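/- **Setting.** Let $d\ge 1$ and let $\mathbb B(\mathbb Z^d)$ be the set of nearest-neighbour (unordered) edges of $\mathbb Z^d$. A configuration $\omega$ assigns to each edge $\langle x,y\rangle$ a conductance $a_{xy}(\omega)=a_{yx}(\omega)$; the space $\Omega$ of configurations carries the product $\sigma$-algebra and the shifts $\tau_x$, $x\in\mathbb Z^d$, given by $a_{yz}(\tau_x\omega)=a_{x+y,x+z}(\omega)$. Put $(\mathcal L_\omega f)(x)=\sum_{y\colon\langle x,y\rangle\in\mathbb B(\mathbb Z^d)}a_{xy}(\omega)[f(y)-f(x)]$. Let $\mathbb P$ be a probability measure on $\Omega$, with expectation $\mathbb E$. *Infinite volume.* An infinite-volume harmonic coordinate for $\mathbb P$ is a function $\psi\colon\Omega\times\mathbb Z^d\to\mathbb R^d$, with $\psi(\cdot,x)$ $\mathbb P$-measurable for each $x$, such that 1. for $\mathbb P$-a.e. $\omega$: $\mathcal L_\omega\psi(\omega,x)=0$ for all $x\in\mathbb Z^d$; 2. for $\mathbb P$-a.e. $\omega$: $\psi(\omega,0)=0$ and $\psi(\omega,y)-\psi(\omega,x)=\psi(\tau_x\omega,y-x)$ for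 all $x,y\in\mathbb Z^d$; 3. $\mathbb E\bigl(\sum_{i=1}^d a_{0,\hat e_i}(\omega)\,|\psi(\omega,\hat e_i)|^2\bigr)<\infty$; 4. $\mathbb E\bigl(|\psi(\omega,x)-x|^2\bigr)/|x|^2\to0$ as $|x|\to\infty$. *Finite volume.* Let $\Lambda_L=[0,L)^d\cap\mathbb Z^d$. For finite $\Lambda\subset\mathbb Z^d$ let $\partial\Lambda$ be the set of vertices outside $\Lambda$ that have a neighbour in $\Lambda$, let $\mathbb B(\Lambda)$ be the set of edges with at least one endpoint in $\Lambda$, and, if all conductances of $\omega$ are positive, let $\Psi_\Lambda(\omega,\cdot)\colon\Lambda\cup\partial\Lambda\to\mathbb R^d$ be the unique solution of $\mathcal L_\omega\Psi_\Lambda(\omega,x)=0$ for $x\in\Lambda$, $\Psi_\Lambda(\omega,x)=x$ for $x\in\partial\Lambda$. *Norms.* With $|\cdot|$ the Euclidean norm, $$\|\nabla f\|_{\Lambda,p}=\Bigl(\frac1{|\Lambda|}\sum_{\langle x,y\rangle\in\mathbb B(\Lambda)}\mathbb E|f(\omega,y)-f(\omega,x)|^p\Bigr)^{1/p},\qquad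 \|\nabla\varphi\|_p=\Bigl(\sum_{i=1}^d\mathbb E|\varphi(\omega,\hat e_i)-\varphi(\omega,0)|^p\Bigr)^{1/p}.$$ **Proposition (Meyers' estimate).** For each $d\ge1$ there is $\lambda=\lambda(d)\in(0,1)$ such that the following holds. Let $\mathbb P$ be any probability measure on $\Omega$ that is invariant and ergodic with respect to the shifts $(\tau_x)_{x\in\mathbb Z^d}$ and for which, $\mathbb P$-a.s., $\lambda\le a_{xy}\le 1/\lambda$ for all $\langle x,y\rangle\in\mathbb B(\mathbb Z^d)$. Then an infinite-volume harmonic coordinate for $\mathbb P$ exists, and there is $p>4$ (real) such that every infinite-volume harmonic coordinate $\psi$ for $\mathbb P$ satisfies $$\|\nabla\psi\|_p<\infty\qquad\text{and}\qquad \sup_{L\ge1}\bigl\|\nabla(\Psi_{\Lambda_L}-\psi)\bigr\|_{\Lambda_L,p}<\infty.$$ -/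

import Mathlib

open MeasureTheory Filter Topology
open scoped ENNReal

noncomputable section

namespace RandomConductance

/-- Vertices of the hypercubic lattice `ℤ^d`. -/
abbrev Vertex (d : ℕ) : Type := Fin d → ℤ

/-- Euclidean space `ℝ^d`, with the Euclidean norm. -/
abbrev Vec (d : ℕ) : Type := EuclideanSpace ℝ (Fin d)

/-- Unordered nearest-neighbour edges of `ℤ^d`: the pair `(x, i)` stands for the edge between
`x` and `x + e i`. -/
abbrev Edge (d : ℕ) : Type := Vertex d × Fin d

/-- Conductance configurations, with the product sigma-algebra; `ω (x, i)` is the conductance of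
the edge between `x` and `x + e i`. -/
abbrev Config (d : ℕ) : Type := Edge d → ℝ

/-- The `i`-th unit coordinate vector, as a lattice point. -/
def e {d : ℕ} (i : Fin d) : Vertex d := Pi.single i 1

/-- The inclusion of `ℤ^d` in `ℝ^d`. -/
def toVec {d : ℕ} (x : Vertex d) : Vec d := WithLp.toLp 2 fun i => (x i : ℝ)

/-- The shift by `x` on configurations: `a_{yz}(τ_x ω) = a_{x+y,x+z}(ω)`. -/
def shift {d : ℕ} (x : Vertex d) (ω : Config d) : Config d := fun b => ω (x + b.1, b.2)

/-- The law `P` is invariant and ergodic with respect to the shifts of `ℤ^d`. -/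
structure IsShiftErgodic {d : ℕ} (P : Measure (Config d)) : Prop where
  measurePreserving : ∀ x : Vertex d, MeasurePreserving (shift x) P P
  zero_or_one : ∀ A : Set (Config d), MeasurableSet A →
    (∀ x : Vertex d, shift x ⁻¹' A = A) → P A = 0 ∨ P A = 1

/-- Uniform ellipticity: all conductances lie in `[lam, 1 / lam]`. -/
def IsElliptic {d : ℕ} (lam : ℝ) (ω : Config d) : Prop :=
  ∀ b : Edge d, lam ≤ ω b ∧ ω b ≤ 1 / lam

/-- The operator `(L_ω f)(x) = ∑_{y ∼ x} a_{xy}(ω) (f y - f x)`. The neighbours of `x` are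
`x + e i`, along the edge `(x, i)`, and `x - e i`, along the edge `(x - e i, i)`. -/
def laplacian {d : ℕ} {V : Type*} [AddCommGroup V] [Module ℝ V] (ω : Config d)
    (f : Vertex d → V) (x : Vertex d) : V :=
  ∑ i : Fin d, (ω (x, i) • (f (x + e i) - f x) + ω (x - e i, i) • (f (x - e i) - f x))

/-- `f` is the finite-volume harmonic coordinate in `Λ`: `L_ω f = 0` in `Λ` and `f x = x` on the
outer boundary of `Λ`. The values farther out, which `L_ω f` on `Λ` does not see, are fixed
to be `f x = x` too. -/
def IsFiniteVolumeCoordinate {d : ℕ} (ω : Config d) (Λ : Finset (Vertex d))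
    (f : Vertex d → Vec d) : Prop :=
  (∀ x ∈ Λ, laplacian ω f x = 0) ∧ ∀ x ∉ Λ, f x = toVec x

/-- The finite-volume harmonic coordinate `Ψ_Λ(ω, ·)`: the solution of the Dirichlet problem, which
exists and is unique as soon as the conductances are positive and `d ≥ 1`; see
`finiteVolumeCoordinate_spec` and `finiteVolumeCoordinate_unique`. -/
def finiteVolumeCoordinate {d : ℕ} (Λ : Finset (Vertex d)) (ω : Config d) : Vertex d → Vec d :=
  Classical.epsilon (IsFiniteVolumeCoordinate ω Λ)

/-- `ψ` is an infinite-volume harmonic coordinate for the conductance law `P`. -/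
structure IsHarmonicCoordinate {d : ℕ} (P : Measure (Config d))
    (ψ : Config d → Vertex d → Vec d) : Prop where
  aemeasurable : ∀ x, AEMeasurable (fun ω => ψ ω x) P
  /-- `ψ` is harmonic. -/
  harmonic : ∀ᵐ ω ∂P, ∀ x, laplacian ω (ψ ω) x = 0
  /-- `ψ` is shift covariant. -/
  covariant : ∀ᵐ ω ∂P, ψ ω 0 = 0 ∧ ∀ x y, ψ ω y - ψ ω x = ψ (shift x ω) (y - x)
  /-- `ψ` is square integrable. -/
  square_integrable :
    ∫⁻ ω, ∑ i : Fin d, ENNReal.ofReal (ω (0, i)) * ‖ψ ω (e i)‖ₑ ^ 2 ∂P < ∞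
  /-- The corrector `ψ(ω, x) - x` satisfies `E |ψ(ω, x) - x|² / |x|² → 0` as `|x| → ∞`. -/
  sublinear : Tendsto
    (fun x : Vertex d => (∫⁻ ω, ‖ψ ω x - toVec x‖ₑ ^ 2 ∂P) / ‖toVec x‖ₑ ^ 2)
    (comap (fun x : Vertex d => ‖toVec x‖) atTop) (𝓝 0)

/-- The box `Λ_L = [0, L)^d ∩ ℤ^d`. -/
def box (d L : ℕ) : Finset (Vertex d) := Fintype.piFinset fun _ => Finset.Ico 0 (L : ℤ)

/-- The edges with at least one endpoint in `Λ`; see `mem_edges`. -/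
def edges {d : ℕ} (Λ : Finset (Vertex d)) : Finset (Edge d) :=
  Λ ×ˢ Finset.univ ∪ (Λ ×ˢ Finset.univ).image fun b : Edge d => (b.1 - e b.2, b.2)

/-- The norm `‖∇f‖_{Λ,p} = (|Λ|⁻¹ ∑_{⟨x,y⟩ ∈ 𝔹(Λ)} E |f(ω, y) - f(ω, x)|^p)^{1/p}`. -/
def boxGradNorm {d : ℕ} (P : Measure (Config d)) (Λ : Finset (Vertex d)) (p : ℝ)
    (f : Config d → Vertex d → Vec d) : ℝ≥0∞ :=
  ((Λ.card : ℝ≥0∞)⁻¹ *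
    ∑ b ∈ edges Λ, ∫⁻ ω, ‖f ω (b.1 + e b.2) - f ω b.1‖ₑ ^ p ∂P) ^ (1 / p)

/-- The norm `‖∇φ‖_p = (∑_i E |φ(ω, e_i) - φ(ω, 0)|^p)^{1/p}`. -/
def gradNorm {d : ℕ} (P : Measure (Config d)) (p : ℝ)
    (φ : Config d → Vertex d → Vec d) : ℝ≥0∞ :=
  (∑ i : Fin d, ∫⁻ ω, ‖φ ω (e i) - φ ω 0‖ₑ ^ p ∂P) ^ (1 / p)

/-! ### Sanity facts: the edge set of `Λ` and the well-posedness of the Dirichlet problem -/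

theorem mem_edges {d : ℕ} (Λ : Finset (Vertex d)) (b : Edge d) :
    b ∈ edges Λ ↔ b.1 ∈ Λ ∨ b.1 + e b.2 ∈ Λ := by
  obtain ⟨x, i⟩ := b
  simp only [edges, Finset.mem_union, Finset.mem_product, Finset.mem_univ, and_true,
    Finset.mem_image, Prod.mk.injEq, Prod.exists]
  constructor
  · rintro (h | ⟨y, j, hy, rfl, rfl⟩)
    · exact Or.inl h
    · right; simpa using hy
  · rintro (h | h)
    · exact Or.inl h
    · exact Or.inr ⟨x + e i, i, h, by simp, rfl⟩

/-- Weak maximum principle: a function that is harmonic in `Λ` and vanishes outside is `≤ 0`. -/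
theorem nonpos_of_harmonic {d : ℕ} (hd : 1 ≤ d) {ω : Config d} (hω : ∀ b, 0 < ω b)
    {Λ : Finset (Vertex d)} {u : Vertex d → ℝ} (h : ∀ x ∈ Λ, laplacian ω u x = 0)
    (h0 : ∀ x ∉ Λ, u x = 0) (x : Vertex d) : u x ≤ 0 := by
  by_contra! hx
  have hxΛ : x ∈ Λ := by
    by_contra hn
    exact hx.ne' (h0 x hn)
  obtain ⟨m, hm, hmax⟩ := Finset.exists_max_image Λ u ⟨x, hxΛ⟩
  have hpos : 0 < u m := hx.trans_le (hmax x hxΛ)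
  have hall : ∀ y, u y ≤ u m := fun y => by
    by_cases hy : y ∈ Λ
    · exact hmax y hy
    · rw [h0 y hy]; exact hpos.le
  let i : Fin d := ⟨0, hd⟩
  have step : ∀ y, u y = u m → u (y + e i) = u m := by
    intro y hy
    have hyΛ : y ∈ Λ := by
      by_contra hn
      rw [h0 y hn] at hy
      exact hpos.ne hy
    have hs := h y hyΛ
    unfold laplacian at hs
    have hle : ∀ z, u z - u y ≤ 0 := fun z => by rw [hy]; linarith [hall z]
    rw [Finset.sum_eq_zero_iff_of_nonpos] at hs
    · have hi := hs i (Finset.mem_univ i)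
      have h1 := mul_nonpos_of_nonneg_of_nonpos (hω (y, i)).le (hle (y + e i))
      have h2 := mul_nonpos_of_nonneg_of_nonpos (hω (y - e i, i)).le (hle (y - e i))
      simp only [smul_eq_mul] at hi
      have h3 : ω (y, i) * (u (y + e i) - u y) = 0 := by linarith
      rcases mul_eq_zero.1 h3 with h4 | h4
      · exact absurd h4 (hω _).ne'
      · linarith
    · intro j _
      have h1 := mul_nonpos_of_nonneg_of_nonpos (hω (y, j)).le (hle (y + e j))
      have h2 := mul_nonpos_of_nonneg_of_nonpos (hω (y - e j, j)).le (hle (y - e j))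
      simp only [smul_eq_mul]
      linarith
  have hit : ∀ n : ℕ, u (m + n • e i) = u m := by
    intro n
    induction n with
    | zero => simp
    | succ k ih => rw [succ_nsmul, ← add_assoc]; exact step _ ih
  have hmem : ∀ n : ℕ, m + n • e i ∈ Λ := by
    intro n
    by_contra hn
    have := hit n
    rw [h0 _ hn] at this
    exact hpos.ne this
  have hinj : Function.Injective fun n : ℕ => m + n • (e i : Vertex d) := by
    intro a b hab
    have := congrFun hab i
    simpa [e] using this
  exact Set.infinite_of_injective_forall_mem hinj hmem Λ.finite_toSet

theorem eq_zero_of_harmonic {d : ℕ} (hd : 1 ≤ d) {ω : Config d} (hω : ∀ b, 0 < ω b)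
    {Λ : Finset (Vertex d)} {u : Vertex d → Vec d} (h : ∀ x ∈ Λ, laplacian ω u x = 0)
    (h0 : ∀ x ∉ Λ, u x = 0) (x : Vertex d) : u x = 0 := by
  ext k
  have hk : ∀ y, laplacian ω (fun z => u z k) y = (laplacian ω u y) k := fun y => by
    simp [laplacian]
  have hneg : ∀ y, laplacian ω (fun z => -u z k) y = -(laplacian ω u y) k := fun y => by
    simp only [laplacian, WithLp.ofLp_sum, Finset.sum_apply, ← Finset.sum_neg_distrib]
    refine Finset.sum_congr rfl fun i _ => ?_
    simp
    ring
  have h1 := nonpos_of_harmonic hd hω (u := fun z => u z k)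
    (fun y hy => by rw [hk, h y hy]; rfl) (fun y hy => by simp [h0 y hy]) x
  have h2 := nonpos_of_harmonic hd hω (u := fun z => -u z k)
    (fun y hy => by rw [hneg, h y hy]; simp) (fun y hy => by simp [h0 y hy]) x
  simp only [PiLp.zero_apply]
  linarith

theorem laplacian_add {d : ℕ} (ω : Config d) (f g : Vertex d → Vec d) (x : Vertex d) :
    laplacian ω (fun y => f y + g y) x = laplacian ω f x + laplacian ω g x := by
  simp only [laplacian, ← Finset.sum_add_distrib]
  refine Finset.sum_congr rfl fun i _ => ?_
  module

theorem laplacian_smul {d : ℕ} (ω : Config d) (c : ℝ) (f : Vertex d → Vec d) (x : Vertex d) :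
    laplacian ω (fun y => c • f y) x = c • laplacian ω f x := by
  simp only [laplacian, Finset.smul_sum]
  refine Finset.sum_congr rfl fun i _ => ?_
  module

theorem exists_isFiniteVolumeCoordinate {d : ℕ} (hd : 1 ≤ d) {ω : Config d} (hω : ∀ b, 0 < ω b)
    (Λ : Finset (Vertex d)) : ∃ f, IsFiniteVolumeCoordinate ω Λ f := by
  classical
  let ext : (Λ → Vec d) → Vertex d → Vec d := fun u y => if hy : y ∈ Λ then u ⟨y, hy⟩ else 0
  have ext_add : ∀ u v, ext (u + v) = fun y => ext u y + ext v y := fun u v => by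
    funext y
    by_cases hy : y ∈ Λ <;> simp [ext, hy]
  have ext_smul : ∀ (c : ℝ) u, ext (c • u) = fun y => c • ext u y := fun c u => by
    funext y
    by_cases hy : y ∈ Λ <;> simp [ext, hy]
  let T : (Λ → Vec d) →ₗ[ℝ] (Λ → Vec d) :=
    { toFun := fun u x => laplacian ω (ext u) x
      map_add' := fun u v => by
        funext x
        simp only [ext_add, laplacian_add, Pi.add_apply]
      map_smul' := fun c u => by
        funext x
        simp only [ext_smul, laplacian_smul, Pi.smul_apply, RingHom.id_apply] }
  have hinj : Function.Injective T := by
    rw [← LinearMap.ker_eq_bot, LinearMap.ker_eq_bot']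
    intro u hu
    funext x
    have := eq_zero_of_harmonic hd hω (Λ := Λ) (u := ext u)
      (fun y hy => congrFun hu ⟨y, hy⟩) (fun y hy => by simp [ext, hy]) x
    simpa [ext] using this
  obtain ⟨w, hw⟩ := LinearMap.injective_iff_surjective.1 hinj fun x => -laplacian ω toVec x
  refine ⟨fun y => toVec y + ext w y, fun x hx => ?_, fun x hx => by simp [ext, hx]⟩
  have hwx : laplacian ω (ext w) x = -laplacian ω toVec x := congrFun hw ⟨x, hx⟩
  rw [laplacian_add, hwx, add_neg_cancel]

theorem finiteVolumeCoordinate_spec {d : ℕ} (hd : 1 ≤ d) {ω : Config d} (hω : ∀ b, 0 < ω b)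
    (Λ : Finset (Vertex d)) : IsFiniteVolumeCoordinate ω Λ (finiteVolumeCoordinate Λ ω) :=
  Classical.epsilon_spec (exists_isFiniteVolumeCoordinate hd hω Λ)

theorem finiteVolumeCoordinate_unique {d : ℕ} (hd : 1 ≤ d) {ω : Config d} (hω : ∀ b, 0 < ω b)
    {Λ : Finset (Vertex d)} {f : Vertex d → Vec d} (hf : IsFiniteVolumeCoordinate ω Λ f) :
    f = finiteVolumeCoordinate Λ ω := by
  have hg := finiteVolumeCoordinate_spec hd hω Λ
  funext x
  have := eq_zero_of_harmonic hd hω (Λ := Λ)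
    (u := fun y => f y + (-1 : ℝ) • finiteVolumeCoordinate Λ ω y)
    (fun y hy => by rw [laplacian_add, laplacian_smul, hf.1 y hy, hg.1 y hy]; simp)
    (fun y hy => by rw [hf.2 y hy, hg.2 y hy]; simp) x
  simpa [← sub_eq_add_neg, sub_eq_zero] using this

end RandomConductance

end

noncomputable section

namespace RandomConductance

/-! The exponent is `p = 6`, and the ellipticity constant is chosen so close to `1` that every
conductance differs from `1` by at most `ellipticGap d`. The equation is then a small perturbation
of the one with constant coefficients, and Meyers' argument reduces the sixth-power gradient bound
to the boundedness of `∇Δ⁻¹∇*` on `ℓ⁶` with a norm depending on `d` only.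

That boundedness is proved on finite abelian groups by a Bellman function. `bellman_gap` is a Jensen
inequality with a gain: averaging `bellman` over the neighbours of a point exceeds its value at the
averages by a multiple of the product of the oscillations of the two arguments. Along the semigroup
of a lazy walk this gain telescopes, so the space-time sum of `|∇Pⁿf| |∇Pⁿh|` is controlled by
`‖f‖₆⁶ + ‖h‖_{6/5}^{6/5}` up to constants (`bilinear_embedding`). Writing `∇Δ⁻¹∇*` as a sum over the
times of the walk gives `riesz_bilinear`, duality gives `gradient_pow_six_le`, and absorbing the
perturbation gives `gradient_pow_six_le_of_near_one`. Odd reflection turns the Dirichlet problem in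
a box into an equation on a torus, whence the deterministic bound `∑ |∇Ψ|⁶ ≤ C L^d`
(`finiteVolumeCoordinate_gradient_le`).

The bound passes to `ψ` by comparison in energy. The difference `Ψ - ψ` is harmonic in the box with
boundary values given by the corrector `χ = ψ - x`, so its energy is at most that of a cutoff of `χ`
near the boundary. By stationarity and sublinearity this is `o(L^d)` on average. Since `min(|∇ψ|,
M)⁶ ≤ 64 (|∇Ψ|⁶ + M⁴ |∇(Ψ - ψ)|²)`, the truncated sixth moment of `∇ψ` is bounded uniformly in `M`
(`truncated_moment_le_const`). Monotone convergence gives the first estimate and the triangle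
inequality the second.

Existence is the Hilbert space argument: the constant fields `e i`, weighted by square roots of the
conductances, are projected on the closure of weighted gradients of `L²(P)` functions
(`exists_corrector`). -/

/-! ### A Bellman function for the exponents `6` and `6/5` -/

/-- The real fifth root of a nonnegative number. -/
def fifthRoot (t : ℝ) : ℝ := t ^ (1 / 5 : ℝ)

theorem fifthRoot_nonneg {t : ℝ} (ht : 0 ≤ t) : 0 ≤ fifthRoot t := Real.rpow_nonneg ht _

theorem fifthRoot_pow {t : ℝ} (ht : 0 ≤ t) : fifthRoot t ^ 5 = t := by
  rw [fifthRoot, ← Real.rpow_natCast, ← Real.rpow_mul ht]; norm_num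

theorem fifthRoot_mono {s t : ℝ} (hs : 0 ≤ s) (h : s ≤ t) : fifthRoot s ≤ fifthRoot t :=
  Real.rpow_le_rpow hs h (by norm_num)

theorem fifthRoot_of_pow {t : ℝ} (ht : 0 ≤ t) : fifthRoot (t ^ 5) = t := by
  rw [fifthRoot, ← Real.rpow_natCast, ← Real.rpow_mul ht]; norm_num

/-- The family of functions whose upper envelope over `k ≥ h ^ (1/5)` is the main part of the
Bellman function. -/
def bellmanAux (f k : ℝ) : ℝ := f ^ 2 * k ^ 4 - 2 / 3 * k ^ 6

/-- The Bellman function. -/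
def bellman (C f h : ℝ) : ℝ :=
  bellmanAux f (max f (fifthRoot h)) + C * fifthRoot h ^ 6

/-- The deficit is one third of `(f² - k²)² (f² + 2k²)`, so `k = f` is the unconstrained maximiser
over `k ≥ 0`. -/
theorem bellmanAux_le_pow (f k : ℝ) : bellmanAux f k ≤ f ^ 6 / 3 := by
  have h : 0 ≤ (f ^ 2 - k ^ 2) ^ 2 * (f ^ 2 + 2 * k ^ 2) := by positivity
  unfold bellmanAux
  nlinarith [h]

/-- In `k`, the function increases up to `k = f` and decreases afterwards. Hence the constrained
supremum is attained at `max f k₀`, and any `k ≥ k₀` may serve as a competitor in a lower bound for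
`bellman`. -/
theorem bellmanAux_le_max {f k k₀ : ℝ} (hf : 0 ≤ f) (hk₀ : 0 ≤ k₀) (hk : k₀ ≤ k) :
    bellmanAux f k ≤ bellmanAux f (max f k₀) := by
  rcases le_total k₀ f with h | h
  · rw [max_eq_left h]
    refine (bellmanAux_le_pow f k).trans (le_of_eq ?_)
    unfold bellmanAux; ring
  · rw [max_eq_right h]
    unfold bellmanAux
    have hA : f ^ 2 ≤ k₀ ^ 2 := pow_le_pow_left₀ hf h 2
    have hB : k₀ ^ 2 ≤ k ^ 2 := pow_le_pow_left₀ hk₀ hk 2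
    have h4 : k₀ ^ 4 ≤ k ^ 4 := pow_le_pow_left₀ hk₀ hk 4
    have h1 := mul_le_mul_of_nonneg_right hA (sub_nonneg.2 h4)
    have h2 : 0 ≤ (k ^ 2 - k₀ ^ 2) ^ 2 * (2 * k ^ 2 + k₀ ^ 2) := by positivity
    nlinarith [h1, h2]

theorem bellman_nonneg {C f h : ℝ} (hC : 1 ≤ C) (hf : 0 ≤ f) (hh : 0 ≤ h) :
    0 ≤ bellman C f h := by
  have h1 := bellmanAux_le_max hf (fifthRoot_nonneg hh) le_rfl
  have h2 : 0 ≤ fifthRoot h ^ 6 := by positivity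
  have h3 : 0 ≤ f ^ 2 * fifthRoot h ^ 4 := by positivity
  have h4 : bellmanAux f (fifthRoot h) = f ^ 2 * fifthRoot h ^ 4 - 2 / 3 * fifthRoot h ^ 6 := rfl
  unfold bellman
  nlinarith

theorem bellman_le {C f h : ℝ} : bellman C f h ≤ f ^ 6 + C * fifthRoot h ^ 6 := by
  have h1 := bellmanAux_le_pow f (max f (fifthRoot h))
  have h2 : 0 ≤ f ^ 6 := by positivity
  unfold bellman
  linarith

/-- Second-order expansions of the powers of order `4/5` and `6/5`, in terms of fifth roots. -/
theorem pow_four_six_expansion {ρ R : ℝ} (hR : 0 < R) (hρ : 0 ≤ ρ) :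
    R ^ 4 + 4 / 5 * R⁻¹ * (ρ ^ 5 - R ^ 5) - R⁻¹ ^ 6 * (ρ ^ 5 - R ^ 5) ^ 2 ≤ ρ ^ 4 ∧
      R * |ρ ^ 4 - R ^ 4| ≤ |ρ ^ 5 - R ^ 5| ∧
      ρ ^ 6 ≤ R ^ 6 + 6 / 5 * R * (ρ ^ 5 - R ^ 5) + R⁻¹ ^ 4 * (ρ ^ 5 - R ^ 5) ^ 2 := by
  set S := R⁻¹ with hS
  have hSR : S * R = 1 := inv_mul_cancel₀ hR.ne'
  have hS0 : 0 < S := inv_pos.2 hR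
  -- `Q` is the difference quotient `(ρ⁵ - R⁵) / (ρ - R)`. All three estimates factor out a power of
  -- `ρ - R` and then use `Q ≥ R⁴`.
  obtain ⟨Q, hQ⟩ : ∃ Q, Q = ρ ^ 4 + ρ ^ 3 * R + ρ ^ 2 * R ^ 2 + ρ * R ^ 3 + R ^ 4 := ⟨_, rfl⟩
  obtain ⟨δ, hδ⟩ : ∃ δ, δ = ρ ^ 5 - R ^ 5 := ⟨_, rfl⟩
  rw [← hδ]
  have hδQ : δ = (ρ - R) * Q := by rw [hδ, hQ]; ring
  have hQR : R ^ 4 ≤ Q := by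
    have : 0 ≤ ρ ^ 4 + ρ ^ 3 * R + ρ ^ 2 * R ^ 2 + ρ * R ^ 3 := by positivity
    rw [hQ]; linarith
  have hQ0 : 0 < Q := lt_of_lt_of_le (by positivity) hQR
  have hone : 1 ≤ S ^ 4 * Q := by
    calc (1 : ℝ) = S ^ 4 * R ^ 4 := by rw [← mul_pow, hSR, one_pow]
      _ ≤ S ^ 4 * Q := by gcongr
  refine ⟨?_, ?_, ?_⟩
  · have e1 : R * ρ ^ 4 - R ^ 5 - 4 / 5 * δ =
        -(1 / 5) * ((ρ - R) ^ 2 * (4 * ρ ^ 3 + 3 * ρ ^ 2 * R + 2 * ρ * R ^ 2 + R ^ 3)) := by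
      rw [hδ]; ring
    have e2 : 4 * ρ ^ 3 + 3 * ρ ^ 2 * R + 2 * ρ * R ^ 2 + R ^ 3 ≤ 4 * (S * Q) := by
      have : S * Q = S * ρ ^ 4 + (S * R) * (ρ ^ 3 + ρ ^ 2 * R + ρ * R ^ 2 + R ^ 3) := by
        rw [hQ]; ring
      rw [this, hSR]
      have : 0 ≤ S * ρ ^ 4 := by positivity
      have : 0 ≤ ρ ^ 2 * R := by positivity
      have : 0 ≤ ρ * R ^ 2 := by positivity
      have : 0 ≤ R ^ 3 := by positivity
      linarith
    have e3 : S * Q ≤ S ^ 5 * Q ^ 2 := by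
      have h := mul_le_mul_of_nonneg_left hone (by positivity : 0 ≤ S * Q)
      calc S * Q = S * Q * 1 := (mul_one _).symm
        _ ≤ S * Q * (S ^ 4 * Q) := h
        _ = _ := by ring
    have e4 : R ^ 5 + 4 / 5 * δ - S ^ 5 * δ ^ 2 ≤ R * ρ ^ 4 := by
      have h := mul_le_mul_of_nonneg_left (e2.trans (mul_le_mul_of_nonneg_left e3 (by norm_num)))
        (sq_nonneg (ρ - R))
      have h' : (ρ - R) ^ 2 * (4 * (S ^ 5 * Q ^ 2)) = 4 * (S ^ 5 * δ ^ 2) := by rw [hδQ]; ring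
      have : 0 ≤ S ^ 5 * δ ^ 2 := by positivity
      linarith
    have h := mul_le_mul_of_nonneg_left e4 hS0.le
    have h1 : S * (R * ρ ^ 4) = ρ ^ 4 := by rw [← mul_assoc, hSR, one_mul]
    have h2 : S * R ^ 5 = R ^ 4 := by
      calc S * R ^ 5 = (S * R) * R ^ 4 := by ring
        _ = R ^ 4 := by rw [hSR, one_mul]
    have h3 : S * (R ^ 5 + 4 / 5 * δ - S ^ 5 * δ ^ 2) =
        S * R ^ 5 + 4 / 5 * S * δ - S ^ 6 * δ ^ 2 := by ring
    linarith
  · have h1 : R * |ρ ^ 4 - R ^ 4| = |ρ - R| * (ρ ^ 3 * R + ρ ^ 2 * R ^ 2 + ρ * R ^ 3 + R ^ 4) := by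
      have h : R * (ρ ^ 4 - R ^ 4) =
          (ρ - R) * (ρ ^ 3 * R + ρ ^ 2 * R ^ 2 + ρ * R ^ 3 + R ^ 4) := by ring
      have h' : R * |ρ ^ 4 - R ^ 4| = |R * (ρ ^ 4 - R ^ 4)| := by rw [abs_mul, abs_of_pos hR]
      rw [h', h, abs_mul]
      congr 1
      exact abs_of_nonneg (by positivity)
    rw [h1, hδQ, abs_mul, abs_of_pos hQ0]
    refine mul_le_mul_of_nonneg_left ?_ (abs_nonneg _)
    have : 0 ≤ ρ ^ 4 := by positivity
    rw [hQ]; linarith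
  · have h1 : ρ ^ 6 - R ^ 6 - 6 / 5 * R * δ = (ρ - R) ^ 2 *
        (ρ ^ 4 + 4 / 5 * ρ ^ 3 * R + 3 / 5 * ρ ^ 2 * R ^ 2 + 2 / 5 * ρ * R ^ 3 + 1 / 5 * R ^ 4) := by
      rw [hδ]; ring
    have h2 : ρ ^ 4 + 4 / 5 * ρ ^ 3 * R + 3 / 5 * ρ ^ 2 * R ^ 2 + 2 / 5 * ρ * R ^ 3
        + 1 / 5 * R ^ 4 ≤ Q := by
      have a1 : 0 ≤ ρ ^ 3 * R := by positivity
      have a2 : 0 ≤ ρ ^ 2 * R ^ 2 := by positivity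
      have a3 : 0 ≤ ρ * R ^ 3 := by positivity
      have a4 : 0 ≤ R ^ 4 := by positivity
      rw [hQ]; linarith
    have h3 : Q ≤ S ^ 4 * Q ^ 2 := by
      calc Q = 1 * Q := (one_mul _).symm
        _ ≤ S ^ 4 * Q * Q := mul_le_mul_of_nonneg_right hone hQ0.le
        _ = _ := by ring
    have h4 := mul_le_mul_of_nonneg_left (h2.trans h3) (sq_nonneg (ρ - R))
    have h5 : (ρ - R) ^ 2 * (S ^ 4 * Q ^ 2) = S ^ 4 * δ ^ 2 := by rw [hδQ]; ring
    linarith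

/-- This compares `bellmanAux` with its tangent plane at `(F, R)` in the variables `f` and `t = ρ⁵`.
There is a quadratic gain in `f`. The quadratic loss in `t` is later paid for by the strong
convexity of `t ^ (6/5)`. The bound `f ≤ κF` keeps the gain when `ρ` is much smaller than `R`. -/
theorem bellmanAux_lower {κ f F ρ R : ℝ} (hκ : 1 ≤ κ) (hR : 0 < R) (hρ : 0 ≤ ρ)
    (hF : 0 ≤ F) (hFR : F ≤ R) (hf : 0 ≤ f) (hfF : f ≤ κ * F) :
    bellmanAux F R + 2 * F * R ^ 4 * (f - F) +
      (4 / 5 * F ^ 2 * R⁻¹ - 4 / 5 * R) * (ρ ^ 5 - R ^ 5)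
      + 1 / 4 * R ^ 4 * (f - F) ^ 2 - 8 * κ ^ 2 * (R⁻¹) ^ 4 * (ρ ^ 5 - R ^ 5) ^ 2
      ≤ bellmanAux f ρ := by
  obtain ⟨e5, e7, e10⟩ := pow_four_six_expansion hR hρ
  set S := R⁻¹ with hS
  have hSR : S * R = 1 := inv_mul_cancel₀ hR.ne'
  have hS0 : 0 < S := inv_pos.2 hR
  generalize ρ ^ 5 - R ^ 5 = δ at *
  obtain ⟨x, hx⟩ : ∃ x, x = f - F := ⟨_, rfl⟩
  have hFS : F ^ 2 * S ^ 2 ≤ 1 := by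
    calc F ^ 2 * S ^ 2 ≤ R ^ 2 * S ^ 2 := by gcongr
      _ = (S * R) ^ 2 := by ring
      _ = 1 := by rw [hSR, one_pow]
  obtain ⟨E, hE⟩ : ∃ E, E = S ^ 4 * δ ^ 2 := ⟨_, rfl⟩
  have hE0 : 0 ≤ E := by rw [hE]; positivity
  have e6 : F ^ 2 * R ^ 4 + 4 / 5 * F ^ 2 * S * δ - E ≤ F ^ 2 * ρ ^ 4 := by
    have h := mul_le_mul_of_nonneg_left e5 (sq_nonneg F)
    have h1 := mul_le_mul_of_nonneg_right hFS hE0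
    have h2 : F ^ 2 * S ^ 2 * E = F ^ 2 * (S ^ 6 * δ ^ 2) := by rw [hE]; ring
    linarith
  have e8 : -(1 / 4 * R ^ 4 * x ^ 2) - 4 * E ≤ 2 * F * x * (ρ ^ 4 - R ^ 4) := by
    have h1 : |2 * F * x * (ρ ^ 4 - R ^ 4)| ≤ 2 * |x| * |δ| := by
      rw [abs_mul, abs_mul, abs_mul, abs_of_nonneg hF, abs_two]
      calc 2 * F * |x| * |ρ ^ 4 - R ^ 4| ≤ 2 * R * |x| * |ρ ^ 4 - R ^ 4| := by gcongr
        _ = 2 * |x| * (R * |ρ ^ 4 - R ^ 4|) := by ring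
        _ ≤ 2 * |x| * |δ| := by gcongr
    have h2 : 2 * |x| * |δ| ≤ 1 / 4 * R ^ 4 * x ^ 2 + 4 * E := by
      have h := sq_nonneg (1 / 2 * R ^ 2 * |x| - 2 * S ^ 2 * |δ|)
      have h' : (1 / 2 * R ^ 2 * |x| - 2 * S ^ 2 * |δ|) ^ 2 =
          1 / 4 * R ^ 4 * |x| ^ 2 - 2 * (S * R) ^ 2 * |x| * |δ| + 4 * (S ^ 4 * |δ| ^ 2) := by ring
      rw [h', hSR, sq_abs, sq_abs] at h
      rw [hE]; linarith
    have := neg_abs_le (2 * F * x * (ρ ^ 4 - R ^ 4))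
    linarith
  have hx2 : x ^ 2 ≤ κ ^ 2 * R ^ 2 := by
    have h1 : |x| ≤ κ * R := by
      have hκF : F ≤ κ * F := le_mul_of_one_le_left hF hκ
      have : κ * F ≤ κ * R := by gcongr
      rw [abs_le]; constructor <;> linarith
    calc x ^ 2 = |x| ^ 2 := (sq_abs x).symm
      _ ≤ (κ * R) ^ 2 := by gcongr
      _ = _ := by ring
  -- If `ρ⁴` is less than half of `R⁴`, then `|ρ⁵ - R⁵|` is at least `R⁵ / 2`, and the loss term `E
  -- ≥ R⁶ / 4` alone dominates `R⁴ x²`, because `|x| ≤ κR`.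
  have e9 : 1 / 2 * R ^ 4 * x ^ 2 - 2 * κ ^ 2 * E ≤ x ^ 2 * ρ ^ 4 := by
    rcases le_total (1 / 2 * R ^ 4) (ρ ^ 4) with h | h
    · have := mul_le_mul_of_nonneg_left h (sq_nonneg x)
      have : 0 ≤ 2 * κ ^ 2 * E := by positivity
      linarith
    · have h1 : 1 / 2 * R ^ 5 ≤ |δ| := by
        refine le_trans ?_ e7
        rw [abs_sub_comm]
        have := le_abs_self (R ^ 4 - ρ ^ 4)
        calc 1 / 2 * R ^ 5 = R * (R ^ 4 - 1 / 2 * R ^ 4) := by ring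
          _ ≤ R * |R ^ 4 - ρ ^ 4| := by gcongr; linarith
      have h2 : 1 / 4 * R ^ 6 ≤ E := by
        calc 1 / 4 * R ^ 6 = (S * R) ^ 4 * (1 / 4 * R ^ 6) := by rw [hSR]; ring
          _ = S ^ 4 * (1 / 2 * R ^ 5) ^ 2 := by ring
          _ ≤ S ^ 4 * |δ| ^ 2 := by gcongr
          _ = E := by rw [sq_abs, hE]
      have h3 : 1 / 2 * R ^ 4 * x ^ 2 ≤ 2 * κ ^ 2 * E := by
        calc 1 / 2 * R ^ 4 * x ^ 2 ≤ 1 / 2 * R ^ 4 * (κ ^ 2 * R ^ 2) := by gcongr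
          _ = 2 * κ ^ 2 * (1 / 4 * R ^ 6) := by ring
          _ ≤ 2 * κ ^ 2 * E := by gcongr
      have : 0 ≤ x ^ 2 * ρ ^ 4 := by positivity
      linarith
  rw [← hE] at e10
  have hκE : E ≤ κ ^ 2 * E := le_mul_of_one_le_left hE0 (by nlinarith)
  unfold bellmanAux
  have hexp : f ^ 2 * ρ ^ 4 = F ^ 2 * ρ ^ 4 + 2 * F * x * (ρ ^ 4 - R ^ 4) + 2 * F * R ^ 4 * x
      + x ^ 2 * ρ ^ 4 := by rw [hx]; ring
  have hE8 : 8 * κ ^ 2 * S ^ 4 * δ ^ 2 = 8 * (κ ^ 2 * E) := by rw [hE]; ring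
  rw [hexp, hE8, ← hx]
  linarith

/-- Strong convexity of `t ^ (6/5)` on `[0, κR⁵]`: its second derivative is of order `t ^ (-4/5)`,
hence at least a constant times `R⁻⁴`. The factor `1 / (25κ)` determines `bellmanConst`, which turns
this gain into `8κ² + 1`, one more than the loss in `bellmanAux_lower`. -/
theorem pow_six_lower {κ τ η R : ℝ} (hκ : 1 ≤ κ) (hR : 0 < R) (hτ : 0 ≤ τ) (hη : 0 ≤ η)
    (hηR : η ≤ R) (hτR : τ ^ 5 ≤ κ * R ^ 5) :
    η ^ 6 + 6 / 5 * η * (τ ^ 5 - η ^ 5) + 1 / (25 * κ) * (R⁻¹) ^ 4 * (τ ^ 5 - η ^ 5) ^ 2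
      ≤ τ ^ 6 := by
  set S := R⁻¹ with hS
  have hSR : S * R = 1 := inv_mul_cancel₀ hR.ne'
  have hS0 : 0 < S := inv_pos.2 hR
  have hκ0 : 0 < κ := by linarith
  set Q := τ ^ 4 + τ ^ 3 * η + τ ^ 2 * η ^ 2 + τ * η ^ 3 + η ^ 4 with hQ
  have hQ0 : 0 ≤ Q := by positivity
  have hm : ∃ m, 0 ≤ m ∧ τ ≤ m ∧ η ≤ m ∧ m ^ 4 ≤ κ * R ^ 4 := by
    rcases le_total τ R with h | h
    · exact ⟨R, hR.le, h, hηR, le_mul_of_one_le_left (by positivity) hκ⟩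
    · refine ⟨τ, hτ, le_rfl, hηR.trans h, ?_⟩
      have h1 : R * τ ^ 4 ≤ R * (κ * R ^ 4) := by
        calc R * τ ^ 4 ≤ τ * τ ^ 4 := by gcongr
          _ = τ ^ 5 := by ring
          _ ≤ κ * R ^ 5 := hτR
          _ = _ := by ring
      exact le_of_mul_le_mul_left h1 hR
  obtain ⟨m, hm0, h1, h2, hm4⟩ := hm
  have hQm : Q ≤ 5 * (κ * R ^ 4) := by
    have a0 : τ ^ 4 ≤ m ^ 4 := by gcongr
    have a1 : τ ^ 3 * η ≤ m ^ 3 * m := by gcongr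
    have a2 : τ ^ 2 * η ^ 2 ≤ m ^ 2 * m ^ 2 := by gcongr
    have a3 : τ * η ^ 3 ≤ m * m ^ 3 := by gcongr
    have a4 : η ^ 4 ≤ m ^ 4 := by gcongr
    rw [hQ]; nlinarith
  have h3 : 1 / (25 * κ) * S ^ 4 * Q ^ 2 ≤ 1 / 5 * Q := by
    calc 1 / (25 * κ) * S ^ 4 * Q ^ 2 = 1 / (25 * κ) * S ^ 4 * Q * Q := by ring
      _ ≤ 1 / (25 * κ) * S ^ 4 * Q * (5 * (κ * R ^ 4)) := by gcongr
      _ = (κ * κ⁻¹) * (S * R) ^ 4 * (1 / 5 * Q) := by field_simp; ring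
      _ = 1 / 5 * Q := by rw [hSR, mul_inv_cancel₀ hκ0.ne']; ring
  have h4 : 1 / 5 * Q ≤
      τ ^ 4 + 4 / 5 * τ ^ 3 * η + 3 / 5 * τ ^ 2 * η ^ 2 + 2 / 5 * τ * η ^ 3 + 1 / 5 * η ^ 4 := by
    have a0 : 0 ≤ τ ^ 4 := by positivity
    have a1 : 0 ≤ τ ^ 3 * η := by positivity
    have a2 : 0 ≤ τ ^ 2 * η ^ 2 := by positivity
    have a3 : 0 ≤ τ * η ^ 3 := by positivity
    rw [hQ]; linarith
  have h5 := mul_le_mul_of_nonneg_left (h3.trans h4) (sq_nonneg (τ - η))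
  have h6 : (τ - η) ^ 2 * (1 / (25 * κ) * S ^ 4 * Q ^ 2) =
      1 / (25 * κ) * S ^ 4 * (τ ^ 5 - η ^ 5) ^ 2 := by
    have : τ ^ 5 - η ^ 5 = (τ - η) * Q := by rw [hQ]; ring
    rw [this]; ring
  have h7 : (τ - η) ^ 2 * (τ ^ 4 + 4 / 5 * τ ^ 3 * η + 3 / 5 * τ ^ 2 * η ^ 2 + 2 / 5 * τ * η ^ 3
      + 1 / 5 * η ^ 4) = τ ^ 6 - η ^ 6 - 6 / 5 * η * (τ ^ 5 - η ^ 5) := by ring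
  linarith

/-- The constant in front of the second term of the Bellman function. -/
def bellmanConst (κ : ℝ) : ℝ := 25 * κ * (8 * κ ^ 2 + 1)

theorem one_le_bellmanConst {κ : ℝ} (hκ : 1 ≤ κ) : 1 ≤ bellmanConst κ := by
  have : 1 ≤ κ ^ 2 := by nlinarith
  unfold bellmanConst
  nlinarith

/-- Quantitative Jensen inequality for the Bellman function. -/
theorem bellman_gap {ι : Type*} [Fintype ι] {κ : ℝ} {w f h : ι → ℝ}
    (hw : ∀ y, 1 ≤ κ * w y) (hκ : 1 ≤ κ) (hw1 : ∑ y, w y = 1)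
    (hf : ∀ y, 0 ≤ f y) (hh : ∀ y, 0 ≤ h y) (a b a' b' : ι) :
    bellman (bellmanConst κ) (∑ y, w y * f y) (∑ y, w y * h y) +
        1 / (2 * κ) * (|f a - f b| * |h a' - h b'|)
      ≤ ∑ y, w y * bellman (bellmanConst κ) (f y) (h y) := by
  have hκ0 : 0 < κ := by linarith
  have hw0 : ∀ y, 0 < w y := fun y => by
    by_contra! hn
    have := mul_nonpos_of_nonneg_of_nonpos hκ0.le hn
    linarith [hw y]
  set F := ∑ y, w y * f y with hF
  set H := ∑ y, w y * h y with hH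
  have hle : ∀ g : ι → ℝ, (∀ y, 0 ≤ g y) → ∀ y, g y ≤ κ * ∑ z, w z * g z := fun g hg y => by
    have h1 : w y * g y ≤ ∑ z, w z * g z :=
      Finset.single_le_sum (fun z _ => mul_nonneg (hw0 z).le (hg z)) (Finset.mem_univ y)
    calc g y ≤ κ * w y * g y := le_mul_of_one_le_left (hg y) (hw y)
      _ = κ * (w y * g y) := by ring
      _ ≤ _ := by gcongr
  have hF0 : 0 ≤ F := Finset.sum_nonneg fun y _ => mul_nonneg (hw0 y).le (hf y)
  have hH0 : 0 ≤ H := Finset.sum_nonneg fun y _ => mul_nonneg (hw0 y).le (hh y)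
  set R := max F (fifthRoot H) with hR
  have hR0 : 0 ≤ R := hF0.trans (le_max_left _ _)
  have hηR : fifthRoot H ≤ R := le_max_right _ _
  -- If `R = 0`, then `F = H = 0`. Positivity of the weights makes every `f y` vanish, so the gain
  -- is zero and nonnegativity of `bellman` suffices.
  rcases hR0.eq_or_lt with hR00 | hRpos
  · have hF00 : F = 0 := le_antisymm (hR00 ▸ le_max_left _ _) hF0
    have hf00 : ∀ y, f y = 0 := fun y => le_antisymm (by
      have := hle f hf y; rw [← hF, hF00] at this; simpa using this) (hf y)
    have hH00 : H = 0 := by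
      have h1 : fifthRoot H = 0 := le_antisymm (hR00 ▸ hηR) (fifthRoot_nonneg hH0)
      rw [← fifthRoot_pow hH0, h1]; norm_num
    have h0 : bellman (bellmanConst κ) F H = 0 := by
      rw [hF00, hH00]
      have : fifthRoot 0 = 0 := by rw [fifthRoot]; exact Real.zero_rpow (by norm_num)
      simp [bellman, bellmanAux, this]
    rw [h0, hf00 a, hf00 b]
    simp only [sub_self, abs_zero, zero_mul, mul_zero, add_zero]
    exact Finset.sum_nonneg fun y _ => mul_nonneg (hw0 y).le
      (bellman_nonneg (one_le_bellmanConst hκ) (hf y) (hh y))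
  · have hHR : H ≤ R ^ 5 := by
      rw [← fifthRoot_pow hH0]
      exact pow_le_pow_left₀ (fifthRoot_nonneg hH0) hηR 5
    -- The competitor `ρ = fifthRoot (k y)` has `ρ⁵ - R⁵ = h y - H`, which averages to zero, so the
    -- linear terms cancel. It is admissible because `H ≤ R⁵` gives `k y ≥ h y`.
    set k : ι → ℝ := fun y => R ^ 5 + (h y - H) with hk
    have hkh : ∀ y, h y ≤ k y := fun y => by simp only [hk]; linarith
    have hk0 : ∀ y, 0 ≤ k y := fun y => (hh y).trans (hkh y)
    set S := R⁻¹ with hS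
    have key1 : ∀ y, bellmanAux F R + 2 * F * R ^ 4 * (f y - F) +
        (4 / 5 * F ^ 2 * S - 4 / 5 * R) * (h y - H)
        + 1 / 4 * R ^ 4 * (f y - F) ^ 2 - 8 * κ ^ 2 * S ^ 4 * (h y - H) ^ 2
        ≤ bellmanAux (f y) (max (f y) (fifthRoot (h y))) := fun y => by
      have h1 := bellmanAux_lower hκ hRpos (fifthRoot_nonneg (hk0 y)) hF0 (le_max_left _ _)
        (hf y) (hle f hf y)
      have h2 : fifthRoot (k y) ^ 5 - R ^ 5 = h y - H := by
        rw [fifthRoot_pow (hk0 y)]; simp [hk]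
      rw [h2] at h1
      exact h1.trans (bellmanAux_le_max (hf y) (fifthRoot_nonneg (hh y))
        (fifthRoot_mono (hh y) (hkh y)))
    have key2 : ∀ y, fifthRoot H ^ 6 + 6 / 5 * fifthRoot H * (h y - H)
        + 1 / (25 * κ) * S ^ 4 * (h y - H) ^ 2 ≤ fifthRoot (h y) ^ 6 := fun y => by
      have h1 := pow_six_lower hκ hRpos (fifthRoot_nonneg (hh y)) (fifthRoot_nonneg hH0) hηR
        (by
          rw [fifthRoot_pow (hh y)]
          exact (hle h hh y).trans (mul_le_mul_of_nonneg_left hHR hκ0.le))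
      rwa [fifthRoot_pow (hh y), fifthRoot_pow hH0] at h1
    have key3 : ∀ y, bellman (bellmanConst κ) F H +
        (2 * F * R ^ 4 * (f y - F) + (4 / 5 * F ^ 2 * S - 4 / 5 * R +
          bellmanConst κ * (6 / 5 * fifthRoot H)) * (h y - H))
        + (1 / 4 * R ^ 4 * (f y - F) ^ 2 + S ^ 4 * (h y - H) ^ 2)
        ≤ bellman (bellmanConst κ) (f y) (h y) := fun y => by
      have hC : 0 ≤ bellmanConst κ := by linarith [one_le_bellmanConst hκ]
      have h1 := mul_le_mul_of_nonneg_left (key2 y) hC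
      have h2 : bellmanConst κ * (1 / (25 * κ) * S ^ 4 * (h y - H) ^ 2) =
          (8 * κ ^ 2 + 1) * (S ^ 4 * (h y - H) ^ 2) := by
        unfold bellmanConst; field_simp
      unfold bellman
      rw [← hR]
      linarith [key1 y]
    have hsum : bellman (bellmanConst κ) F H +
        ∑ y, w y * (1 / 4 * R ^ 4 * (f y - F) ^ 2 + S ^ 4 * (h y - H) ^ 2)
        ≤ ∑ y, w y * bellman (bellmanConst κ) (f y) (h y) := by
      have h1 := Finset.sum_le_sum fun y (_ : y ∈ Finset.univ) =>
        mul_le_mul_of_nonneg_left (key3 y) (hw0 y).le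
      refine le_trans (le_of_eq ?_) h1
      have l1 : ∑ y, w y * (f y - F) = 0 := by
        simp only [mul_sub, Finset.sum_sub_distrib, ← Finset.sum_mul, hw1, one_mul, ← hF, sub_self]
      have l2 : ∑ y, w y * (h y - H) = 0 := by
        simp only [mul_sub, Finset.sum_sub_distrib, ← Finset.sum_mul, hw1, one_mul, ← hH, sub_self]
      set c1 := 2 * F * R ^ 4
      set c2 := 4 / 5 * F ^ 2 * S - 4 / 5 * R + bellmanConst κ * (6 / 5 * fifthRoot H)
      have : ∀ y, w y * (bellman (bellmanConst κ) F H + (c1 * (f y - F) + c2 * (h y - H)) +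
          (1 / 4 * R ^ 4 * (f y - F) ^ 2 + S ^ 4 * (h y - H) ^ 2)) =
          w y * bellman (bellmanConst κ) F H + (c1 * (w y * (f y - F)) + c2 * (w y * (h y - H))) +
          w y * (1 / 4 * R ^ 4 * (f y - F) ^ 2 + S ^ 4 * (h y - H) ^ 2) := fun y => by ring
      simp only [this, Finset.sum_add_distrib, ← Finset.mul_sum, l1, l2, ← Finset.sum_mul, hw1]
      ring
    refine le_trans ?_ hsum
    gcongr
    -- A variance dominates the oscillation between any two points, because each of them has weight
    -- at least `1 / κ`.
    have hvar : ∀ (g : ι → ℝ) (m : ℝ) (a b : ι),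
        1 / (2 * κ) * (g a - g b) ^ 2 ≤ ∑ y, w y * (g y - m) ^ 2 := fun g m a b => by
      have hwκ : ∀ y, 1 / κ ≤ w y := fun y => by
        rw [div_le_iff₀ hκ0, mul_comm]; exact hw y
      by_cases hab : a = b
      · rw [hab]; simp only [sub_self]
        have : ∀ y, 0 ≤ w y * (g y - m) ^ 2 := fun y => mul_nonneg (hw0 y).le (sq_nonneg _)
        simpa using Finset.sum_nonneg fun y _ => this y
      · classical
        have h1 : ∑ y ∈ ({a, b} : Finset ι), w y * (g y - m) ^ 2 ≤ ∑ y, w y * (g y - m) ^ 2 :=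
          Finset.sum_le_sum_of_subset_of_nonneg (Finset.subset_univ _)
            fun y _ _ => mul_nonneg (hw0 y).le (sq_nonneg _)
        rw [Finset.sum_pair hab] at h1
        refine le_trans ?_ h1
        have h2 := mul_le_mul_of_nonneg_right (hwκ a) (sq_nonneg (g a - m))
        have h3 := mul_le_mul_of_nonneg_right (hwκ b) (sq_nonneg (g b - m))
        refine le_trans ?_ (add_le_add h2 h3)
        have h4 : 1 / (2 * κ) * (g a - g b) ^ 2 = 1 / κ * (1 / 2 * (g a - g b) ^ 2) := by
          field_simp
        rw [h4, ← mul_add]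
        refine mul_le_mul_of_nonneg_left ?_ (by positivity)
        nlinarith [sq_nonneg ((g a - m) + (g b - m))]
    have hsplit : ∑ y, w y * (1 / 4 * R ^ 4 * (f y - F) ^ 2 + S ^ 4 * (h y - H) ^ 2) =
        1 / 4 * R ^ 4 * ∑ y, w y * (f y - F) ^ 2 + S ^ 4 * ∑ y, w y * (h y - H) ^ 2 := by
      rw [Finset.mul_sum, Finset.mul_sum, ← Finset.sum_add_distrib]
      exact Finset.sum_congr rfl fun y _ => by ring
    rw [hsplit]
    have h1 := mul_le_mul_of_nonneg_left (hvar f F a b) (by positivity : 0 ≤ 1 / 4 * R ^ 4)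
    have h2 := mul_le_mul_of_nonneg_left (hvar h H a' b') (by positivity : 0 ≤ S ^ 4)
    refine le_trans ?_ (add_le_add h1 h2)
    have hSR : S * R = 1 := inv_mul_cancel₀ hRpos.ne'
    -- The weights `R⁴` and `R⁻⁴` of the two variances cancel in the arithmetic-geometric mean
    -- inequality, which leaves the product of oscillations free of `R`.
    have h3 := sq_nonneg (1 / 2 * R ^ 2 * |f a - f b| - S ^ 2 * |h a' - h b'|)
    have h4 : (1 / 2 * R ^ 2 * |f a - f b| - S ^ 2 * |h a' - h b'|) ^ 2 =
        1 / 4 * R ^ 4 * |f a - f b| ^ 2 - (S * R) ^ 2 * (|f a - f b| * |h a' - h b'|)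
          + S ^ 4 * |h a' - h b'| ^ 2 := by ring
    rw [h4, hSR, sq_abs, sq_abs] at h3
    have h5 := mul_le_mul_of_nonneg_left h3 (by positivity : 0 ≤ 1 / (2 * κ))
    linarith

/-! ### Random walks on finite abelian groups and bilinear embedding -/

section Walk

variable {G : Type*} [AddCommGroup G]

/-- Translation of functions, as a linear operator. -/
def translate (a : G) : Module.End ℝ (G → ℝ) where
  toFun f x := f (x + a)
  map_add' _ _ := rfl
  map_smul' _ _ := rfl

@[simp] theorem translate_apply (a : G) (f : G → ℝ) (x : G) : translate a f x = f (x + a) := rfl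

variable {Y : Type*} [Fintype Y]

/-- The transition operator of the random walk with uniformly chosen increments `c y`. -/
def walkOp (c : Y → G) : Module.End ℝ (G → ℝ) :=
  (Fintype.card Y : ℝ)⁻¹ • ∑ y, translate (c y)

theorem walkOp_apply (c : Y → G) (f : G → ℝ) (x : G) :
    walkOp c f x = ∑ y, (Fintype.card Y : ℝ)⁻¹ * f (x + c y) := by
  simp [walkOp, Finset.sum_apply, Finset.mul_sum]

theorem commute_translate (a b : G) : Commute (translate a) (translate b) := by
  ext f x
  simp [add_right_comm]

theorem commute_translate_walkOp (c : Y → G) (a : G) : Commute (translate a) (walkOp c) :=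
  Commute.smul_right (Commute.sum_right _ _ _ fun _ _ => commute_translate _ _) _

theorem walkOp_pow_translate (c : Y → G) (n : ℕ) (f : G → ℝ) (a x : G) :
    (walkOp c ^ n) (translate a f) x = (walkOp c ^ n) f (x + a) := by
  have h : Commute (translate a) (walkOp c ^ n) := (commute_translate_walkOp c a).pow_right n
  have := congrFun (LinearMap.congr_fun h.eq f) x
  simpa using this.symm

theorem walkOp_nonneg (c : Y → G) {f : G → ℝ} (hf : ∀ x, 0 ≤ f x) (x : G) :
    0 ≤ walkOp c f x := by
  rw [walkOp_apply]
  exact Finset.sum_nonneg fun y _ => mul_nonneg (by positivity) (hf _)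

theorem walkOp_pow_nonneg (c : Y → G) {f : G → ℝ} (hf : ∀ x, 0 ≤ f x) (n : ℕ) (x : G) :
    0 ≤ (walkOp c ^ n) f x := by
  induction n generalizing x with
  | zero => simpa using hf x
  | succ n ih => rw [pow_succ', Module.End.mul_apply]; exact walkOp_nonneg c ih x

theorem sum_weight [Nonempty Y] : ∑ _y : Y, (Fintype.card Y : ℝ)⁻¹ = 1 := by
  rw [Finset.sum_const, Finset.card_univ, nsmul_eq_mul]
  exact mul_inv_cancel₀ (Nat.cast_ne_zero.2 Fintype.card_ne_zero)

variable [Fintype G]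

theorem sum_comp_add (f : G → ℝ) (a : G) : ∑ x, f (x + a) = ∑ x, f x :=
  Fintype.sum_equiv (Equiv.addRight a) _ _ fun _ => rfl

theorem sum_walkOp [Nonempty Y] (c : Y → G) (f : G → ℝ) : ∑ x, walkOp c f x = ∑ x, f x := by
  simp only [walkOp_apply]
  rw [Finset.sum_comm]
  have h : ∀ y, ∑ x, (Fintype.card Y : ℝ)⁻¹ * f (x + c y) = (Fintype.card Y : ℝ)⁻¹ * ∑ x, f x :=
    fun y => by rw [← Finset.mul_sum, sum_comp_add]
  simp only [h]
  rw [← Finset.sum_mul, sum_weight, one_mul]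

theorem sum_translate_mul (a : G) (f g : G → ℝ) :
    ∑ x, translate a f x * g x = ∑ x, f x * translate (-a) g x := by
  rw [← sum_comp_add (fun x => f x * translate (-a) g x) a]
  exact Finset.sum_congr rfl fun x _ => by simp

theorem sum_walkOp_mul {c : Y → G} {σ : Equiv.Perm Y} (hσ : ∀ y, c (σ y) = -c y) (f g : G → ℝ) :
    ∑ x, walkOp c f x * g x = ∑ x, f x * walkOp c g x := by
  have h1 : ∀ f g : G → ℝ, ∑ x, walkOp c f x * g x =
      ∑ y, (Fintype.card Y : ℝ)⁻¹ * ∑ x, translate (c y) f x * g x := fun f g => by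
    simp only [walkOp_apply, Finset.sum_mul, Finset.mul_sum, translate_apply]
    rw [Finset.sum_comm]
    exact Finset.sum_congr rfl fun y _ => Finset.sum_congr rfl fun x _ => by ring
  have h2 : ∑ x, f x * walkOp c g x = ∑ x, walkOp c g x * f x :=
    Finset.sum_congr rfl fun x _ => mul_comm _ _
  rw [h2, h1, h1]
  refine Fintype.sum_equiv σ _ _ fun y => ?_
  rw [sum_translate_mul, hσ]
  congr 1
  exact Finset.sum_congr rfl fun x _ => mul_comm _ _

theorem sum_walkOp_pow_mul {c : Y → G} {σ : Equiv.Perm Y} (hσ : ∀ y, c (σ y) = -c y) (n : ℕ)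
    (f g : G → ℝ) : ∑ x, (walkOp c ^ n) f x * g x = ∑ x, f x * (walkOp c ^ n) g x := by
  induction n generalizing f g with
  | zero => simp
  | succ n ih =>
    rw [pow_succ, Module.End.mul_apply, ih, sum_walkOp_mul hσ, ← Module.End.mul_apply, ← pow_succ',
      ← pow_succ]

theorem sum_walkOp_pow_six_le [Nonempty Y] (c : Y → G) (f : G → ℝ) :
    ∑ x, walkOp c f x ^ 6 ≤ ∑ x, f x ^ 6 := by
  rw [← sum_walkOp c fun x => f x ^ 6]
  refine Finset.sum_le_sum fun x _ => ?_
  rw [walkOp_apply, walkOp_apply]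
  exact Real.pow_arith_mean_le_arith_mean_pow_of_even _ _ _ (fun y _ => by positivity)
    sum_weight (by decide)

/-- The total `∑ₓ bellman (Pⁿf) (Pⁿh)` is nonnegative and, since the walk preserves sums, decreases
at each time by at least a multiple of the product of gradients. Summing over time telescopes to the
initial value. -/
theorem bilinear_embedding_of_nonneg [Nonempty Y] (c : Y → G) {f h : G → ℝ} (hf : ∀ x, 0 ≤ f x)
    (hh : ∀ x, 0 ≤ h x) (a b a' b' : Y) (M : ℕ) :
    ∑ n ∈ Finset.range M, ∑ x, |(walkOp c ^ n) f (x + c a) - (walkOp c ^ n) f (x + c b)| *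
        |(walkOp c ^ n) h (x + c a') - (walkOp c ^ n) h (x + c b')| ≤
      2 * Fintype.card Y *
        ∑ x, (f x ^ 6 + bellmanConst (Fintype.card Y) * fifthRoot (h x) ^ 6) := by
  set κ : ℝ := (Fintype.card Y : ℝ) with hκdef
  have hκ : 1 ≤ κ := by
    rw [hκdef]; exact_mod_cast Fintype.card_pos (α := Y)
  have hκ0 : 0 < κ := by linarith
  set B : ℕ → ℝ := fun n =>
    ∑ x, bellman (bellmanConst κ) ((walkOp c ^ n) f x) ((walkOp c ^ n) h x) with hB
  have hfn := fun n => walkOp_pow_nonneg c hf n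
  have hhn := fun n => walkOp_pow_nonneg c hh n
  have hstep : ∀ n, ∑ x, |(walkOp c ^ n) f (x + c a) - (walkOp c ^ n) f (x + c b)| *
        |(walkOp c ^ n) h (x + c a') - (walkOp c ^ n) h (x + c b')| ≤
        2 * κ * (B n - B (n + 1)) := fun n => by
    have h1 : B n = ∑ x, walkOp c (fun x => bellman (bellmanConst κ) ((walkOp c ^ n) f x)
        ((walkOp c ^ n) h x)) x := (sum_walkOp c _).symm
    rw [h1, hB, ← Finset.sum_sub_distrib, Finset.mul_sum]
    refine Finset.sum_le_sum fun x _ => ?_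
    have h2 := bellman_gap (κ := κ) (w := fun _ : Y => κ⁻¹)
      (f := fun y => (walkOp c ^ n) f (x + c y)) (h := fun y => (walkOp c ^ n) h (x + c y))
      (fun y => by rw [mul_inv_cancel₀ hκ0.ne']) hκ sum_weight (fun y => hfn n _)
      (fun y => hhn n _) a b a' b'
    simp only [pow_succ', Module.End.mul_apply]
    rw [walkOp_apply c _ x, walkOp_apply c _ x, walkOp_apply c _ x]
    have h3 : ∀ X : ℝ, X = 2 * κ * (1 / (2 * κ) * X) := fun X => by field_simp
    rw [h3 (_ * _)]
    refine mul_le_mul_of_nonneg_left ?_ (by positivity)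
    linarith
  refine (Finset.sum_le_sum fun n _ => hstep n).trans ?_
  rw [← Finset.mul_sum, Finset.sum_range_sub']
  refine mul_le_mul_of_nonneg_left ?_ (by positivity)
  have hM : 0 ≤ B M := Finset.sum_nonneg fun x _ =>
    bellman_nonneg (one_le_bellmanConst hκ) (hfn M x) (hhn M x)
  have h0 : B 0 ≤ ∑ x, (f x ^ 6 + bellmanConst κ * fifthRoot (h x) ^ 6) := by
    simp only [hB, pow_zero, Module.End.one_apply]
    exact Finset.sum_le_sum fun x _ => bellman_le
  linarith

theorem bilinear_embedding [Nonempty Y] (c : Y → G) (f h : G → ℝ) (a b a' b' : Y) (M : ℕ) :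
    ∑ n ∈ Finset.range M, ∑ x, |(walkOp c ^ n) f (x + c a) - (walkOp c ^ n) f (x + c b)| *
        |(walkOp c ^ n) h (x + c a') - (walkOp c ^ n) h (x + c b')| ≤
      8 * Fintype.card Y *
        ∑ x, (f x ^ 6 + bellmanConst (Fintype.card Y) * fifthRoot |h x| ^ 6) := by
  set κ : ℝ := (Fintype.card Y : ℝ) with hκdef
  have hκ : 1 ≤ κ := by
    rw [hκdef]; exact_mod_cast Fintype.card_pos (α := Y)
  set X := ∑ x, (f x ^ 6 + bellmanConst κ * fifthRoot |h x| ^ 6) with hX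
  -- Positive and negative parts of both functions give four nonnegative pairs, which accounts for
  -- the factor `8 = 4 · 2`.
  have hdec : ∀ (g : G → ℝ) (n : ℕ) (u v : G),
      |(walkOp c ^ n) g u - (walkOp c ^ n) g v| ≤
        |(walkOp c ^ n) (fun x => (g x)⁺) u - (walkOp c ^ n) (fun x => (g x)⁺) v| +
        |(walkOp c ^ n) (fun x => (g x)⁻) u - (walkOp c ^ n) (fun x => (g x)⁻) v| :=
    fun g n u v => by
      have hg : g = (fun x => (g x)⁺) - fun x => (g x)⁻ := by
        funext x; simp
      have h1 : ∀ u, (walkOp c ^ n) g u =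
          (walkOp c ^ n) (fun x => (g x)⁺) u - (walkOp c ^ n) (fun x => (g x)⁻) u := fun u => by
        conv_lhs => rw [hg, map_sub]
        rfl
      rw [h1, h1]
      refine le_trans (le_of_eq ?_) (abs_sub _ _)
      congr 1; ring
  have hbd : ∀ f' h' : G → ℝ, (∀ x, 0 ≤ f' x) → (∀ x, 0 ≤ h' x) → (∀ x, f' x ≤ |f x|) →
      (∀ x, h' x ≤ |h x|) →
      ∑ n ∈ Finset.range M, ∑ x, |(walkOp c ^ n) f' (x + c a) - (walkOp c ^ n) f' (x + c b)| *
        |(walkOp c ^ n) h' (x + c a') - (walkOp c ^ n) h' (x + c b')| ≤ 2 * κ * X :=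
    fun f' h' h1 h2 h3 h4 => by
      refine (bilinear_embedding_of_nonneg c h1 h2 a b a' b' M).trans ?_
      refine mul_le_mul_of_nonneg_left (Finset.sum_le_sum fun x _ => ?_) (by positivity)
      have hC := one_le_bellmanConst hκ
      have e1 : f' x ^ 6 ≤ f x ^ 6 := by
        calc f' x ^ 6 ≤ |f x| ^ 6 := pow_le_pow_left₀ (h1 x) (h3 x) 6
          _ = f x ^ 6 := Even.pow_abs (by decide) _
      have e2 : fifthRoot (h' x) ^ 6 ≤ fifthRoot |h x| ^ 6 :=
        pow_le_pow_left₀ (fifthRoot_nonneg (h2 x)) (fifthRoot_mono (h2 x) (h4 x)) 6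
      have e3 := mul_le_mul_of_nonneg_left e2 (by linarith : 0 ≤ bellmanConst κ)
      exact add_le_add e1 e3
  have p1 : ∀ (g : G → ℝ) x, 0 ≤ (g x)⁺ := fun g x => posPart_nonneg _
  have p2 : ∀ (g : G → ℝ) x, 0 ≤ (g x)⁻ := fun g x => negPart_nonneg _
  have p3 : ∀ (g : G → ℝ) x, (g x)⁺ ≤ |g x| := fun g x => by
    rw [← posPart_add_negPart]; linarith [p2 g x]
  have p4 : ∀ (g : G → ℝ) x, (g x)⁻ ≤ |g x| := fun g x => by
    rw [← posPart_add_negPart]; linarith [p1 g x]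
  have s1 := hbd _ _ (p1 f) (p1 h) (p3 f) (p3 h)
  have s2 := hbd _ _ (p1 f) (p2 h) (p3 f) (p4 h)
  have s3 := hbd _ _ (p2 f) (p1 h) (p4 f) (p3 h)
  have s4 := hbd _ _ (p2 f) (p2 h) (p4 f) (p4 h)
  have : 8 * κ * X = 2 * κ * X + 2 * κ * X + (2 * κ * X + 2 * κ * X) := by ring
  rw [this]
  refine le_trans ?_ (add_le_add (add_le_add s1 s2) (add_le_add s3 s4))
  simp only [← Finset.sum_add_distrib]
  refine Finset.sum_le_sum fun n _ => Finset.sum_le_sum fun x _ => ?_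
  refine (mul_le_mul (hdec f n _ _) (hdec h n _ _) (abs_nonneg _) (by positivity)).trans ?_
  exact le_of_eq (by ring)

end Walk

/-! ### Sixth-power gradient bounds on finite abelian groups -/

section Torus

variable {d : ℕ} {G : Type*} [AddCommGroup G]

/-- The increments of the lazy walk along the generators `s i`. -/
def lazyStep (s : Fin d → G) (y : Fin d × Bool × Bool) : G :=
  if y.2.1 then 0 else if y.2.2 then s y.1 else -s y.1

/-- The symmetry of the increments of the lazy walk. -/
def lazyFlip (d : ℕ) : Equiv.Perm (Fin d × Bool × Bool) :=
  (Equiv.refl _).prodCongr ((Equiv.refl _).prodCongr Equiv.boolNot)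

theorem lazyStep_flip (s : Fin d → G) (y : Fin d × Bool × Bool) :
    lazyStep s (lazyFlip d y) = -lazyStep s y := by
  obtain ⟨i, b, b'⟩ := y
  cases b <;> cases b' <;> simp [lazyStep, lazyFlip]

theorem card_lazyStep : (Fintype.card (Fin d × Bool × Bool) : ℝ) = 4 * d := by
  simp; ring

theorem sum_lazyStep (s : Fin d → G) (f : G → ℝ) (x : G) :
    ∑ y, f (x + lazyStep s y) = 2 * d * f x + ∑ i, (f (x + s i) + f (x - s i)) := by
  have : ∀ i : Fin d, ∑ z : Bool × Bool, f (x + lazyStep s (i, z)) =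
      2 * f x + (f (x + s i) + f (x - s i)) := fun i => by
    simp [Fintype.sum_prod_type, lazyStep, sub_eq_add_neg]; ring
  rw [Fintype.sum_prod_type]
  simp only [this, Finset.sum_add_distrib, Finset.sum_const, Finset.card_univ, Fintype.card_fin]
  simp; ring

theorem sub_walkOp_lazyStep (hd : 1 ≤ d) (s : Fin d → G) (f : G → ℝ) (x : G) :
    f x - walkOp (lazyStep s) f x =
      (4 * d : ℝ)⁻¹ * ∑ i, ((f x - f (x - s i)) - (f (x + s i) - f x)) := by
  have hd0 : (d : ℝ) ≠ 0 := by positivity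
  rw [walkOp_apply, ← Finset.mul_sum, sum_lazyStep, card_lazyStep]
  have : ∑ i, ((f x - f (x - s i)) - (f (x + s i) - f x)) =
      2 * d * f x - ∑ i, (f (x + s i) + f (x - s i)) := by
    rw [eq_sub_iff_add_eq, ← Finset.sum_add_distrib]
    have : ∀ i, f x - f (x - s i) - (f (x + s i) - f x) + (f (x + s i) + f (x - s i)) = 2 * f x :=
      fun i => by ring
    simp [this]; ring
  rw [this]
  field_simp
  ring

variable [Fintype G]

/-- The constant of the bilinear bound for second-order Riesz transforms. -/
def rieszConst (d : ℕ) : ℝ := 512 * d * bellmanConst (4 * d)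

/-- Here `u = Δ⁻¹∇*F`, and `∇u` is tested against `h`. Expanding the inverse Laplacian as a sum over
the times of the lazy walk puts one gradient on `F` and one on `h`, which is the form controlled by
`bilinear_embedding`. Laziness makes `0` an increment, so a difference along a generator is a
difference between two increments of the walk. -/
theorem riesz_bilinear (hd : 1 ≤ d) (s : Fin d → G) (u : G → ℝ) (F : Fin d → G → ℝ) (h : G → ℝ)
    (hu : ∀ x, ∑ i, ((u x - u (x - s i)) - (u (x + s i) - u x)) =
      ∑ i, (F i (x - s i) - F i x)) (i : Fin d) :
    |∑ x, (u (x + s i) - u x) * h x| ≤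
      rieszConst d * (∑ j, ∑ x, F j x ^ 6 + ∑ x, fifthRoot |h x| ^ 6) := by
  have hd0 : (0 : ℝ) < d := by exact_mod_cast hd
  have : Nonempty (Fin d × Bool × Bool) := ⟨(⟨0, hd⟩, true, true)⟩
  set P : Module.End ℝ (G → ℝ) := walkOp (lazyStep s) with hP
  set Cb := bellmanConst (4 * d) with hCb
  have hCb1 : 1 ≤ Cb := one_le_bellmanConst (by
    have : (1 : ℝ) ≤ d := by exact_mod_cast hd
    linarith)
  -- the gradient of the walk tends to zero
  have hlim : Tendsto (fun n => ∑ x, ((P ^ n) u (x + s i) - (P ^ n) u x) * h x) atTop (𝓝 0) := by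
    -- The embedding applied to the pair `(u, u)` makes the squared gradients of `Pⁿu` summable in
    -- time, hence convergent to zero; no spectral gap is needed.
    have hsum : Summable fun n => ∑ x, |(P ^ n) u (x + s i) - (P ^ n) u x| *
        |(P ^ n) u (x + s i) - (P ^ n) u x| := by
      refine summable_of_sum_range_le (c := 8 * Fintype.card (Fin d × Bool × Bool) * ∑ x, (u x ^ 6 +
          bellmanConst (Fintype.card (Fin d × Bool × Bool)) * fifthRoot |u x| ^ 6)) (fun n => Finset.sum_nonneg fun x _ => by positivity)
        fun M => ?_
      have := bilinear_embedding (lazyStep s) u u (i, false, true) (i, true, true)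
        (i, false, true) (i, true, true) M
      simpa [lazyStep] using this
    have h0 := hsum.tendsto_atTop_zero
    have hx : ∀ x, Tendsto (fun n => (P ^ n) u (x + s i) - (P ^ n) u x) atTop (𝓝 0) := fun x => by
      have h1 : Tendsto (fun n => ((P ^ n) u (x + s i) - (P ^ n) u x) ^ 2) atTop (𝓝 0) := by
        refine squeeze_zero (fun n => sq_nonneg _) (fun n => ?_) h0
        have := Finset.single_le_sum (f := fun x => |(P ^ n) u (x + s i) - (P ^ n) u x| *
          |(P ^ n) u (x + s i) - (P ^ n) u x|) (fun x _ => by positivity) (Finset.mem_univ x)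
        simpa [abs_mul_abs_self, pow_two] using this
      have h2 := h1.sqrt
      simp only [Real.sqrt_sq_eq_abs, Real.sqrt_zero] at h2
      exact (tendsto_zero_iff_abs_tendsto_zero _).2 h2
    have := tendsto_finsetSum Finset.univ fun x _ => (hx x).mul_const (h x)
    simpa using this
  have hlim2 := hlim.comp (tendsto_id.const_mul_atTop' (show 0 < 2 by norm_num))
  -- From `u - P²u = (1 + P)(u - Pu)`, the source for the two-step walk is `F + PF`. Even powers are
  -- used so that the self-adjoint `P^(2n)` splits into one `Pⁿ` on the source and one on `h`.
  set F' : Fin d → G → ℝ := fun j => F j + P (F j) with hF'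
  set D : Module.End ℝ (G → ℝ) := translate (s i) - 1 with hD
  have hcomm : ∀ n, Commute D (P ^ n) := fun n =>
    Commute.pow_right (Commute.sub_left (commute_translate_walkOp _ _) (Commute.one_left _)) n
  have hdiv : u - P u = (4 * d : ℝ)⁻¹ • ∑ j, (translate (-s j) (F j) - F j) := by
    funext x
    have := sub_walkOp_lazyStep hd s u x
    rw [hu] at this
    simpa [Finset.sum_apply, sub_eq_add_neg] using this
  have hdiv' : u - (P ^ 2) u = (4 * d : ℝ)⁻¹ • ∑ j, (translate (-s j) (F' j) - F' j) := by
    have e1 : u - (P ^ 2) u = (u - P u) + P (u - P u) := by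
      rw [map_sub, pow_two, Module.End.mul_apply]; abel
    have e2 : ∀ j, translate (-s j) (P (F j)) = P (translate (-s j) (F j)) := fun j =>
      LinearMap.congr_fun (commute_translate_walkOp (lazyStep s) (-s j)).eq (F j)
    rw [e1, hdiv, map_smul, map_sum, ← smul_add, ← Finset.sum_add_distrib]
    congr 1
    refine Finset.sum_congr rfl fun j _ => ?_
    rw [hF', map_sub]
    simp only [map_add, e2]
    abel
  have htel : ∀ M, u - (P ^ (2 * M)) u = ∑ n ∈ Finset.range M, (P ^ (2 * n)) (u - (P ^ 2) u) :=
    fun M => by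
      induction M with
      | zero => simp
      | succ M ih =>
        rw [Finset.sum_range_succ, ← ih, map_sub, ← Module.End.mul_apply, ← pow_add]
        have : 2 * M + 2 = 2 * (M + 1) := by ring
        rw [this]; abel
  -- the contribution of one step
  have hterm : ∀ n j, ∑ x, D ((P ^ (2 * n)) (translate (-s j) (F' j) - F' j)) x * h x =
      ∑ x, ((P ^ n) (F' j) (x - s j) - (P ^ n) (F' j) x) * ((P ^ n) h (x - s i) - (P ^ n) h x) :=
    fun n j => by
      have e1 : D ((P ^ (2 * n)) (translate (-s j) (F' j) - F' j)) =
          (P ^ n) (D ((P ^ n) (translate (-s j) (F' j) - F' j))) := by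
        rw [two_mul, pow_add, Module.End.mul_apply]
        exact LinearMap.congr_fun (hcomm n).eq _
      rw [e1, sum_walkOp_pow_mul (lazyStep_flip s)]
      have e2 : (P ^ n) (translate (-s j) (F' j) - F' j) =
          fun x => (P ^ n) (F' j) (x - s j) - (P ^ n) (F' j) x := by
        funext x
        rw [map_sub, Pi.sub_apply, walkOp_pow_translate, sub_eq_add_neg]
        simp [sub_eq_add_neg, hP]
      rw [e2]
      set g : G → ℝ := fun x => (P ^ n) (F' j) (x - s j) - (P ^ n) (F' j) x with hg
      have e3 : ∀ x, D g x * (P ^ n) h x =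
          translate (s i) g x * (P ^ n) h x - g x * (P ^ n) h x := fun x => by
        simp [hD]; ring
      rw [← hP]
      simp only [e3, Finset.sum_sub_distrib]
      rw [sum_translate_mul, ← Finset.sum_sub_distrib]
      refine Finset.sum_congr rfl fun x _ => ?_
      rw [translate_apply, ← sub_eq_add_neg]
      ring
  have hF'6 : ∀ j, ∑ x, F' j x ^ 6 ≤ 64 * ∑ x, F j x ^ 6 := fun j => by
    have e1 : ∀ x, F' j x ^ 6 ≤ 32 * (F j x ^ 6 + P (F j) x ^ 6) := fun x => by
      have := Even.add_pow_le (n := 6) (by decide) (a := F j x) (b := P (F j) x)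
      norm_num at this
      simpa [hF'] using this
    have e2 := sum_walkOp_pow_six_le (lazyStep s) (F j)
    have e3 := Finset.sum_le_sum fun x (_ : x ∈ Finset.univ) => e1 x
    rw [← Finset.mul_sum, Finset.sum_add_distrib] at e3
    linarith
  set A := ∑ j, ∑ x, F j x ^ 6
  set Hh := ∑ x, fifthRoot |h x| ^ 6 with hHh
  have hHh0 : 0 ≤ Hh := Finset.sum_nonneg fun x _ =>
    pow_nonneg (fifthRoot_nonneg (abs_nonneg _)) 6
  have hbil : ∀ M j, |∑ n ∈ Finset.range M,
      ∑ x, ((P ^ n) (F' j) (x - s j) - (P ^ n) (F' j) x) * ((P ^ n) h (x - s i) - (P ^ n) h x)|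
      ≤ 32 * d * (64 * ∑ x, F j x ^ 6 + Cb * Hh) := fun M j => by
    have e1 := bilinear_embedding (lazyStep s) (F' j) h (j, false, false) (j, true, true)
      (i, false, false) (i, true, true) M
    rw [card_lazyStep, Finset.sum_add_distrib, ← Finset.mul_sum] at e1
    simp only [lazyStep, if_true, Bool.false_eq_true, if_false, add_zero, ← sub_eq_add_neg] at e1
    refine (Finset.abs_sum_le_sum_abs _ _).trans ?_
    refine (Finset.sum_le_sum fun n _ => Finset.abs_sum_le_sum_abs _ _).trans ?_
    simp only [abs_mul]
    refine e1.trans ?_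
    have e2 : (8 : ℝ) * (4 * d) = 32 * d := by ring
    rw [e2]
    gcongr
    exact hF'6 j
  have hmain : ∀ M, |∑ x, (u (x + s i) - u x) * h x -
      ∑ x, ((P ^ (2 * M)) u (x + s i) - (P ^ (2 * M)) u x) * h x| ≤ rieszConst d * (A + Hh) :=
    fun M => by
      have e1 : ∑ x, (u (x + s i) - u x) * h x -
          ∑ x, ((P ^ (2 * M)) u (x + s i) - (P ^ (2 * M)) u x) * h x =
          ∑ x, D (u - (P ^ (2 * M)) u) x * h x := by
        rw [← Finset.sum_sub_distrib]
        refine Finset.sum_congr rfl fun x _ => ?_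
        simp [hD]; ring
      have e2 : ∑ x, D (u - (P ^ (2 * M)) u) x * h x = (4 * d : ℝ)⁻¹ * ∑ j, ∑ n ∈ Finset.range M,
          ∑ x, ((P ^ n) (F' j) (x - s j) - (P ^ n) (F' j) x) *
            ((P ^ n) h (x - s i) - (P ^ n) h x) := by
        simp only [← hterm]
        rw [htel, hdiv']
        simp only [map_sum, map_smul, Finset.sum_apply, Pi.smul_apply, smul_eq_mul,
          Finset.sum_mul, Finset.mul_sum, mul_assoc]
        rw [Finset.sum_comm]
        simp only [Finset.sum_comm (s := (Finset.univ : Finset G))]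
        rw [Finset.sum_comm]
      rw [e1, e2, abs_mul, abs_of_pos (by positivity)]
      calc (4 * d : ℝ)⁻¹ * |∑ j, ∑ n ∈ Finset.range M,
          ∑ x, ((P ^ n) (F' j) (x - s j) - (P ^ n) (F' j) x) *
            ((P ^ n) h (x - s i) - (P ^ n) h x)|
          ≤ (4 * d : ℝ)⁻¹ * ∑ j, 32 * d * (64 * ∑ x, F j x ^ 6 + Cb * Hh) := by
            gcongr
            exact (Finset.abs_sum_le_sum_abs _ _).trans (Finset.sum_le_sum fun j _ => hbil M j)
        _ = 8 * (64 * A + d * (Cb * Hh)) := by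
            rw [← Finset.mul_sum, Finset.sum_add_distrib, ← Finset.mul_sum]
            simp only [Finset.sum_const, Finset.card_univ, Fintype.card_fin, nsmul_eq_mul]
            field_simp; ring
        _ ≤ rieszConst d * (A + Hh) := by
            have hA0 : 0 ≤ A := Finset.sum_nonneg fun j _ => Finset.sum_nonneg fun x _ =>
              (by decide : Even 6).pow_nonneg _
            have hd1 : (1 : ℝ) ≤ d := by exact_mod_cast hd
            have h1 : (1 : ℝ) ≤ d * Cb := one_le_mul_of_one_le_of_one_le hd1 hCb1
            have h2 := mul_le_mul_of_nonneg_right h1 hA0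
            have h3 : 0 ≤ d * Cb * Hh := by positivity
            unfold rieszConst
            rw [← hCb]
            linarith
  have hL := (hlim2.const_sub (∑ x, (u (x + s i) - u x) * h x)).abs
  rw [sub_zero] at hL
  exact le_of_tendsto hL (Eventually.of_forall fun M => hmain M)

theorem one_le_rieszConst (hd : 1 ≤ d) : 1 ≤ rieszConst d := by
  have hd1 : (1 : ℝ) ≤ d := by exact_mod_cast hd
  have h1 : 1 ≤ bellmanConst (4 * d) := one_le_bellmanConst (by linarith)
  unfold rieszConst
  nlinarith

/-- The operator norm of `∇ Δ⁻¹ ∇*` on `ℓ⁶` is bounded by a constant that depends on `d` only. -/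
theorem gradient_pow_six_le (hd : 1 ≤ d) (s : Fin d → G) (u : G → ℝ) (F : Fin d → G → ℝ)
    (hu : ∀ x, ∑ i, ((u x - u (x - s i)) - (u (x + s i) - u x)) =
      ∑ i, (F i (x - s i) - F i x)) :
    ∑ i, ∑ x, (u (x + s i) - u x) ^ 6 ≤
      d * (2 * rieszConst d) ^ 6 * ∑ i, ∑ x, F i x ^ 6 := by
  have hC := one_le_rieszConst hd
  set C := rieszConst d
  have key : ∀ i, ∑ x, (u (x + s i) - u x) ^ 6 ≤
      (2 * C) ^ 6 * ∑ i, ∑ x, F i x ^ 6 := fun i => by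
    -- The test function is the `ℓ⁶` dual `(τ∇u)⁵`. With `τ = 1 / (2C)`, the term `C τ⁶ ‖∇u‖₆⁶` is
    -- half of the left-hand side and is absorbed.
    set τ := (2 * C)⁻¹ with hτ
    have hτ0 : 0 < τ := by positivity
    have h1 := riesz_bilinear hd s u F (fun x => (τ * (u (x + s i) - u x)) ^ 5) hu i
    have h2 : ∀ x, fifthRoot |(τ * (u (x + s i) - u x)) ^ 5| ^ 6 =
        τ ^ 6 * (u (x + s i) - u x) ^ 6 := fun x => by
      rw [abs_pow, fifthRoot_of_pow (abs_nonneg _), Even.pow_abs (by decide), mul_pow]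
    have h3 : ∀ x, (u (x + s i) - u x) * (τ * (u (x + s i) - u x)) ^ 5 =
        τ ^ 5 * (u (x + s i) - u x) ^ 6 := fun x => by ring
    simp only [h2, h3, ← Finset.mul_sum] at h1
    set X := ∑ x, (u (x + s i) - u x) ^ 6
    have h4 := (le_abs_self _).trans h1
    have h5 : C * (τ ^ 6 * X) = 1 / 2 * (τ ^ 5 * X) := by
      rw [hτ]; field_simp
    have h6 : τ ^ 5 * X ≤ 2 * C * ∑ j, ∑ x, F j x ^ 6 := by linarith
    calc X = (2 * C) ^ 5 * (τ ^ 5 * X) := by rw [hτ]; field_simp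
      _ ≤ (2 * C) ^ 5 * (2 * C * ∑ j, ∑ x, F j x ^ 6) := by gcongr
      _ = _ := by ring
  refine (Finset.sum_le_sum fun i _ => key i).trans ?_
  simp only [Finset.sum_const, Finset.card_univ, Fintype.card_fin, nsmul_eq_mul]
  exact le_of_eq (by ring)

/-- The admissible deviation of the conductances from `1`. -/
def ellipticGap (d : ℕ) : ℝ := (4 * (d * (2 * rieszConst d) ^ 6))⁻¹

theorem ellipticGap_pos (hd : 1 ≤ d) : 0 < ellipticGap d := by
  have := one_le_rieszConst hd
  have hd1 : (0 : ℝ) < d := by exact_mod_cast hd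
  unfold ellipticGap
  positivity

/-- A gradient bound for perturbations of the constant-coefficient operator. -/
theorem gradient_pow_six_le_of_near_one (hd : 1 ≤ d) (s : Fin d → G) (u : G → ℝ)
    (a g : Fin d → G → ℝ) (ha : ∀ i x, |a i x - 1| ≤ ellipticGap d) (hg : ∀ i x, |g i x| ≤ 1)
    (hu : ∀ x, ∑ i, (a i (x - s i) * (u x - u (x - s i) + g i (x - s i)) -
      a i x * (u (x + s i) - u x + g i x)) = 0) :
    ∑ i, ∑ x, (u (x + s i) - u x) ^ 6 ≤
      2 * (d * (2 * rieszConst d) ^ 6) * (d * 2048 * Fintype.card G) := by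
  have hC := one_le_rieszConst hd
  have hd1 : (1 : ℝ) ≤ d := by exact_mod_cast hd
  set K := d * (2 * rieszConst d) ^ 6 with hK
  have hK1 : 1 ≤ K := by
    have : 1 ≤ (2 * rieszConst d) ^ 6 := one_le_pow₀ (by linarith)
    rw [hK]; nlinarith
  have hK0 : 0 < K := by linarith
  set ε := ellipticGap d with hε
  have hε' : ε = (4 * K)⁻¹ := rfl
  have hε0 : 0 < ε := ellipticGap_pos hd
  have hε4 : ε ≤ 1 / 4 := by
    rw [hε', inv_le_comm₀ (by positivity) (by norm_num)]; norm_num; linarith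
  -- Moving `(a - 1)∇u` to the right-hand side leaves the constant-coefficient equation with source
  -- `F`. The choice of `ellipticGap` makes the part of `K ‖F‖₆⁶` that contains `∇u` at most half of
  -- `‖∇u‖₆⁶`.
  set F : Fin d → G → ℝ := fun i x =>
    (1 - a i x) * (u (x + s i) - u x) - a i x * g i x with hF
  have h1 := gradient_pow_six_le hd s u F fun x => by
    rw [← sub_eq_zero, ← Finset.sum_sub_distrib, ← hu x]
    refine Finset.sum_congr rfl fun i _ => ?_
    simp only [hF, sub_add_cancel]
    ring
  have h2 : ∀ i x, F i x ^ 6 ≤ 1 / (2 * K) * (u (x + s i) - u x) ^ 6 + 2048 := fun i x => by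
    have e1 := Even.add_pow_le (n := 6) (by decide) 
      (a := (1 - a i x) * (u (x + s i) - u x)) (b := -(a i x * g i x))
    norm_num at e1
    have e2 : |a i x| ≤ 2 := by
      have := abs_sub_abs_le_abs_sub (a i x) 1
      rw [abs_one] at this
      linarith [ha i x]
    have e3 : (a i x * g i x) ^ 6 ≤ 64 := by
      have : |a i x * g i x| ≤ 2 := by
        rw [abs_mul]
        calc |a i x| * |g i x| ≤ 2 * 1 := mul_le_mul e2 (hg i x) (abs_nonneg _) (by norm_num)
          _ = 2 := by norm_num
      calc (a i x * g i x) ^ 6 = |a i x * g i x| ^ 6 := (Even.pow_abs (by decide) _).symm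
        _ ≤ 2 ^ 6 := pow_le_pow_left₀ (abs_nonneg _) this 6
        _ = 64 := by norm_num
    have e4 : 32 * (1 - a i x) ^ 6 ≤ 1 / (2 * K) := by
      have h := pow_le_pow_left₀ (abs_nonneg _) (ha i x) 5
      have h' : |a i x - 1| ^ 5 ≤ (1 / 4) ^ 5 :=
        pow_le_pow_left₀ (abs_nonneg _) ((ha i x).trans hε4) 5
      calc 32 * (1 - a i x) ^ 6 = 32 * (|a i x - 1| ^ 5 * |a i x - 1|) := by
            rw [← pow_succ, Even.pow_abs (by decide)]; ring
        _ ≤ 32 * ((1 / 4) ^ 5 * ε) := by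
            gcongr
            exact ha i x
        _ ≤ 2 * ε := by linarith
        _ = 1 / (2 * K) := by rw [hε']; field_simp; norm_num
    have e5 := mul_le_mul_of_nonneg_right e4
      ((by decide : Even 6).pow_nonneg (u (x + s i) - u x))
    have e6 : F i x ^ 6 ≤ 32 * ((1 - a i x) ^ 6 * (u (x + s i) - u x) ^ 6 +
        (a i x * g i x) ^ 6) := by
      have : (-(a i x * g i x)) ^ 6 = (a i x * g i x) ^ 6 := Even.neg_pow (by decide) _
      calc F i x ^ 6 = ((1 - a i x) * (u (x + s i) - u x) + -(a i x * g i x)) ^ 6 := by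
            simp only [hF]; ring
        _ ≤ _ := by
          refine e1.trans (le_of_eq ?_)
          ring
    linarith
  have h3 : ∑ i, ∑ x, F i x ^ 6 ≤
      1 / (2 * K) * ∑ i, ∑ x, (u (x + s i) - u x) ^ 6 + d * 2048 * Fintype.card G := by
    refine (Finset.sum_le_sum fun i _ => Finset.sum_le_sum fun x _ => h2 i x).trans ?_
    simp only [Finset.sum_add_distrib, ← Finset.mul_sum, Finset.sum_const, Finset.card_univ,
      Fintype.card_fin, nsmul_eq_mul]
    exact le_of_eq (by ring)
  set X := ∑ i, ∑ x, (u (x + s i) - u x) ^ 6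
  have h4 := h1.trans (mul_le_mul_of_nonneg_left h3 hK0.le)
  have h5 : K * (1 / (2 * K) * X) = X / 2 := by field_simp
  rw [mul_add, h5] at h4
  linarith

end Torus

/-! ### Odd reflection of a Dirichlet problem in a box to a torus -/

section Reflection

variable {L : ℕ}

/-- The distance of `z` to `0` in the cycle of length `2 (L + 1)`. -/
def fold (z : ZMod (2 * (L + 1))) : ℤ := min (z.val : ℤ) (2 * (L + 1) - z.val)

/-- The sign of the reflection. -/
def reflSign (z : ZMod (2 * (L + 1))) : ℝ :=
  if z.val = 0 ∨ z.val = L + 1 then 0 else if z.val < L + 1 then 1 else -1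

/-- The image under folding of the lower end of the edge from `z` to `z + 1`, as a coordinate of
the box `[0, L)`. -/
def foldLower (z : ZMod (2 * (L + 1))) : ℤ := min (fold z) (fold (z + 1)) - 1

/-- Odd reflection of a function of one variable. -/
def oddRefl (w : ℤ → ℝ) (z : ZMod (2 * (L + 1))) : ℝ := reflSign z * w (fold z - 1)

theorem val_add_one (z : ZMod (2 * (L + 1))) :
    (z + 1).val = if z.val + 1 = 2 * (L + 1) then 0 else z.val + 1 := by
  have h1 : (1 : ZMod (2 * (L + 1))).val = 1 := ZMod.val_one'' (by omega)
  have hz := ZMod.val_lt z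
  rw [ZMod.val_add, h1]
  split_ifs with h
  · rw [h, Nat.mod_self]
  · exact Nat.mod_eq_of_lt (by omega)

theorem val_sub_one (z : ZMod (2 * (L + 1))) :
    (z - 1).val = if z.val = 0 then 2 * L + 1 else z.val - 1 := by
  have h := val_add_one (z - 1)
  rw [sub_add_cancel] at h
  have hz := ZMod.val_lt (z - 1)
  split_ifs at h ⊢ <;> omega

/-- On the unreflected half, folding preserves orientation. The reflecting points `0` and `L + 1` of
the cycle stand for the lattice coordinates `-1` and `L`, where `w` vanishes, so the zero sign there
does no harm. -/
theorem oddRefl_of_pos {w : ℤ → ℝ} (hw : ∀ m : ℤ, ¬(0 ≤ m ∧ m < L) → w m = 0)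
    {z : ZMod (2 * (L + 1))} (hz : reflSign z = 1) :
    oddRefl w z = w (fold z - 1) ∧ oddRefl w (z + 1) = w (fold z - 1 + 1) ∧
      oddRefl w (z - 1) = w (fold z - 1 - 1) ∧ foldLower z = fold z - 1 ∧
      foldLower (z - 1) = fold z - 1 - 1 := by
  have hv := ZMod.val_lt z
  have h1 := val_add_one z
  have h2 := val_sub_one z
  have hz' : z.val ≠ 0 ∧ z.val < L + 1 := by
    unfold reflSign at hz
    split_ifs at hz with a b <;> first | (norm_num at hz; done) | skip
    push Not at a
    exact ⟨a.1, b⟩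
  obtain ⟨hz0, hzL⟩ := hz'
  rw [if_neg (by omega)] at h1
  rw [if_neg hz0] at h2
  have f0 : fold z = z.val := by unfold fold; omega
  have f1 : fold (z + 1) = z.val + 1 := by unfold fold; omega
  have f2 : fold (z - 1) = z.val - 1 := by unfold fold; omega
  refine ⟨by rw [oddRefl, hz, one_mul], ?_, ?_, ?_, ?_⟩
  · unfold oddRefl
    rw [f0, f1]
    by_cases h : z.val = L
    · rw [hw _ (by omega), hw _ (by omega), mul_zero]
    · rw [reflSign, if_neg (by omega), if_pos (by omega), one_mul]; congr 1; ring
  · unfold oddRefl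
    rw [f0, f2]
    by_cases h : z.val = 1
    · rw [hw _ (by omega), mul_zero]
    · rw [reflSign, if_neg (by omega), if_pos (by omega), one_mul]
  · unfold foldLower; omega
  · unfold foldLower; rw [sub_add_cancel]; omega

/-- On the reflected half, folding reverses orientation: the forward neighbour folds to the backward
one, and the two conductances are exchanged. -/
theorem oddRefl_of_neg {w : ℤ → ℝ} (hw : ∀ m : ℤ, ¬(0 ≤ m ∧ m < L) → w m = 0)
    {z : ZMod (2 * (L + 1))} (hz : reflSign z = -1) :
    oddRefl w z = -w (fold z - 1) ∧ oddRefl w (z + 1) = -w (fold z - 1 - 1) ∧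
      oddRefl w (z - 1) = -w (fold z - 1 + 1) ∧ foldLower z = fold z - 1 - 1 ∧
      foldLower (z - 1) = fold z - 1 := by
  have hv := ZMod.val_lt z
  have h1 := val_add_one z
  have h2 := val_sub_one z
  have hz' : L + 1 < z.val := by
    unfold reflSign at hz
    split_ifs at hz with a b <;> first | (norm_num at hz; done) | skip
    omega
  rw [if_neg (by omega)] at h2
  have f0 : fold z = 2 * (L + 1) - z.val := by unfold fold; omega
  have f1 : fold (z + 1) = 2 * (L + 1) - z.val - 1 := by
    unfold fold; split_ifs at h1 <;> omega
  have f2 : fold (z - 1) = 2 * (L + 1) - z.val + 1 := by unfold fold; omega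
  refine ⟨by rw [oddRefl, hz, neg_one_mul], ?_, ?_, ?_, ?_⟩
  · unfold oddRefl
    rw [f0, f1]
    split_ifs at h1
    · rw [hw _ (by omega), mul_zero, neg_zero]
    · rw [reflSign, if_neg (by omega), if_neg (by omega), neg_one_mul]
  · unfold oddRefl
    rw [f0, f2]
    by_cases h : z.val = L + 2
    · rw [hw _ (by omega), hw _ (by omega), mul_zero, neg_zero]
    · rw [reflSign, if_neg (by omega), if_neg (by omega), neg_one_mul]; congr 2; ring
  · unfold foldLower; omega
  · unfold foldLower; rw [sub_add_cancel]; omega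

theorem oddRefl_of_zero (w : ℤ → ℝ) {z : ZMod (2 * (L + 1))} (hz : reflSign z = 0) :
    oddRefl w z = 0 ∧ oddRefl w (z + 1) = -oddRefl w (z - 1) ∧
      foldLower z = foldLower (z - 1) := by
  have hv := ZMod.val_lt z
  have h1 := val_add_one z
  have h2 := val_sub_one z
  have hz' : z.val = 0 ∨ z.val = L + 1 := by
    unfold reflSign at hz
    split_ifs at hz with a b <;> first | (norm_num at hz; done) | skip
    exact a
  have hf : fold (z + 1) = fold (z - 1) := by
    unfold fold; split_ifs at h1 h2 <;> omega
  refine ⟨by rw [oddRefl, hz, zero_mul], ?_, ?_⟩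
  · have : reflSign (z + 1) = -reflSign (z - 1) := by
      rcases Nat.eq_zero_or_pos L with hL | hL
      · unfold reflSign; rw [if_pos, if_pos, neg_zero] <;> split_ifs at h1 h2 <;> omega
      · have hs : ∀ y : ZMod (2 * (L + 1)), 0 < y.val → y.val < L + 1 → reflSign y = 1 :=
          fun y h h' => by rw [reflSign, if_neg (by omega), if_pos h']
        have hs' : ∀ y : ZMod (2 * (L + 1)), L + 1 < y.val → reflSign y = -1 :=
          fun y h => by rw [reflSign, if_neg (by omega), if_neg (by omega)]
        rcases hz' with h | h
        · rw [if_neg (by omega)] at h1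
          rw [if_pos h] at h2
          rw [hs _ (by omega) (by omega), hs' _ (by omega), neg_neg]
        · rw [if_neg (by omega)] at h1 h2
          rw [hs (z - 1) (by omega) (by omega), hs' _ (by omega)]
    unfold oddRefl
    rw [this, hf, neg_mul]
  · unfold foldLower
    rw [sub_add_cancel, hf, min_comm]

theorem reflSign_cases (z : ZMod (2 * (L + 1))) :
    reflSign z = 0 ∨ reflSign z = 1 ∨ reflSign z = -1 := by
  unfold reflSign; split_ifs <;> simp

theorem abs_reflSign_le_one (z : ZMod (2 * (L + 1))) : |reflSign z| ≤ 1 := by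
  rcases reflSign_cases z with h | h | h <;> simp [h]

variable {d : ℕ}

/-- Folding of the torus onto the box. -/
def foldVertex (x : Fin d → ZMod (2 * (L + 1))) : Vertex d := fun j => fold (x j) - 1

/-- The product of the signs of the coordinates other than `i`. -/
def crossSign (i : Fin d) (x : Fin d → ZMod (2 * (L + 1))) : ℝ :=
  ∏ j ∈ Finset.univ.erase i, reflSign (x j)

theorem mem_box {x : Vertex d} : x ∈ box d L ↔ ∀ j, 0 ≤ x j ∧ x j < L := by
  simp [box]

theorem crossSign_update (i : Fin d) (x : Fin d → ZMod (2 * (L + 1))) (a : ZMod (2 * (L + 1))) :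
    crossSign i (x + Pi.single i a) = crossSign i x :=
  Finset.prod_congr rfl fun j hj => by
    simp [Pi.single_eq_of_ne (Finset.ne_of_mem_erase hj)]

/-- Odd reflection of a function on the box. -/
def reflFun (u : Vertex d → ℝ) (x : Fin d → ZMod (2 * (L + 1))) : ℝ :=
  (∏ j, reflSign (x j)) * u (foldVertex x)

theorem reflFun_eq (u : Vertex d → ℝ) (i : Fin d) (x : Fin d → ZMod (2 * (L + 1))) :
    reflFun u x =
      crossSign i x * oddRefl (fun t => u (Function.update (foldVertex x) i t)) (x i) := by
  unfold reflFun crossSign oddRefl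
  rw [← Finset.mul_prod_erase _ _ (Finset.mem_univ i)]
  have : Function.update (foldVertex x) i (fold (x i) - 1) = foldVertex x :=
    Function.update_eq_self i (foldVertex x)
  simp only [this]; ring

theorem reflFun_add_single (u : Vertex d → ℝ) (i : Fin d) (x : Fin d → ZMod (2 * (L + 1)))
    (a : ZMod (2 * (L + 1))) :
    reflFun u (x + Pi.single i a) =
      crossSign i x * oddRefl (fun t => u (Function.update (foldVertex x) i t)) (x i + a) := by
  rw [reflFun_eq u i, crossSign_update]
  have : ∀ t, Function.update (foldVertex (x + Pi.single i a)) i t =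
      Function.update (foldVertex x) i t := fun t => by
    funext j
    by_cases h : j = i
    · subst h; simp
    · simp [h, foldVertex]
  simp [this]

/-- Off the reflecting hyperplanes this is the original equation at the folded point, up to sign. On
a hyperplane normal to direction `j`, the term of direction `j` cancels by oddness of `u` and
evenness of the conductances, and the other terms vanish with their `crossSign`. The forcing in
direction `k` is even in coordinate `k` and odd in the others, which is why it carries `crossSign`.
-/
theorem reflected_equation {ω : Config d} {k : Fin d} {u : Vertex d → ℝ}
    (hu0 : ∀ x ∉ box d L, u x = 0)
    (hu : ∀ x ∈ box d L, ∑ i, (ω (x - e i, i) * (u x - u (x - e i) + if i = k then 1 else 0) -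
      ω (x, i) * (u (x + e i) - u x + if i = k then 1 else 0)) = 0)
    (x : Fin d → ZMod (2 * (L + 1))) :
    ∑ i, (ω (Function.update (foldVertex (x - Pi.single i 1)) i
        (foldLower ((x - Pi.single i 1 : Fin d → ZMod (2 * (L + 1))) i)), i) *
        (reflFun u x - reflFun u (x - Pi.single i 1) +
          (if i = k then crossSign i (x - Pi.single i 1) else 0)) -
      ω (Function.update (foldVertex x) i (foldLower (x i)), i) *
        (reflFun u (x + Pi.single i 1) - reflFun u x + (if i = k then crossSign i x else 0))) =
      0 := by
  set W : Fin d → ZMod (2 * (L + 1)) → ℝ := fun i =>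
    oddRefl fun t => u (Function.update (foldVertex x) i t) with hW
  have hterm : ∀ i, ω (Function.update (foldVertex (x - Pi.single i 1)) i
        (foldLower ((x - Pi.single i 1 : Fin d → ZMod (2 * (L + 1))) i)), i) *
        (reflFun u x - reflFun u (x - Pi.single i 1) +
          (if i = k then crossSign i (x - Pi.single i 1) else 0)) -
      ω (Function.update (foldVertex x) i (foldLower (x i)), i) *
        (reflFun u (x + Pi.single i 1) - reflFun u x + (if i = k then crossSign i x else 0)) =
      crossSign i x * (ω (Function.update (foldVertex x) i (foldLower (x i - 1)), i) *
        (W i (x i) - W i (x i - 1) + if i = k then 1 else 0) -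
        ω (Function.update (foldVertex x) i (foldLower (x i)), i) *
        (W i (x i + 1) - W i (x i) + if i = k then 1 else 0)) := fun i => by
    have e1 : x - Pi.single i 1 = x + Pi.single i (-1) := by rw [Pi.single_neg, sub_eq_add_neg]
    have e2 : Function.update (foldVertex (x + Pi.single i (-1))) i (foldLower (x i - 1)) =
        Function.update (foldVertex x) i (foldLower (x i - 1)) := by
      funext j
      by_cases h : j = i
      · subst h; simp
      · simp [h, foldVertex]
    have e3 : (x - Pi.single i 1 : Fin d → ZMod (2 * (L + 1))) i = x i - 1 := by simp
    rw [e3, e1, crossSign_update, reflFun_add_single, reflFun_add_single, reflFun_eq u i x, e2,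
      ← sub_eq_add_neg]
    by_cases h : i = k
    · simp only [h, if_true, hW]; ring
    · simp only [h, if_false, hW]; ring
  have hw : ∀ i, ∀ m : ℤ, ¬(0 ≤ m ∧ m < L) → u (Function.update (foldVertex x) i m) = 0 :=
    fun i m hm => hu0 _ fun hn => hm (by simpa using mem_box.1 hn i)
  simp only [hterm]
  by_cases h0 : ∃ j, reflSign (x j) = 0
  · obtain ⟨j, hj⟩ := h0
    refine Finset.sum_eq_zero fun i _ => ?_
    by_cases hij : i = j
    · subst hij
      obtain ⟨h1, h2, h3⟩ := oddRefl_of_zero (fun t => u (Function.update (foldVertex x) i t)) hj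
      simp only [hW]
      rw [h1, h2, h3]
      ring
    · have : crossSign i x = 0 :=
        Finset.prod_eq_zero (Finset.mem_erase.2 ⟨Ne.symm hij, Finset.mem_univ j⟩) hj
      rw [this, zero_mul]
  · push Not at h0
    have hbox : foldVertex x ∈ box d L := by
      refine mem_box.2 fun j => ?_
      have h1 := h0 j
      have hv := ZMod.val_lt (x j)
      have h2 : ¬((x j).val = 0 ∨ (x j).val = L + 1) := fun h => h1 (by rw [reflSign, if_pos h])
      unfold foldVertex fold
      omega
    have h1 := congrArg ((∏ j, reflSign (x j)) * ·) (hu _ hbox)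
    simp only [mul_zero, Finset.mul_sum] at h1
    refine Eq.trans (Finset.sum_congr rfl fun i _ => ?_) h1
    rw [← Finset.mul_prod_erase _ _ (Finset.mem_univ i)]
    change _ = reflSign (x i) * crossSign i x * _
    have up : ∀ t : ℤ, Function.update (foldVertex x) i (fold (x i) - 1 + t) =
        foldVertex x + Pi.single i t := fun t => by
      funext j
      by_cases h : j = i
      · subst h; simp [foldVertex]
      · simp [h]
    have u0 : Function.update (foldVertex x) i (fold (x i) - 1) = foldVertex x := by
      have := up 0; simpa using this
    have u1 : Function.update (foldVertex x) i (fold (x i) - 1 + 1) = foldVertex x + e i := up 1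
    have u2 : Function.update (foldVertex x) i (fold (x i) - 1 - 1) = foldVertex x - e i := by
      have := up (-1)
      rwa [← sub_eq_add_neg, Pi.single_neg, ← sub_eq_add_neg] at this
    rcases (reflSign_cases (x i)).resolve_left (h0 i) with hs | hs
    · obtain ⟨a1, a2, a3, a4, a5⟩ := oddRefl_of_pos (hw i) hs
      simp only [hW]
      rw [a1, a2, a3, a4, a5, u0, u1, u2, hs]
      ring
    · obtain ⟨a1, a2, a3, a4, a5⟩ := oddRefl_of_neg (hw i) hs
      simp only [hW]
      rw [a1, a2, a3, a4, a5, u0, u1, u2, hs]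
      ring

/-- The inclusion of the box in the torus. -/
def toTorus (L : ℕ) (y : Vertex d) : Fin d → ZMod (2 * (L + 1)) := fun j => ((y j + 1 : ℤ) : ZMod _)

theorem val_toTorus {y : Vertex d} {j : Fin d} (h0 : -1 ≤ y j) (h1 : y j ≤ L) :
    ((toTorus L y j).val : ℤ) = y j + 1 := by
  unfold toTorus
  rw [ZMod.val_intCast]
  exact Int.emod_eq_of_lt (by omega) (by push_cast; omega)

theorem reflFun_toTorus {u : Vertex d → ℝ} (hu0 : ∀ x ∉ box d L, u x = 0) {y : Vertex d}
    (hy : ∀ j, -1 ≤ y j ∧ y j ≤ L) : reflFun u (toTorus L y) = u y := by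
  have hv : ∀ j, ((toTorus L y j).val : ℤ) = y j + 1 := fun j => val_toTorus (hy j).1 (hy j).2
  have hfold : foldVertex (toTorus L y) = y := by
    funext j
    have := hv j
    have := hy j
    unfold foldVertex fold
    omega
  unfold reflFun
  rw [hfold]
  by_cases h : y ∈ box d L
  · rw [Finset.prod_eq_one, one_mul]
    intro j _
    have h1 := mem_box.1 h j
    have h2 := hv j
    unfold reflSign
    rw [if_neg (by omega), if_pos (by omega)]
  · rw [hu0 y h, mul_zero]

theorem bounds_of_mem_edges {b : Edge d} (hb : b ∈ edges (box d L)) (j : Fin d) :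
    (-1 ≤ b.1 j ∧ b.1 j < L) ∧ (-1 ≤ (b.1 + e b.2) j ∧ (b.1 + e b.2) j ≤ L) := by
  have he : (b.1 + e b.2) j = b.1 j + (if j = b.2 then 1 else 0) := by simp [e, Pi.single_apply]
  rcases (mem_edges _ _).1 hb with h | h
  · have := mem_box.1 h j
    rw [he]; split_ifs <;> omega
  · have := mem_box.1 h j
    rw [he] at this ⊢
    split_ifs at this ⊢ <;> omega

/-- Sixth-power gradient bound for the finite-volume corrector. -/
theorem box_gradient_pow_six_le (hd : 1 ≤ d) {ω : Config d} (hω : ∀ b, |ω b - 1| ≤ ellipticGap d)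
    {k : Fin d} {u : Vertex d → ℝ} (hu0 : ∀ x ∉ box d L, u x = 0)
    (hu : ∀ x ∈ box d L, ∑ i, (ω (x - e i, i) * (u x - u (x - e i) + if i = k then 1 else 0) -
      ω (x, i) * (u (x + e i) - u x + if i = k then 1 else 0)) = 0) :
    ∑ b ∈ edges (box d L), (u (b.1 + e b.2) - u b.1) ^ 6 ≤
      2 * (d * (2 * rieszConst d) ^ 6) * (d * 2048 * (2 * (L + 1)) ^ d) := by
  have h1 := gradient_pow_six_le_of_near_one (G := Fin d → ZMod (2 * (L + 1))) hd
    (fun i => Pi.single i 1) (reflFun u)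
    (fun i x => ω (Function.update (foldVertex x) i (foldLower (x i)), i))
    (fun i x => if i = k then crossSign i x else 0) (fun i x => hω _)
    (fun i x => by
      split_ifs
      · unfold crossSign
        rw [Finset.abs_prod]
        exact Finset.prod_le_one (fun j _ => abs_nonneg _) fun j _ => abs_reflSign_le_one _
      · simp)
    (reflected_equation hu0 hu)
  have hcard : (Fintype.card (Fin d → ZMod (2 * (L + 1))) : ℝ) = (2 * (L + 1)) ^ d := by
    rw [Fintype.card_fun, ZMod.card, Fintype.card_fin]; push_cast; ring
  rw [hcard] at h1
  have h3 : ∑ p : (Fin d → ZMod (2 * (L + 1))) × Fin d,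
      (reflFun u (p.1 + Pi.single p.2 1) - reflFun u p.1) ^ 6 ≤
      2 * (d * (2 * rieszConst d) ^ 6) * (d * 2048 * (2 * (L + 1)) ^ d) := by
    rw [Fintype.sum_prod_type, Finset.sum_comm]
    exact h1
  refine le_trans ?_ h3
  have hinj : Set.InjOn (fun b : Edge d => (toTorus L b.1, b.2)) (edges (box d L)) := by
    rintro ⟨y, i⟩ hb ⟨y', i'⟩ hb' heq
    simp only [Prod.mk.injEq] at heq ⊢
    refine ⟨funext fun j => ?_, heq.2⟩
    have b1 := (bounds_of_mem_edges hb j).1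
    have b2 := (bounds_of_mem_edges hb' j).1
    have v1 := val_toTorus (L := L) (y := y) (j := j) b1.1 b1.2.le
    have v2 := val_toTorus (L := L) (y := y') (j := j) b2.1 b2.2.le
    rw [heq.1] at v1
    omega
  have h2 : ∀ b ∈ edges (box d L), (u (b.1 + e b.2) - u b.1) ^ 6 =
      (reflFun u (toTorus L b.1 + Pi.single b.2 1) - reflFun u (toTorus L b.1)) ^ 6 :=
    fun b hb => by
      have b1 := bounds_of_mem_edges hb
      have e1 : toTorus L b.1 + Pi.single b.2 1 = toTorus L (b.1 + e b.2) := by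
        funext j
        by_cases h : j = b.2
        · subst h; simp [toTorus, e]
        · simp [toTorus, e, h]
      rw [e1, reflFun_toTorus hu0 fun j => (b1 j).2,
        reflFun_toTorus hu0 fun j => ⟨(b1 j).1.1, (b1 j).1.2.le⟩]
  rw [Finset.sum_congr rfl h2]
  set Φ : (Fin d → ZMod (2 * (L + 1))) × Fin d → ℝ := fun p =>
    (reflFun u (p.1 + Pi.single p.2 1) - reflFun u p.1) ^ 6
  refine (le_of_eq (Finset.sum_image (f := Φ) hinj).symm).trans ?_
  exact Finset.sum_le_sum_of_subset_of_nonneg (Finset.subset_univ _)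
    fun p _ _ => (by decide : Even 6).pow_nonneg _

end Reflection

/-! ### Deterministic bounds for the finite-volume harmonic coordinate -/

section FiniteVolume

variable {d : ℕ}

theorem toVec_add (x y : Vertex d) : toVec (x + y) = toVec x + toVec y := by
  ext k; simp [toVec]

theorem toVec_sub (x y : Vertex d) : toVec (x - y) = toVec x - toVec y := by
  ext k; simp [toVec]

theorem norm_toVec_e (i : Fin d) : ‖toVec (e i : Vertex d)‖ = 1 := by
  have : toVec (e i : Vertex d) = EuclideanSpace.single i (1 : ℝ) := by
    ext k
    simp [toVec, e, Pi.single_apply]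
  rw [this]; simp

theorem norm_pow_six_le (v : Vec d) : ‖v‖ ^ 6 ≤ (d : ℝ) ^ 2 * ∑ k, v k ^ 6 := by
  rcases Nat.eq_zero_or_pos d with h | h
  · subst h
    have : v = 0 := Subsingleton.elim _ _
    simp [this]
  · have h1 := pow_sum_div_card_le_sum_pow (s := Finset.univ) (f := fun k => v k ^ 2)
      (fun k _ => sq_nonneg _) 2
    have hd : (0 : ℝ) < d := by exact_mod_cast h
    rw [div_le_iff₀ (by simpa using by positivity)] at h1
    have h2 : ‖v‖ ^ 6 = (∑ k, v k ^ 2) ^ 3 := by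
      rw [← EuclideanSpace.real_norm_sq_eq]; ring
    rw [h2]
    refine h1.trans (le_of_eq ?_)
    simp only [Finset.card_univ, Fintype.card_fin, ← pow_mul]
    ring

theorem laplacian_apply (ω : Config d) (f : Vertex d → Vec d) (x : Vertex d) (k : Fin d) :
    laplacian ω f x k = laplacian ω (fun y => f y k) x := by
  simp [laplacian]

theorem card_edges_le (Λ : Finset (Vertex d)) : (edges Λ).card ≤ 2 * d * Λ.card := by
  classical
  unfold edges
  refine (Finset.card_union_le _ _).trans ?_
  have h1 : (Λ ×ˢ (Finset.univ : Finset (Fin d))).card = Λ.card * d := by simp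
  have h2 := Finset.card_image_le (s := Λ ×ˢ (Finset.univ : Finset (Fin d)))
    (f := fun b : Edge d => (b.1 - e b.2, b.2))
  rw [h1] at h2 ⊢
  linarith

theorem card_box (L : ℕ) : (box d L).card = L ^ d := by
  simp [box]

theorem ellipticGap_le (hd : 1 ≤ d) : ellipticGap d ≤ 1 / 4 := by
  have hC := one_le_rieszConst hd
  have hd1 : (1 : ℝ) ≤ d := by exact_mod_cast hd
  have : (1 : ℝ) ≤ d * (2 * rieszConst d) ^ 6 :=
    one_le_mul_of_one_le_of_one_le hd1 (one_le_pow₀ (by linarith))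
  unfold ellipticGap
  rw [inv_le_comm₀ (by positivity) (by norm_num)]
  norm_num
  linarith

theorem bounds_of_near_one (hd : 1 ≤ d) {ω : Config d} (hω : ∀ b, |ω b - 1| ≤ ellipticGap d)
    (b : Edge d) : 3 / 4 ≤ ω b ∧ ω b ≤ 5 / 4 := by
  have h1 := abs_le.1 ((hω b).trans (ellipticGap_le hd))
  constructor <;> linarith [h1.1, h1.2]

/-- The constant in the sixth-power bound for the finite-volume harmonic coordinate. -/
def gradConst (d : ℕ) : ℝ :=
  32 * ((d : ℝ) ^ 2 * (d * (2 * (d * (2 * rieszConst d) ^ 6) * (d * 2048 * 4 ^ d))) + 2 * d)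

/-- Each component of `Ψ - x` vanishes outside the box and solves the equation with a unit forcing
in direction `k`, to which the reflected bound applies. The torus has `(2(L + 1))^d ≤ 4^d L^d`
points, so the bound is of the order of the volume. -/
theorem finiteVolumeCoordinate_gradient_le (hd : 1 ≤ d) {ω : Config d}
    (hω : ∀ b, |ω b - 1| ≤ ellipticGap d) {L : ℕ} (hL : 1 ≤ L) :
    ∑ b ∈ edges (box d L), ‖finiteVolumeCoordinate (box d L) ω (b.1 + e b.2) -
      finiteVolumeCoordinate (box d L) ω b.1‖ ^ 6 ≤ gradConst d * (L : ℝ) ^ d := by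
  have hpos : ∀ b, 0 < ω b := fun b => by linarith [(bounds_of_near_one hd hω b).1]
  obtain ⟨hharm, hbd⟩ := finiteVolumeCoordinate_spec hd hpos (box d L)
  set Ψ := finiteVolumeCoordinate (box d L) ω
  set K := 2 * (d * (2 * rieszConst d) ^ 6) * (d * 2048 * (2 * ((L : ℝ) + 1)) ^ d) with hK
  have hcomp : ∀ k : Fin d, ∑ b ∈ edges (box d L),
      ((Ψ (b.1 + e b.2) - Ψ b.1 - toVec (e b.2)) k) ^ 6 ≤ K := fun k => by
    have h1 := box_gradient_pow_six_le hd hω (k := k) (u := fun x => Ψ x k - x k)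
      (fun x hx => by rw [hbd x hx]; simp [toVec]) (fun x hx => by
        have h2 := congrArg (fun v : Vec d => v k) (hharm x hx)
        simp only [laplacian_apply, PiLp.zero_apply] at h2
        unfold laplacian at h2
        refine neg_eq_zero.1 ((Finset.sum_neg_distrib _).symm.trans
          (Eq.trans (Finset.sum_congr rfl fun i _ => ?_) h2))
        have h3 : ((e i : Vertex d) k : ℝ) = if i = k then 1 else 0 := by
          simp [e, Pi.single_apply, eq_comm]
        simp only [smul_eq_mul, Pi.add_apply, Pi.sub_apply, Int.cast_add, Int.cast_sub, h3]
        ring)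
    refine le_trans (le_of_eq (Finset.sum_congr rfl fun b _ => ?_)) h1
    simp only [toVec, PiLp.sub_apply, Pi.add_apply, Int.cast_add]
    ring
  have hL1 : (1 : ℝ) ≤ L := by exact_mod_cast hL
  have hvec : ∑ b ∈ edges (box d L), ‖Ψ (b.1 + e b.2) - Ψ b.1 - toVec (e b.2)‖ ^ 6 ≤
      (d : ℝ) ^ 2 * (d * K) := by
    refine (Finset.sum_le_sum fun b _ => norm_pow_six_le _).trans ?_
    rw [← Finset.mul_sum, Finset.sum_comm]
    refine mul_le_mul_of_nonneg_left ?_ (by positivity)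
    refine (Finset.sum_le_sum fun k _ => hcomp k).trans ?_
    simp
  have hpt : ∀ b : Edge d, ‖Ψ (b.1 + e b.2) - Ψ b.1‖ ^ 6 ≤
      32 * (‖Ψ (b.1 + e b.2) - Ψ b.1 - toVec (e b.2)‖ ^ 6 + 1) := fun b => by
    have h1 : ‖Ψ (b.1 + e b.2) - Ψ b.1‖ ≤ ‖Ψ (b.1 + e b.2) - Ψ b.1 - toVec (e b.2)‖ + 1 := by
      have := norm_add_le (Ψ (b.1 + e b.2) - Ψ b.1 - toVec (e b.2)) (toVec (e b.2))
      rwa [sub_add_cancel, norm_toVec_e] at this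
    calc ‖Ψ (b.1 + e b.2) - Ψ b.1‖ ^ 6
        ≤ (‖Ψ (b.1 + e b.2) - Ψ b.1 - toVec (e b.2)‖ + 1) ^ 6 := by gcongr
      _ ≤ 2 ^ (6 - 1) * (‖Ψ (b.1 + e b.2) - Ψ b.1 - toVec (e b.2)‖ ^ 6 + 1 ^ 6) :=
          add_pow_le (norm_nonneg _) zero_le_one 6
      _ = _ := by norm_num
  refine (Finset.sum_le_sum fun b _ => hpt b).trans ?_
  rw [← Finset.mul_sum, Finset.sum_add_distrib]
  have hcard : ∑ _b ∈ edges (box d L), (1 : ℝ) ≤ 2 * d * (L : ℝ) ^ d := by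
    have := card_edges_le (box d L)
    rw [card_box] at this
    simp only [Finset.sum_const, nsmul_eq_mul, mul_one]
    exact_mod_cast this
  have hKL : K ≤ 2 * (d * (2 * rieszConst d) ^ 6) * (d * 2048 * 4 ^ d) * (L : ℝ) ^ d := by
    have h1 : (2 * ((L : ℝ) + 1)) ^ d ≤ (4 * L) ^ d :=
      pow_le_pow_left₀ (by positivity) (by linarith) d
    rw [mul_pow 4] at h1
    calc K ≤ 2 * (d * (2 * rieszConst d) ^ 6) * (d * 2048 * (4 ^ d * (L : ℝ) ^ d)) := by
          have := one_le_rieszConst hd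
          rw [hK]; gcongr
      _ = _ := by ring
  calc 32 * (∑ b ∈ edges (box d L), ‖Ψ (b.1 + e b.2) - Ψ b.1 - toVec (e b.2)‖ ^ 6 +
        ∑ _b ∈ edges (box d L), (1 : ℝ))
      ≤ 32 * ((d : ℝ) ^ 2 * (d * (2 * (d * (2 * rieszConst d) ^ 6) * (d * 2048 * 4 ^ d) *
          (L : ℝ) ^ d)) + 2 * d * (L : ℝ) ^ d) := by
        gcongr
        refine hvec.trans ?_
        gcongr
    _ = gradConst d * (L : ℝ) ^ d := by unfold gradConst; ring

/-- Summation by parts. -/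
theorem sum_edges_mul_gradient {Λ : Finset (Vertex d)} (ω : Config d) (w v : Vertex d → ℝ)
    (hv : ∀ x ∉ Λ, v x = 0) :
    ∑ b ∈ edges Λ, ω b * (w (b.1 + e b.2) - w b.1) * (v (b.1 + e b.2) - v b.1) =
      -∑ x ∈ Λ, v x * laplacian ω w x := by
  classical
  set g : Edge d → ℝ := fun b => ω b * (w (b.1 + e b.2) - w b.1) with hg
  have h1 : ∑ b ∈ edges Λ, g b * v b.1 = ∑ x ∈ Λ, ∑ i, g (x, i) * v x := by
    rw [← Finset.sum_product']
    refine (Finset.sum_subset (fun b hb => (mem_edges _ _).2 (Or.inl ?_)) ?_).symm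
    · simpa using hb
    · intro b _ hb
      rw [hv b.1 (by simpa using hb), mul_zero]
  have h2 : ∑ b ∈ edges Λ, g b * v (b.1 + e b.2) = ∑ x ∈ Λ, ∑ i, g (x - e i, i) * v x := by
    rw [← Finset.sum_product']
    symm
    refine Finset.sum_of_injOn (fun p : Vertex d × Fin d => (p.1 - e p.2, p.2)) ?_ ?_ ?_ ?_
    · rintro ⟨x, i⟩ _ ⟨y, j⟩ _ h
      simp only [Prod.mk.injEq] at h ⊢
      obtain ⟨h1, rfl⟩ := h
      exact ⟨sub_left_injective h1, rfl⟩
    · rintro ⟨x, i⟩ hx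
      refine (mem_edges _ _).2 (Or.inr ?_)
      simpa using hx
    · rintro ⟨x, i⟩ _ hx
      rw [hv, mul_zero]
      intro hn
      refine hx ⟨(x + e i, i), by simpa using hn, ?_⟩
      simp
    · rintro ⟨x, i⟩ _
      simp
  have h3 : ∀ b, g b * (v (b.1 + e b.2) - v b.1) = g b * v (b.1 + e b.2) - g b * v b.1 :=
    fun b => by ring
  have h4 : ∀ x, v x * laplacian ω w x = ∑ i, (g (x, i) * v x - g (x - e i, i) * v x) :=
    fun x => by
      unfold laplacian
      rw [Finset.mul_sum]
      refine Finset.sum_congr rfl fun i _ => ?_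
      simp only [hg, smul_eq_mul, sub_add_cancel]
      ring
  change ∑ b ∈ edges Λ, g b * (v (b.1 + e b.2) - v b.1) = _
  simp only [h3, h4, Finset.sum_sub_distrib]
  rw [h1, h2]
  ring

/-- A harmonic function minimizes the Dirichlet energy. -/
theorem energy_le_of_harmonic {Λ : Finset (Vertex d)} {ω : Config d}
    (hω : ∀ b, 3 / 4 ≤ ω b ∧ ω b ≤ 5 / 4) {w ζ : Vertex d → ℝ}
    (hw : ∀ x ∈ Λ, laplacian ω w x = 0) (hζ : ∀ x ∉ Λ, w x + ζ x = 0) :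
    ∑ b ∈ edges Λ, (w (b.1 + e b.2) - w b.1) ^ 2 ≤
      4 * ∑ b ∈ edges Λ, (ζ (b.1 + e b.2) - ζ b.1) ^ 2 := by
  -- The test function `w + ζ` vanishes outside `Λ`, so its energy pairing with the harmonic `w` is
  -- zero.
  have h1 := sum_edges_mul_gradient (Λ := Λ) ω w (fun x => w x + ζ x) hζ
  have h0 : ∑ x ∈ Λ, (w x + ζ x) * laplacian ω w x = 0 :=
    Finset.sum_eq_zero fun x hx => by rw [hw x hx, mul_zero]
  rw [h0, neg_zero] at h1
  have h2 : ∀ b ∈ edges Λ, 1 / 4 * (w (b.1 + e b.2) - w b.1) ^ 2 ≤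
      ω b * (w (b.1 + e b.2) - w b.1) * (w (b.1 + e b.2) + ζ (b.1 + e b.2) - (w b.1 + ζ b.1)) +
        (ζ (b.1 + e b.2) - ζ b.1) ^ 2 := fun b _ => by
    obtain ⟨h3, h4⟩ := hω b
    generalize w (b.1 + e b.2) = p, w b.1 = q, ζ (b.1 + e b.2) = r, ζ b.1 = s
    nlinarith [mul_nonneg (sub_nonneg.2 h3) (sq_nonneg (p - q + 1 / 2 * (r - s))),
      mul_nonneg (sub_nonneg.2 h4) (sq_nonneg (r - s)), sq_nonneg (p - q + 3 / 4 * (r - s))]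
  have h3 := Finset.sum_le_sum h2
  rw [Finset.sum_add_distrib, h1, zero_add, ← Finset.mul_sum] at h3
  linarith

theorem vec_energy_le_of_harmonic {Λ : Finset (Vertex d)} {ω : Config d}
    (hω : ∀ b, 3 / 4 ≤ ω b ∧ ω b ≤ 5 / 4) {w ζ : Vertex d → Vec d}
    (hw : ∀ x ∈ Λ, laplacian ω w x = 0) (hζ : ∀ x ∉ Λ, w x + ζ x = 0) :
    ∑ b ∈ edges Λ, ‖w (b.1 + e b.2) - w b.1‖ ^ 2 ≤
      4 * ∑ b ∈ edges Λ, ‖ζ (b.1 + e b.2) - ζ b.1‖ ^ 2 := by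
  simp only [EuclideanSpace.real_norm_sq_eq, PiLp.sub_apply]
  rw [Finset.sum_comm, Finset.sum_comm (s := edges Λ) (t := Finset.univ), Finset.mul_sum]
  refine Finset.sum_le_sum fun k _ => ?_
  refine energy_le_of_harmonic hω (w := fun x => w x k) (ζ := fun x => ζ x k) (fun x hx => ?_)
    fun x hx => ?_
  · rw [← laplacian_apply, hw x hx]; rfl
  · have := congrArg (fun v : Vec d => v k) (hζ x hx)
    simpa using this

/-- A cutoff function that vanishes outside `Λ` and equals `1` at distance `m` from the
complement of `Λ`. -/
def cutoff (Λ : Finset (Vertex d)) (m : ℝ) (x : Vertex d) : ℝ :=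
  min 1 (Metric.infDist x (Λ : Set (Vertex d))ᶜ / m)

theorem cutoff_of_notMem {Λ : Finset (Vertex d)} {m : ℝ} {x : Vertex d} (hx : x ∉ Λ) :
    cutoff Λ m x = 0 := by
  unfold cutoff
  rw [Metric.infDist_zero_of_mem (by simpa using hx), zero_div]
  simp

theorem cutoff_mem_Icc {Λ : Finset (Vertex d)} {m : ℝ} (hm : 0 < m) (x : Vertex d) :
    0 ≤ cutoff Λ m x ∧ cutoff Λ m x ≤ 1 :=
  ⟨le_min zero_le_one (div_nonneg Metric.infDist_nonneg hm.le), min_le_left _ _⟩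

theorem dist_add_e (x : Vertex d) (i : Fin d) : dist (x + e i) x ≤ 1 := by
  rw [dist_pi_le_iff zero_le_one]
  intro j
  rw [Int.dist_eq]
  by_cases h : j = i
  · subst h; simp [e]
  · simp [e, h]

theorem abs_cutoff_sub_le {Λ : Finset (Vertex d)} {m : ℝ} (hm : 0 < m) (x : Vertex d)
    (i : Fin d) : |cutoff Λ m (x + e i) - cutoff Λ m x| ≤ m⁻¹ := by
  have h1 := Metric.infDist_le_infDist_add_dist (s := (Λ : Set (Vertex d))ᶜ) (x := x + e i) (y := x)
  have h2 := Metric.infDist_le_infDist_add_dist (s := (Λ : Set (Vertex d))ᶜ) (x := x) (y := x + e i)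
  have h3 := dist_add_e x i
  rw [dist_comm] at h2
  unfold cutoff
  refine (abs_min_sub_min_le_max _ _ _ _).trans ?_
  rw [sub_self, abs_zero]
  refine max_le (by positivity) ?_
  rw [← sub_div, abs_div, abs_of_pos hm, inv_eq_one_div]
  gcongr
  rw [abs_le]
  constructor <;> linarith

theorem cutoff_eq_one {L m : ℕ} (hd : 1 ≤ d) (hm : 0 < m) {x : Vertex d}
    (hx : ∀ j, (m : ℤ) ≤ x j ∧ x j < L - m) : cutoff (box d L) m x = 1 := by
  unfold cutoff
  refine min_eq_left ?_
  rw [le_div_iff₀ (by exact_mod_cast hm), one_mul]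
  have hne : ((box d L : Set (Vertex d))ᶜ).Nonempty := by
    refine ⟨fun _ => -1, ?_⟩
    simp only [Set.mem_compl_iff, Finset.mem_coe, mem_box]
    intro h
    have := (h ⟨0, hd⟩).1
    omega
  refine (Metric.le_infDist hne).2 fun y hy => ?_
  simp only [Set.mem_compl_iff, Finset.mem_coe, mem_box, not_forall] at hy
  obtain ⟨j, hj⟩ := hy
  refine le_trans ?_ (dist_le_pi_dist x y j)
  rw [Int.dist_eq]
  have := hx j
  have h2 : (m : ℤ) ≤ |x j - y j| := by
    rw [le_abs]; omega
  exact_mod_cast h2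

/-- Comparison of the finite-volume coordinate with a harmonic function, in energy. -/
theorem finiteVolumeCoordinate_energy_le (hd : 1 ≤ d) {ω : Config d}
    (hω : ∀ b, |ω b - 1| ≤ ellipticGap d) {L m : ℕ} (hm : 0 < m) {f : Vertex d → Vec d}
    (hf : ∀ x, laplacian ω f x = 0) :
    ∑ b ∈ edges (box d L), ‖finiteVolumeCoordinate (box d L) ω (b.1 + e b.2) - f (b.1 + e b.2) -
      (finiteVolumeCoordinate (box d L) ω b.1 - f b.1)‖ ^ 2 ≤
    8 * ∑ b ∈ (edges (box d L)).filter fun b => cutoff (box d L) m b.1 ≠ 1,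
        ‖f (b.1 + e b.2) - toVec (b.1 + e b.2) - (f b.1 - toVec b.1)‖ ^ 2 +
      8 * (m : ℝ)⁻¹ ^ 2 * ∑ b ∈ edges (box d L), ‖f (b.1 + e b.2) - toVec (b.1 + e b.2)‖ ^ 2 := by
  have hm0 : (0 : ℝ) < m := by exact_mod_cast hm
  have hb := bounds_of_near_one hd hω
  have hpos : ∀ b, 0 < ω b := fun b => by linarith [(hb b).1]
  obtain ⟨hharm, hbd⟩ := finiteVolumeCoordinate_spec hd hpos (box d L)
  set Ψ := finiteVolumeCoordinate (box d L) ω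
  set η := cutoff (box d L) (m : ℝ) with hη
  set χ : Vertex d → Vec d := fun x => f x - toVec x with hχ
  -- Outside the box the cutoff vanishes, and `(1 - η)χ` equals `f - x`, the negative of `Ψ - f`.
  -- The product rule below separates the gradient of `χ` in the boundary layer from the gradient of
  -- the cutoff, which is at most `1 / m`.
  have h1 := vec_energy_le_of_harmonic (Λ := box d L) hb (w := fun x => Ψ x - f x)
    (ζ := fun x => (1 - η x) • χ x) (fun x hx => by
      have : (fun x => Ψ x - f x) = fun x => Ψ x + (-1 : ℝ) • f x := by funext x; simp [sub_eq_add_neg]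
      rw [this, laplacian_add, laplacian_smul, hharm x hx, hf x]; simp)
    (fun x hx => by
      rw [hη, cutoff_of_notMem hx, hbd x hx]; simp [hχ])
  refine h1.trans ?_
  have h2 : ∀ b : Edge d, ‖(1 - η (b.1 + e b.2)) • χ (b.1 + e b.2) - (1 - η b.1) • χ b.1‖ ^ 2 ≤
      2 * (if η b.1 ≠ 1 then ‖χ (b.1 + e b.2) - χ b.1‖ ^ 2 else 0) +
        2 * ((m : ℝ)⁻¹ ^ 2 * ‖χ (b.1 + e b.2)‖ ^ 2) := fun b => by
    have e1 : (1 - η (b.1 + e b.2)) • χ (b.1 + e b.2) - (1 - η b.1) • χ b.1 =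
        (1 - η b.1) • (χ (b.1 + e b.2) - χ b.1) +
          (η b.1 - η (b.1 + e b.2)) • χ (b.1 + e b.2) := by module
    have e2 : ‖(1 - η b.1) • (χ (b.1 + e b.2) - χ b.1)‖ ^ 2 ≤
        if η b.1 ≠ 1 then ‖χ (b.1 + e b.2) - χ b.1‖ ^ 2 else 0 := by
      split_ifs with h
      · have hc := cutoff_mem_Icc (Λ := box d L) hm0 b.1
        rw [← hη] at hc
        rw [norm_smul, mul_pow, Real.norm_eq_abs, sq_abs]
        refine mul_le_of_le_one_left (sq_nonneg _) ?_
        nlinarith [hc.1, hc.2]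
      · push Not at h
        rw [h]; simp
    have e3 : ‖(η b.1 - η (b.1 + e b.2)) • χ (b.1 + e b.2)‖ ^ 2 ≤
        (m : ℝ)⁻¹ ^ 2 * ‖χ (b.1 + e b.2)‖ ^ 2 := by
      rw [norm_smul, mul_pow, Real.norm_eq_abs, abs_sub_comm]
      gcongr
      exact abs_cutoff_sub_le hm0 _ _
    rw [e1]
    calc _ ≤ (‖(1 - η b.1) • (χ (b.1 + e b.2) - χ b.1)‖ +
          ‖(η b.1 - η (b.1 + e b.2)) • χ (b.1 + e b.2)‖) ^ 2 := by
            gcongr; exact norm_add_le _ _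
      _ ≤ 2 * (‖(1 - η b.1) • (χ (b.1 + e b.2) - χ b.1)‖ ^ 2 +
          ‖(η b.1 - η (b.1 + e b.2)) • χ (b.1 + e b.2)‖ ^ 2) := add_sq_le
      _ ≤ _ := by linarith
  have h3 := Finset.sum_le_sum fun b (_ : b ∈ edges (box d L)) => h2 b
  rw [Finset.sum_add_distrib, ← Finset.mul_sum, ← Finset.mul_sum, ← Finset.mul_sum,
    ← Finset.sum_filter] at h3
  linarith

/-- The layer lies over `[-1, L)^d` minus `[m, L - m)^d`. Its relative size follows from Bernoulli's
inequality, as the ratio of the side lengths is `1 - (2m + 1) / (L + 1)`. -/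
theorem card_boundary_layer_le (hd : 1 ≤ d) {L m : ℕ} (hm : 0 < m) (hmL : 2 * m ≤ L) :
    (((edges (box d L)).filter fun b => cutoff (box d L) m b.1 ≠ 1).card : ℝ) ≤
      3 * d ^ 2 * 2 ^ d * (m / L) * (L : ℝ) ^ d := by
  classical
  set big : Finset (Vertex d) := Fintype.piFinset fun _ => Finset.Ico (-1) (L : ℤ)
  set small : Finset (Vertex d) := Fintype.piFinset fun _ => Finset.Ico (m : ℤ) (L - m)
  have hsub : small ⊆ big := Fintype.piFinset_subset _ _ fun _ =>
    Finset.Ico_subset_Ico (by omega) (by omega)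
  have hsub2 : ((edges (box d L)).filter fun b => cutoff (box d L) m b.1 ≠ 1) ⊆
      (big \ small) ×ˢ Finset.univ := by
    intro b hb
    rw [Finset.mem_filter] at hb
    simp only [Finset.mem_product, Finset.mem_univ, and_true, Finset.mem_sdiff]
    refine ⟨?_, fun hs => hb.2 (cutoff_eq_one hd hm ?_)⟩
    · exact Fintype.mem_piFinset.2 fun j => Finset.mem_Ico.2 (bounds_of_mem_edges hb.1 j).1
    · exact fun j => Finset.mem_Ico.1 (Fintype.mem_piFinset.1 hs j)
  have hcard := Finset.card_le_card hsub2
  rw [Finset.card_product, Finset.card_sdiff_of_subset hsub, Finset.card_univ, Fintype.card_fin]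
    at hcard
  have hbig : big.card = (L + 1) ^ d := by
    simp only [big, Fintype.card_piFinset, Int.card_Ico, Finset.prod_const, Finset.card_univ,
      Fintype.card_fin]
    congr 1
  have hsmall : small.card = (L - 2 * m) ^ d := by
    simp only [small, Fintype.card_piFinset, Int.card_Ico, Finset.prod_const, Finset.card_univ,
      Fintype.card_fin]
    congr 1
    omega
  have hle := Finset.card_le_card hsub
  have hcard' : (((edges (box d L)).filter fun b => cutoff (box d L) m b.1 ≠ 1).card : ℝ) ≤
      (((L : ℝ) + 1) ^ d - (L - 2 * m) ^ d) * d := by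
    have h1 : (((edges (box d L)).filter fun b => cutoff (box d L) m b.1 ≠ 1).card : ℝ) ≤
      ((big.card - small.card : ℕ) : ℝ) * d := by exact_mod_cast hcard
    rw [Nat.cast_sub hle, hbig, hsmall] at h1
    push_cast [Nat.cast_sub hmL] at h1
    exact h1
  refine hcard'.trans ?_
  have hm1 : (1 : ℝ) ≤ m := by exact_mod_cast hm
  have hL0 : (2 : ℝ) * m ≤ L := by exact_mod_cast hmL
  have hLpos : (0 : ℝ) < L := by linarith
  set t : ℝ := (2 * m + 1) / (L + 1) with ht
  have ht1 : t ≤ 1 := by rw [ht, div_le_one (by positivity)]; linarith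
  have ht3 : t ≤ 3 * (m / L) := by
    rw [ht, ← mul_div_assoc, div_le_div_iff₀ (by positivity) hLpos]
    nlinarith
  have hbern := one_add_mul_le_pow (a := -t) (by linarith) d
  have hsplit : (L : ℝ) - 2 * m = (L + 1) * (1 + -t) := by
    rw [ht]; field_simp; ring
  rw [hsplit, mul_pow]
  have hL2 : ((L : ℝ) + 1) ^ d ≤ 2 ^ d * (L : ℝ) ^ d := by
    rw [← mul_pow]; gcongr; linarith
  calc (((L : ℝ) + 1) ^ d - ((L : ℝ) + 1) ^ d * (1 + -t) ^ d) * d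
      = ((L : ℝ) + 1) ^ d * (1 - (1 + -t) ^ d) * d := by ring
    _ ≤ ((L : ℝ) + 1) ^ d * (d * t) * d := by gcongr; linarith
    _ ≤ 2 ^ d * (L : ℝ) ^ d * (d * (3 * (m / L))) * d := by gcongr
    _ = _ := by ring

end FiniteVolume

/-! ### Moments of harmonic coordinates -/

section Moments

variable {d : ℕ}

theorem shift_shift (x y : Vertex d) (ω : Config d) : shift x (shift y ω) = shift (x + y) ω := by
  funext b
  simp only [shift]
  congr 2
  abel

theorem shift_zero (ω : Config d) : shift 0 ω = ω := by
  funext b; simp [shift]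

theorem measurable_shift (x : Vertex d) : Measurable (shift x : Config d → Config d) :=
  measurable_pi_lambda _ fun _ => measurable_pi_apply _

/-- The shift as a measurable equivalence. -/
def shiftEquiv (x : Vertex d) : Config d ≃ᵐ Config d where
  toFun := shift x
  invFun := shift (-x)
  left_inv ω := by rw [shift_shift, neg_add_cancel, shift_zero]
  right_inv ω := by rw [shift_shift, add_neg_cancel, shift_zero]
  measurable_toFun := measurable_shift x
  measurable_invFun := measurable_shift (-x)

variable {P : Measure (Config d)}

theorem IsShiftErgodic.lintegral_shift (hP : IsShiftErgodic P) (x : Vertex d)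
    (f : Config d → ℝ≥0∞) : ∫⁻ ω, f (shift x ω) ∂P = ∫⁻ ω, f ω ∂P :=
  (hP.measurePreserving x).lintegral_comp_emb (shiftEquiv x).measurableEmbedding f

theorem IsShiftErgodic.ae_shift (hP : IsShiftErgodic P) (x : Vertex d) {p : Config d → Prop}
    (h : ∀ᵐ ω ∂P, p ω) : ∀ᵐ ω ∂P, p (shift x ω) :=
  (hP.measurePreserving x).quasiMeasurePreserving.ae h

/-- Superadditivity of the upper integral needs no measurability, so the finite-volume coordinate
can be integrated without showing that it is measurable in `ω`. -/
theorem sum_lintegral_le {ι α : Type*} {mα : MeasurableSpace α} {μ : Measure α} (s : Finset ι)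
    (f : ι → α → ℝ≥0∞) : ∑ i ∈ s, ∫⁻ a, f i a ∂μ ≤ ∫⁻ a, ∑ i ∈ s, f i a ∂μ := by
  classical
  induction s using Finset.induction_on with
  | empty => simp
  | insert i s hi ih =>
    simp only [Finset.sum_insert hi]
    exact (add_le_add le_rfl ih).trans (le_lintegral_add _ _)

theorem ennreal_add_pow_le (a b : ℝ≥0∞) (n : ℕ) : (a + b) ^ n ≤ 2 ^ n * (a ^ n + b ^ n) := by
  rcases le_total a b with h | h
  · calc (a + b) ^ n ≤ (2 * b) ^ n := by gcongr; rw [two_mul]; gcongr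
      _ = 2 ^ n * b ^ n := mul_pow _ _ _
      _ ≤ _ := by gcongr; exact le_add_self
  · calc (a + b) ^ n ≤ (2 * a) ^ n := by gcongr; rw [two_mul]; gcongr
      _ = 2 ^ n * a ^ n := mul_pow _ _ _
      _ ≤ _ := by gcongr; exact le_self_add

/-- With `a = |∇Ψ|` and `b = |∇(Ψ - ψ)|`, truncation trades four of the six powers of the error for
`M⁴`, so that an energy estimate for `Ψ - ψ` is enough. -/
theorem min_pow_six_le {a b v M : ℝ≥0∞} (hv : v ≤ a + b) :
    min v M ^ 6 ≤ 64 * (a ^ 6 + M ^ 4 * b ^ 2) := by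
  rcases le_total b a with h | h
  · have h1 : v ≤ 2 * a := hv.trans (by rw [two_mul]; gcongr)
    calc min v M ^ 6 ≤ (2 * a) ^ 6 := by gcongr; exact (min_le_left _ _).trans h1
      _ = 64 * a ^ 6 := by rw [mul_pow]; norm_num
      _ ≤ _ := by gcongr; exact le_self_add
  · have h1 : v ≤ 2 * b := hv.trans (by rw [two_mul]; gcongr)
    calc min v M ^ 6 = min v M ^ 4 * min v M ^ 2 := by rw [← pow_add]
      _ ≤ M ^ 4 * (2 * b) ^ 2 := by
          gcongr
          · exact min_le_right _ _
          · exact (min_le_left _ _).trans h1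
      _ = 4 * (M ^ 4 * b ^ 2) := by rw [mul_pow]; ring
      _ ≤ 64 * (M ^ 4 * b ^ 2) := by gcongr; norm_num
      _ ≤ _ := by gcongr; exact le_add_self

theorem sum_enorm_pow {ι E : Type*} [NormedAddCommGroup E] (s : Finset ι) (f : ι → E) (n : ℕ) :
    ∑ i ∈ s, ‖f i‖ₑ ^ n = ENNReal.ofReal (∑ i ∈ s, ‖f i‖ ^ n) := by
  rw [ENNReal.ofReal_sum_of_nonneg fun i _ => by positivity]
  refine Finset.sum_congr rfl fun i _ => ?_
  rw [ENNReal.ofReal_pow (norm_nonneg _), ofReal_norm]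

/-- The second moment of the corrector. -/
def correctorMoment (P : Measure (Config d)) (ψ : Config d → Vertex d → Vec d) (x : Vertex d) :
    ℝ≥0∞ := ∫⁻ ω, ‖ψ ω x - toVec x‖ₑ ^ 2 ∂P

variable {ψ : Config d → Vertex d → Vec d}

theorem exists_norm_toVec_ge (hd : 1 ≤ d) (r : ℝ) : ∃ x : Vertex d, r ≤ ‖toVec x‖ := by
  obtain ⟨n, hn⟩ := exists_nat_ge r
  refine ⟨Pi.single ⟨0, hd⟩ (n : ℤ), hn.trans ?_⟩
  have : toVec (Pi.single ⟨0, hd⟩ (n : ℤ) : Vertex d) = EuclideanSpace.single ⟨0, hd⟩ (n : ℝ) := by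
    ext k
    by_cases h : k = ⟨0, hd⟩ <;> simp [toVec, Pi.single_apply, h]
  rw [this]; simp

theorem IsHarmonicCoordinate.correctorMoment_le_of_norm_ge (hψ : IsHarmonicCoordinate P ψ)
    {ε : ℝ≥0∞} (hε : 0 < ε) : ∃ r : ℝ, ∀ x : Vertex d, r ≤ ‖toVec x‖ →
      correctorMoment P ψ x ≤ ε * ‖toVec x‖ₑ ^ 2 := by
  have h1 := (hψ.sublinear.eventually (ge_mem_nhds hε))
  rw [eventually_comap] at h1
  obtain ⟨r, hr⟩ := eventually_atTop.1 h1
  refine ⟨max r 1, fun x hx => ?_⟩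
  have h2 := hr _ ((le_max_left _ _).trans hx) x rfl
  have h0 : ‖toVec x‖ₑ ^ 2 ≠ 0 := by
    have : 0 < ‖toVec x‖ := lt_of_lt_of_le one_pos ((le_max_right _ _).trans hx)
    simpa using norm_pos_iff.1 this
  rwa [ENNReal.div_le_iff h0 (by simp)] at h2

theorem IsHarmonicCoordinate.lintegral_increment (hP : IsShiftErgodic P)
    (hψ : IsHarmonicCoordinate P ψ) (F : Vec d → ℝ≥0∞) (x y : Vertex d) :
    ∫⁻ ω, F (ψ ω (x + y) - ψ ω x) ∂P = ∫⁻ ω, F (ψ ω y) ∂P := by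
  rw [← hP.lintegral_shift x fun ω => F (ψ ω y)]
  refine lintegral_congr_ae ?_
  filter_upwards [hψ.covariant] with ω hω
  rw [hω.2 x (x + y), add_sub_cancel_left]

theorem IsHarmonicCoordinate.lintegral_corrector_increment (hP : IsShiftErgodic P)
    (hψ : IsHarmonicCoordinate P ψ) (x y : Vertex d) :
    ∫⁻ ω, ‖ψ ω (x + y) - toVec (x + y) - (ψ ω x - toVec x)‖ₑ ^ 2 ∂P = correctorMoment P ψ y := by
  rw [correctorMoment, ← hψ.lintegral_increment hP (fun v => ‖v - toVec y‖ₑ ^ 2) x y]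
  refine lintegral_congr fun ω => ?_
  congr 2
  rw [toVec_add]; abel

/-- Sublinearity gives finiteness only far from the origin. For a fixed `x`, a distant `y` makes
both `y` and `x + y` far away, and `χ(x)` is `χ(x + y)` minus an increment distributed like `χ(y)`.
-/
theorem IsHarmonicCoordinate.correctorMoment_lt_top (hd : 1 ≤ d) (hP : IsShiftErgodic P)
    (hψ : IsHarmonicCoordinate P ψ) (x : Vertex d) : correctorMoment P ψ x < ∞ := by
  obtain ⟨r, hr⟩ := hψ.correctorMoment_le_of_norm_ge (ε := 1) one_pos
  have hfin : ∀ y, r ≤ ‖toVec y‖ → correctorMoment P ψ y < ∞ := fun y hy =>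
    (hr y hy).trans_lt (ENNReal.mul_lt_top ENNReal.one_lt_top (by simp))
  obtain ⟨y, hy⟩ := exists_norm_toVec_ge hd (max r (r + ‖toVec x‖))
  have h1 := hfin y ((le_max_left _ _).trans hy)
  have h2 : correctorMoment P ψ (x + y) < ∞ := by
    refine hfin _ ?_
    have : ‖toVec y‖ ≤ ‖toVec (x + y)‖ + ‖toVec x‖ := by
      have := norm_sub_le (toVec (x + y)) (toVec x)
      rwa [toVec_add, add_sub_cancel_left, ← toVec_add] at this
    linarith [(le_max_right r (r + ‖toVec x‖)).trans hy]
  have hm : ∀ z, AEMeasurable (fun ω => ‖ψ ω z - toVec z‖ₑ ^ 2) P := fun z =>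
    ((hψ.aemeasurable z).sub_const _).enorm.pow_const _
  calc correctorMoment P ψ x
      ≤ ∫⁻ ω, 2 ^ 2 * (‖ψ ω (x + y) - toVec (x + y)‖ₑ ^ 2 +
          ‖ψ ω (x + y) - toVec (x + y) - (ψ ω x - toVec x)‖ₑ ^ 2) ∂P := by
        refine lintegral_mono fun ω => ?_
        refine le_trans ?_ (ennreal_add_pow_le _ _ 2)
        gcongr
        refine le_trans (le_of_eq ?_) enorm_sub_le
        congr 1; abel
    _ = 2 ^ 2 * (correctorMoment P ψ (x + y) + correctorMoment P ψ y) := by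
        rw [lintegral_const_mul' _ _ (by norm_num), lintegral_add_left' (hm _),
          hψ.lintegral_corrector_increment hP]
        rfl
    _ < ∞ := ENNReal.mul_lt_top (by norm_num) (ENNReal.add_lt_top.2 ⟨h2, h1⟩)

theorem finite_norm_toVec_lt (r : ℝ) : {x : Vertex d | ‖toVec x‖ < r}.Finite := by
  obtain ⟨n, hn⟩ := exists_nat_ge r
  refine (Set.finite_Icc (fun _ => -(n : ℤ)) (fun _ => (n : ℤ)) : (Set.Icc _ _ :
    Set (Vertex d)).Finite).subset fun x hx => ?_
  have h1 : ∀ j, |x j| ≤ (n : ℤ) := fun j => by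
    have h2 : ‖toVec x j‖ ≤ ‖toVec x‖ := PiLp.norm_apply_le (toVec x) j
    have h3 : ‖toVec x j‖ = ((|x j| : ℤ) : ℝ) := by simp [toVec]
    have h4 : ((|x j| : ℤ) : ℝ) ≤ ((n : ℤ) : ℝ) := by
      rw [← h3]
      exact (h2.trans (le_of_lt hx)).trans (by simpa using hn)
    exact_mod_cast h4
  exact ⟨fun j => (abs_le.1 (h1 j)).1, fun j => (abs_le.1 (h1 j)).2⟩

theorem IsHarmonicCoordinate.correctorMoment_le (hψ : IsHarmonicCoordinate P ψ)
    {ε : ℝ} (hε : 0 < ε) : ∃ C : ℝ, 0 ≤ C ∧ ∀ x : Vertex d,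
      (correctorMoment P ψ x).toReal ≤ ε * ‖toVec x‖ ^ 2 + C := by
  obtain ⟨r, hr⟩ := hψ.correctorMoment_le_of_norm_ge (ENNReal.ofReal_pos.2 hε)
  refine ⟨∑ x ∈ (finite_norm_toVec_lt (d := d) r).toFinset, (correctorMoment P ψ x).toReal,
    Finset.sum_nonneg fun x _ => ENNReal.toReal_nonneg, fun x => ?_⟩
  have hs := fun x (_ : x ∈ (finite_norm_toVec_lt (d := d) r).toFinset) =>
    ENNReal.toReal_nonneg (a := correctorMoment P ψ x)
  rcases lt_or_ge ‖toVec x‖ r with h | h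
  · have h1 := Finset.single_le_sum hs (a := x) (by simpa using h)
    have : 0 ≤ ε * ‖toVec x‖ ^ 2 := by positivity
    linarith
  · have h1 := ENNReal.toReal_mono (by finiteness) (hr x h)
    rw [ENNReal.toReal_mul, ENNReal.toReal_ofReal hε.le, ENNReal.toReal_pow, toReal_enorm] at h1
    have := Finset.sum_nonneg hs
    linarith

/-- A truncated sixth moment of the gradient is controlled by the finite-volume bound. -/
theorem IsHarmonicCoordinate.truncated_moment_le (hd : 1 ≤ d) (hP : IsShiftErgodic P)
    [IsProbabilityMeasure P] (hell : ∀ᵐ ω ∂P, ∀ b, |ω b - 1| ≤ ellipticGap d)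
    (hψ : IsHarmonicCoordinate P ψ) (i : Fin d) (M : ℝ≥0∞) (hM : M ≠ ∞) {L m : ℕ} (hL : 1 ≤ L)
    (hm : 0 < m) :
    (L : ℝ≥0∞) ^ d * ∫⁻ ω, min ‖ψ ω (e i)‖ₑ M ^ 6 ∂P ≤
      64 * (ENNReal.ofReal (gradConst d * (L : ℝ) ^ d) + M ^ 4 *
        (8 * (((edges (box d L)).filter fun b => cutoff (box d L) m b.1 ≠ 1).card *
          ∑ j, correctorMoment P ψ (e j)) +
        8 * ENNReal.ofReal ((m : ℝ)⁻¹ ^ 2) *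
          ∑ b ∈ edges (box d L), correctorMoment P ψ (b.1 + e b.2))) := by
  set layer := (edges (box d L)).filter fun b => cutoff (box d L) m b.1 ≠ 1 with hlayer
  set X := ∫⁻ ω, min ‖ψ ω (e i)‖ₑ M ^ 6 ∂P with hX
  -- the left-hand side
  have hleft : (L : ℝ≥0∞) ^ d * X ≤
      ∫⁻ ω, ∑ b ∈ edges (box d L), min ‖ψ ω (b.1 + e b.2) - ψ ω b.1‖ₑ M ^ 6 ∂P := by
    have h1 : ∀ x, ∫⁻ ω, min ‖ψ ω (x + e i) - ψ ω x‖ₑ M ^ 6 ∂P = X := fun x =>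
      hψ.lintegral_increment hP (fun v => min ‖v‖ₑ M ^ 6) x (e i)
    have h2 : (L : ℝ≥0∞) ^ d * X =
        ∑ x ∈ box d L, ∫⁻ ω, min ‖ψ ω (x + e i) - ψ ω x‖ₑ M ^ 6 ∂P := by
      simp only [h1, Finset.sum_const, card_box, nsmul_eq_mul]
      push_cast; rfl
    rw [h2]
    refine (sum_lintegral_le _ _).trans (lintegral_mono fun ω => ?_)
    have hinj : Set.InjOn (fun x : Vertex d => ((x, i) : Edge d)) (box d L) :=
      fun x _ y _ h => (Prod.mk.inj h).1
    rw [← Finset.sum_image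
      (f := fun b : Edge d => min ‖ψ ω (b.1 + e b.2) - ψ ω b.1‖ₑ M ^ 6) hinj]
    refine Finset.sum_le_sum_of_subset fun b hb => ?_
    obtain ⟨x, hx, rfl⟩ := Finset.mem_image.1 hb
    exact (mem_edges _ _).2 (Or.inl hx)
  refine hleft.trans ?_
  -- the pointwise bound
  have hpt : ∀ᵐ ω ∂P, ∑ b ∈ edges (box d L), min ‖ψ ω (b.1 + e b.2) - ψ ω b.1‖ₑ M ^ 6 ≤
      64 * (ENNReal.ofReal (gradConst d * (L : ℝ) ^ d) + M ^ 4 *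
        (8 * ∑ b ∈ layer, ‖ψ ω (b.1 + e b.2) - toVec (b.1 + e b.2) - (ψ ω b.1 - toVec b.1)‖ₑ ^ 2 +
          8 * ENNReal.ofReal ((m : ℝ)⁻¹ ^ 2) *
            ∑ b ∈ edges (box d L), ‖ψ ω (b.1 + e b.2) - toVec (b.1 + e b.2)‖ₑ ^ 2)) := by
    filter_upwards [hell, hψ.harmonic] with ω hω hharm
    set Ψ := finiteVolumeCoordinate (box d L) ω
    have h1 := finiteVolumeCoordinate_gradient_le hd hω hL
    have h2 := finiteVolumeCoordinate_energy_le hd hω (L := L) hm hharm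
    rw [← ENNReal.ofReal_le_ofReal_iff (by
      exact (Finset.sum_nonneg fun b _ => by positivity).trans h1), ← sum_enorm_pow] at h1
    have h2' := ENNReal.ofReal_le_ofReal h2
    rw [← sum_enorm_pow, ENNReal.ofReal_add (by positivity) (by positivity),
      ENNReal.ofReal_mul (by norm_num), ENNReal.ofReal_mul (by positivity), ← sum_enorm_pow,
      ← sum_enorm_pow, ENNReal.ofReal_mul (by norm_num)] at h2'
    simp only [ENNReal.ofReal_ofNat] at h2'
    calc ∑ b ∈ edges (box d L), min ‖ψ ω (b.1 + e b.2) - ψ ω b.1‖ₑ M ^ 6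
        ≤ ∑ b ∈ edges (box d L), 64 * (‖Ψ (b.1 + e b.2) - Ψ b.1‖ₑ ^ 6 + M ^ 4 *
            ‖Ψ (b.1 + e b.2) - ψ ω (b.1 + e b.2) - (Ψ b.1 - ψ ω b.1)‖ₑ ^ 2) := by
          refine Finset.sum_le_sum fun b _ => min_pow_six_le ?_
          refine le_trans (le_of_eq ?_) enorm_sub_le
          congr 1; abel
      _ = 64 * (∑ b ∈ edges (box d L), ‖Ψ (b.1 + e b.2) - Ψ b.1‖ₑ ^ 6 + M ^ 4 *
            ∑ b ∈ edges (box d L),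
              ‖Ψ (b.1 + e b.2) - ψ ω (b.1 + e b.2) - (Ψ b.1 - ψ ω b.1)‖ₑ ^ 2) := by
          rw [← Finset.mul_sum, Finset.sum_add_distrib, ← Finset.mul_sum]
      _ ≤ _ := by gcongr
  refine (lintegral_mono_ae hpt).trans ?_
  -- integration
  have hm1 : ∀ z, AEMeasurable (fun ω => ψ ω z - toVec z) P := fun z =>
    (hψ.aemeasurable z).sub_const _
  have hm2 : ∀ b : Edge d, AEMeasurable (fun ω => ‖ψ ω (b.1 + e b.2) - toVec (b.1 + e b.2) -
      (ψ ω b.1 - toVec b.1)‖ₑ ^ 2) P := fun b => ((hm1 _).sub (hm1 _)).enorm.pow_const _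
  have hm3 : ∀ b : Edge d, AEMeasurable (fun ω => ‖ψ ω (b.1 + e b.2) - toVec (b.1 + e b.2)‖ₑ ^ 2) P :=
    fun b => (hm1 _).enorm.pow_const _
  rw [lintegral_const_mul' _ _ (by norm_num), lintegral_add_left' aemeasurable_const,
    lintegral_const_mul' _ _ (by finiteness), lintegral_add_left'
      ((Finset.aemeasurable_fun_sum _ fun b _ => hm2 b).const_mul _),
    lintegral_const_mul' _ _ (by norm_num), lintegral_const_mul' _ _ (by finiteness),
    lintegral_finsetSum' _ fun b _ => hm2 b, lintegral_finsetSum' _ fun b _ => hm3 b]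
  simp only [lintegral_const, measure_univ, mul_one, hψ.lintegral_corrector_increment hP]
  gcongr
  · refine (Finset.sum_le_sum fun b _ => Finset.single_le_sum (f := fun j =>
      correctorMoment P ψ (e j)) (fun _ _ => zero_le) (Finset.mem_univ b.2)).trans (le_of_eq ?_)
    simp
  · exact le_rfl

/-- The order of choice matters: `R` against `A`, then `ε` against `B R²`, and finally `m` against
`B g(ε)`. Each of the three errors is then at most `1`. -/
theorem toReal_le_of_forall_scale {X C A B : ℝ} {g : ℝ → ℝ} (hB : 0 ≤ B)
    (h : ∀ ε > 0, ∀ R m : ℕ, 2 ≤ R → 0 < m →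
      X ≤ C + A / R + B * (ε * (R : ℝ) ^ 2 + g ε / (m : ℝ) ^ 2)) : X ≤ C + 3 := by
  obtain ⟨R, hR⟩ := exists_nat_ge (max A 2)
  have hR2 : 2 ≤ R := by exact_mod_cast (le_max_right A 2).trans hR
  have hRA : A ≤ R := (le_max_left A 2).trans hR
  have hR0 : (0 : ℝ) < R := by positivity
  set ε : ℝ := 1 / ((B + 1) * (R : ℝ) ^ 2) with hε
  have hε0 : 0 < ε := by positivity
  obtain ⟨m, hm⟩ := exists_nat_ge (max (B * g ε) 1)
  have hm1 : (1 : ℝ) ≤ m := (le_max_right _ _).trans hm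
  have hmB : B * g ε ≤ m := (le_max_left _ _).trans hm
  have h1 := h ε hε0 R m hR2 (by exact_mod_cast hm1)
  have h2 : A / R ≤ 1 := (div_le_one hR0).2 hRA
  have h3 : B * (ε * (R : ℝ) ^ 2) ≤ 1 := by
    rw [hε]
    field_simp
    linarith
  have h4 : B * (g ε / (m : ℝ) ^ 2) ≤ 1 := by
    rw [← mul_div_assoc, div_le_one (by positivity)]
    nlinarith
  rw [mul_add] at h1
  linarith

theorem norm_toVec_sq_le {L : ℕ} (hL : 1 ≤ L) {b : Edge d} (hb : b ∈ edges (box d L)) :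
    ‖toVec (b.1 + e b.2)‖ ^ 2 ≤ d * (L : ℝ) ^ 2 := by
  rw [EuclideanSpace.real_norm_sq_eq]
  have : ∀ k, toVec (b.1 + e b.2) k ^ 2 ≤ (L : ℝ) ^ 2 := fun k => by
    have h1 := (bounds_of_mem_edges hb k).2
    rw [sq_le_sq, abs_of_nonneg (by positivity : (0 : ℝ) ≤ L)]
    have h2 : |(b.1 + e b.2) k| ≤ (L : ℤ) := abs_le.2 ⟨by omega, h1.2⟩
    have h3 : ((|(b.1 + e b.2) k| : ℤ) : ℝ) ≤ ((L : ℤ) : ℝ) := by exact_mod_cast h2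
    simpa [toVec] using h3
  refine (Finset.sum_le_sum fun k _ => this k).trans ?_
  simp

/-- The box has side `L = mR` and a boundary layer of width `m`. After division by `L^d` the layer
contributes order `1 / R`, and the cutoff gradient contributes order `εR² + g(ε) / m²`. The
coefficients depend on `M`, but the limiting bound does not. -/
theorem IsHarmonicCoordinate.truncated_moment_le_const (hd : 1 ≤ d) (hP : IsShiftErgodic P)
    [IsProbabilityMeasure P] (hell : ∀ᵐ ω ∂P, ∀ b, |ω b - 1| ≤ ellipticGap d)
    (hψ : IsHarmonicCoordinate P ψ) (i : Fin d) (M : ℝ≥0∞) (hM : M ≠ ∞) :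
    ∫⁻ ω, min ‖ψ ω (e i)‖ₑ M ^ 6 ∂P ≤ ENNReal.ofReal (64 * gradConst d + 3) := by
  have hd1 : (1 : ℝ) ≤ d := by exact_mod_cast hd
  set X := ∫⁻ ω, min ‖ψ ω (e i)‖ₑ M ^ 6 ∂P with hX
  have hXfin : X ≠ ∞ := by
    refine ne_top_of_le_ne_top (b := M ^ 6) (by finiteness) ?_
    calc X ≤ ∫⁻ _, M ^ 6 ∂P := lintegral_mono fun ω => by gcongr; exact min_le_right _ _
      _ = M ^ 6 := by simp
  rw [← ENNReal.ofReal_toReal hXfin]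
  refine ENNReal.ofReal_le_ofReal ?_
  have hgc : 0 ≤ gradConst d := by
    have := one_le_rieszConst hd
    unfold gradConst; positivity
  set m₀ : ℝ := M.toReal
  set S : ℝ := ∑ j, (correctorMoment P ψ (e j)).toReal with hS
  have hS0 : 0 ≤ S := Finset.sum_nonneg fun _ _ => ENNReal.toReal_nonneg
  have hm0 : 0 ≤ m₀ := ENNReal.toReal_nonneg
  have hcm : ∀ x, correctorMoment P ψ x ≠ ∞ := fun x => (hψ.correctorMoment_lt_top hd hP x).ne
  choose! g hg0 hg using fun (ε : ℝ) (hε : 0 < ε) => hψ.correctorMoment_le hε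
  refine toReal_le_of_forall_scale (A := 64 * m₀ ^ 4 * (8 * (3 * d ^ 2 * 2 ^ d * S)))
    (B := 64 * m₀ ^ 4 * (16 * d * d)) (g := g) (by positivity)
    fun ε hε R m hR hm => ?_
  set L := m * R with hLdef
  have hL1 : 1 ≤ L := Nat.mul_pos hm (by omega)
  have hmL : 2 * m ≤ L := by rw [hLdef]; nlinarith
  have hR0 : (0 : ℝ) < R := by positivity
  have hmr : (0 : ℝ) < m := by exact_mod_cast hm
  have hLr : (L : ℝ) = m * R := by rw [hLdef]; push_cast; rfl
  have hL0 : (0 : ℝ) < L := by exact_mod_cast hL1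
  have h1 := hψ.truncated_moment_le hd hP hell i M hM hL1 hm
  set layer := (edges (box d L)).filter fun b => cutoff (box d L) m b.1 ≠ 1
  have h2 := ENNReal.toReal_mono (by
    have := fun x => hcm x
    have e1 : ∑ j, correctorMoment P ψ (e j) ≠ ∞ := ENNReal.sum_ne_top.2 fun j _ => hcm _
    have e2 : ∑ b ∈ edges (box d L), correctorMoment P ψ (b.1 + e b.2) ≠ ∞ :=
      ENNReal.sum_ne_top.2 fun j _ => hcm _
    finiteness) h1
  have e1 : ∑ j, correctorMoment P ψ (e j) ≠ ∞ := ENNReal.sum_ne_top.2 fun j _ => hcm _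
  have e2 : ∑ b ∈ edges (box d L), correctorMoment P ψ (b.1 + e b.2) ≠ ∞ :=
    ENNReal.sum_ne_top.2 fun j _ => hcm _
  rw [ENNReal.toReal_mul, ENNReal.toReal_mul, ENNReal.toReal_add (by finiteness) (by finiteness),
    ENNReal.toReal_ofReal (by positivity), ENNReal.toReal_mul,
    ENNReal.toReal_add (by finiteness) (by finiteness), ENNReal.toReal_mul, ENNReal.toReal_mul,
    ENNReal.toReal_mul, ENNReal.toReal_mul, ENNReal.toReal_ofReal (by positivity),
    ENNReal.toReal_sum fun j _ => hcm _, ENNReal.toReal_sum fun j _ => hcm _] at h2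
  simp only [ENNReal.toReal_pow, ENNReal.toReal_natCast, ENNReal.toReal_ofNat] at h2
  have hN := card_boundary_layer_le hd hm hmL
  have hsum : ∑ b ∈ edges (box d L), (correctorMoment P ψ (b.1 + e b.2)).toReal ≤
      2 * d * (L : ℝ) ^ d * (d * (ε * (L : ℝ) ^ 2 + g ε)) := by
    have e3 : ∀ b ∈ edges (box d L), (correctorMoment P ψ (b.1 + e b.2)).toReal ≤
        d * (ε * (L : ℝ) ^ 2 + g ε) := fun b hb => by
      refine (hg ε hε _).trans ?_
      have e4 := mul_le_mul_of_nonneg_left (norm_toVec_sq_le hL1 hb) hε.le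
      have e5 : g ε ≤ d * g ε := le_mul_of_one_le_left (hg0 ε hε) hd1
      linarith
    refine (Finset.sum_le_sum e3).trans ?_
    rw [Finset.sum_const, nsmul_eq_mul]
    have e6 := card_edges_le (box d L)
    rw [card_box] at e6
    have e7 : ((edges (box d L)).card : ℝ) ≤ 2 * d * (L : ℝ) ^ d := by exact_mod_cast e6
    have := hg0 ε hε
    gcongr
  have hLd : (0 : ℝ) < (L : ℝ) ^ d := by positivity
  refine le_of_mul_le_mul_left ?_ hLd
  refine h2.trans ?_
  have hmLr : (m : ℝ) / L = 1 / R := by rw [hLr]; field_simp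
  rw [hmLr] at hN
  calc 64 * (gradConst d * (L : ℝ) ^ d + m₀ ^ 4 * (8 * ((layer.card : ℝ) * S) +
        8 * (m : ℝ)⁻¹ ^ 2 * ∑ b ∈ edges (box d L), (correctorMoment P ψ (b.1 + e b.2)).toReal))
      ≤ 64 * (gradConst d * (L : ℝ) ^ d + m₀ ^ 4 *
        (8 * ((3 * d ^ 2 * 2 ^ d * (1 / R) * (L : ℝ) ^ d) * S) +
        8 * (m : ℝ)⁻¹ ^ 2 * (2 * d * (L : ℝ) ^ d * (d * (ε * (L : ℝ) ^ 2 + g ε))))) := by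
        gcongr
    _ = _ := by
        rw [hLr]
        field_simp
        ring

/-- Sixth moments of the gradient of a harmonic coordinate. -/
theorem IsHarmonicCoordinate.moment_le (hd : 1 ≤ d) (hP : IsShiftErgodic P)
    [IsProbabilityMeasure P] (hell : ∀ᵐ ω ∂P, ∀ b, |ω b - 1| ≤ ellipticGap d)
    (hψ : IsHarmonicCoordinate P ψ) (i : Fin d) :
    ∫⁻ ω, ‖ψ ω (e i)‖ₑ ^ 6 ∂P ≤ ENNReal.ofReal (64 * gradConst d + 3) := by
  have h1 : Tendsto (fun n : ℕ => ∫⁻ ω, min ‖ψ ω (e i)‖ₑ n ^ 6 ∂P) atTop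
      (𝓝 (∫⁻ ω, ‖ψ ω (e i)‖ₑ ^ 6 ∂P)) := by
    refine lintegral_tendsto_of_tendsto_of_monotone
      (fun n => ((hψ.aemeasurable _).enorm.min aemeasurable_const).pow_const _) ?_ ?_
    · refine ae_of_all _ fun ω n k hnk => ?_
      dsimp only
      gcongr
    · refine ae_of_all _ fun ω => ?_
      have := (tendsto_const_nhds (x := ‖ψ ω (e i)‖ₑ)).min ENNReal.tendsto_nat_nhds_top
      rw [min_eq_left le_top] at this
      exact ((ENNReal.continuous_pow 6).tendsto _).comp this
  exact le_of_tendsto' h1 fun n => hψ.truncated_moment_le_const hd hP hell i n (by simp)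

theorem IsHarmonicCoordinate.gradNorm_lt_top (hd : 1 ≤ d) (hP : IsShiftErgodic P)
    [IsProbabilityMeasure P] (hell : ∀ᵐ ω ∂P, ∀ b, |ω b - 1| ≤ ellipticGap d)
    (hψ : IsHarmonicCoordinate P ψ) : gradNorm P 6 ψ < ∞ := by
  unfold gradNorm
  refine ENNReal.rpow_lt_top_of_nonneg (by norm_num) (ENNReal.sum_ne_top.2 fun i _ => ?_)
  refine ne_top_of_le_ne_top ENNReal.ofReal_ne_top (le_trans (le_of_eq ?_)
    (hψ.moment_le hd hP hell i))
  refine lintegral_congr_ae ?_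
  filter_upwards [hψ.covariant] with ω hω
  rw [hω.1, sub_zero, ENNReal.rpow_ofNat]

theorem IsHarmonicCoordinate.boxGradNorm_le (hd : 1 ≤ d) (hP : IsShiftErgodic P)
    [IsProbabilityMeasure P] (hell : ∀ᵐ ω ∂P, ∀ b, |ω b - 1| ≤ ellipticGap d)
    (hψ : IsHarmonicCoordinate P ψ) {L : ℕ} (hL : 1 ≤ L) :
    boxGradNorm P (box d L) 6 (fun ω x => finiteVolumeCoordinate (box d L) ω x - ψ ω x) ≤
      (64 * (ENNReal.ofReal (gradConst d) +
        2 * d * ENNReal.ofReal (64 * gradConst d + 3))) ^ (1 / 6 : ℝ) := by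
  unfold boxGradNorm
  refine ENNReal.rpow_le_rpow ?_ (by norm_num)
  set A := ENNReal.ofReal (gradConst d)
  set B := ENNReal.ofReal (64 * gradConst d + 3)
  have hcard0 : ((box d L).card : ℝ≥0∞) ≠ 0 := by
    rw [card_box]
    exact_mod_cast (pow_pos hL d).ne'
  rw [mul_comm, ← div_eq_mul_inv]
  refine ENNReal.div_le_of_le_mul ?_
  simp only [ENNReal.rpow_ofNat]
  have h1 : ∀ b : Edge d, ∫⁻ ω, ‖finiteVolumeCoordinate (box d L) ω (b.1 + e b.2) -
      ψ ω (b.1 + e b.2) - (finiteVolumeCoordinate (box d L) ω b.1 - ψ ω b.1)‖ₑ ^ 6 ∂P ≤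
      64 * (∫⁻ ω, ‖finiteVolumeCoordinate (box d L) ω (b.1 + e b.2) -
        finiteVolumeCoordinate (box d L) ω b.1‖ₑ ^ 6 ∂P + B) := fun b => by
    refine le_trans (lintegral_mono (g := fun ω =>
      64 * (‖finiteVolumeCoordinate (box d L) ω (b.1 + e b.2) -
        finiteVolumeCoordinate (box d L) ω b.1‖ₑ ^ 6 +
        ‖ψ ω (b.1 + e b.2) - ψ ω b.1‖ₑ ^ 6)) fun ω => ?_) ?_
    · have h64 : (64 : ℝ≥0∞) = 2 ^ 6 := by norm_num
      dsimp only
      rw [h64]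
      refine le_trans ?_ (ennreal_add_pow_le _ _ 6)
      gcongr
      refine le_trans (le_of_eq ?_) enorm_sub_le
      congr 1; abel
    · have hmeas : AEMeasurable (fun ω => ‖ψ ω (b.1 + e b.2) - ψ ω b.1‖ₑ ^ 6) P :=
        ((hψ.aemeasurable _).sub (hψ.aemeasurable _)).enorm.pow_const _
      -- Only the `ψ` summand has to be measurable for the integral to split.
      rw [lintegral_const_mul' _ _ (by norm_num), lintegral_add_right' _ hmeas,
        hψ.lintegral_increment hP (fun v => ‖v‖ₑ ^ 6)]
      gcongr
      exact hψ.moment_le hd hP hell b.2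
  have h2 : ∑ b ∈ edges (box d L), ∫⁻ ω, ‖finiteVolumeCoordinate (box d L) ω (b.1 + e b.2) -
      finiteVolumeCoordinate (box d L) ω b.1‖ₑ ^ 6 ∂P ≤ A * (L : ℝ≥0∞) ^ d := by
    refine (sum_lintegral_le _ _).trans ?_
    calc _ ≤ ∫⁻ _, A * (L : ℝ≥0∞) ^ d ∂P := by
          refine lintegral_mono_ae ?_
          filter_upwards [hell] with ω hω
          have h3 := ENNReal.ofReal_le_ofReal (finiteVolumeCoordinate_gradient_le hd hω hL)
          rw [← sum_enorm_pow, ENNReal.ofReal_mul' (by positivity),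
            ENNReal.ofReal_pow (by positivity), ENNReal.ofReal_natCast] at h3
          exact h3
      _ = _ := by simp
  refine (Finset.sum_le_sum fun b _ => h1 b).trans ?_
  rw [← Finset.mul_sum, Finset.sum_add_distrib, Finset.sum_const, nsmul_eq_mul, mul_assoc]
  gcongr
  rw [add_mul]
  have h4 := card_edges_le (box d L)
  have h5 : ((edges (box d L)).card : ℝ≥0∞) ≤ 2 * d * (box d L).card := by exact_mod_cast h4
  refine add_le_add ?_ ?_
  · rw [card_box]; push_cast; exact h2
  · calc ((edges (box d L)).card : ℝ≥0∞) * B ≤ 2 * d * (box d L).card * B := by gcongr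
      _ = _ := by ring

end Moments

/-! ### Existence of the infinite-volume harmonic coordinate -/

section Hilbert

variable {d : ℕ} {E : Type*} [NormedAddCommGroup E] [InnerProductSpace ℝ E]

/-- Isometry makes `‖U x f - f‖` subadditive in `x`, so the increments along generators control all
others. This upgrades convergence of gradients to convergence of the whole cocycle. -/
theorem norm_increment_le {U : Vertex d → E →ₗᵢ[ℝ] E} (hU : ∀ x y f, U x (U y f) = U (x + y) f)
    (f : E) (x : Vertex d) : ‖U x f - f‖ ≤ ∑ i, |(x i : ℝ)| * ‖U (e i) f - f‖ := by
  have hU0 : ∀ f, U 0 f = f := fun f => (U 0).injective (by rw [hU, add_zero])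
  have hadd : ∀ x y, ‖U (x + y) f - f‖ ≤ ‖U x f - f‖ + ‖U y f - f‖ := fun x y => by
    have h1 : U (x + y) f - f = U x (U y f - f) + (U x f - f) := by
      rw [map_sub, hU]; abel
    rw [h1, add_comm]
    refine (norm_add_le _ _).trans (le_of_eq ?_)
    rw [LinearIsometry.norm_map]
  have hneg : ∀ x, ‖U (-x) f - f‖ = ‖U x f - f‖ := fun x => by
    rw [← (U x).norm_map, map_sub, hU, add_neg_cancel, hU0, norm_sub_rev]
  have hnat : ∀ (n : ℕ) x, ‖U (n • x) f - f‖ ≤ n * ‖U x f - f‖ := fun n x => by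
    induction n with
    | zero => simp [hU0]
    | succ n ih =>
      rw [succ_nsmul]
      refine (hadd _ _).trans ?_
      push_cast
      linarith
  have hint : ∀ (z : ℤ) x, ‖U (z • x) f - f‖ ≤ |(z : ℝ)| * ‖U x f - f‖ := fun z x => by
    obtain ⟨n, rfl | rfl⟩ := z.eq_nat_or_neg
    · simpa using hnat n x
    · rw [neg_smul, hneg]
      simpa using hnat n x
  have hsum : ∀ s : Finset (Fin d), ‖U (∑ i ∈ s, x i • e i) f - f‖ ≤
      ∑ i ∈ s, |(x i : ℝ)| * ‖U (e i) f - f‖ := fun s => by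
    classical
    induction s using Finset.induction_on with
    | empty => simp [hU0]
    | insert i s hi ih =>
      rw [Finset.sum_insert hi, Finset.sum_insert hi]
      exact (hadd _ _).trans (add_le_add (hint _ _) ih)
  have hx : x = ∑ i, x i • e i := by
    funext j
    simp [e, Finset.sum_apply, Pi.single_apply]
  conv_lhs => rw [hx]
  exact hsum _

/-- Existence of the corrector in an abstract Hilbert space with an action of `ℤ^d` by isometries:
`M i` plays the role of the multiplication by the square root of the conductance in direction
`i`. -/
theorem exists_corrector [CompleteSpace E] {U : Vertex d → E →ₗᵢ[ℝ] E}
    (hU : ∀ x y f, U x (U y f) = U (x + y) f) {M N : Fin d → E →L[ℝ] E}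
    (hsymm : ∀ i f g, inner ℝ (M i f) g = inner ℝ f (M i g)) (hNM : ∀ i f, N i (M i f) = f)
    (hMN : ∀ i f, M i (N i f) = f) (v : Fin d → E) :
    ∃ c : Vertex d → E, (∀ x y, U x (c y) = c (x + y) - c x) ∧
      (∀ ε > 0, ∃ C : ℝ, ∀ x, ‖c x‖ ≤ ε * ∑ i, |(x i : ℝ)| + C) ∧
      ∑ i, (U (-e i) (M i (M i (v i - c (e i)))) - M i (M i (v i - c (e i)))) = 0 := by
  have hU0 : ∀ f, U 0 f = f := fun f => (U 0).injective (by rw [hU, add_zero])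
  -- the weighted gradient
  let T : E →ₗ[ℝ] PiLp 2 fun _ : Fin d => E :=
    { toFun := fun g => WithLp.toLp 2 fun i => M i (U (e i) g - g)
      map_add' := fun f g => by
        ext i
        change M i (U (e i) (f + g) - (f + g)) = M i (U (e i) f - f) + M i (U (e i) g - g)
        rw [← map_add (M i), map_add (U (e i))]
        congr 1; abel
      map_smul' := fun r f => by
        ext i
        change M i (U (e i) (r • f) - r • f) = r • M i (U (e i) f - f)
        rw [← map_smul (M i), map_smul (U (e i)), smul_sub] }
  let K : Submodule ℝ (PiLp 2 fun _ : Fin d => E) := (LinearMap.range T).topologicalClosure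
  have : CompleteSpace K := (Submodule.isClosed_topologicalClosure _).completeSpace_coe
  let V : PiLp 2 fun _ : Fin d => E := WithLp.toLp 2 fun i => M i (v i)
  -- `Φ` is the weighted gradient of the corrector. It need not be the gradient of an element of
  -- `E`, only a limit of such gradients, so `c x` is obtained as the limit of `U x (g n) - g n`.
  set Φ := K.starProjection V with hΦ
  have hΦK : Φ ∈ K := Submodule.starProjection_apply_mem _ _
  have horth : V - Φ ∈ Kᗮ := Submodule.sub_starProjection_mem_orthogonal V
  have hcl : Φ ∈ closure (LinearMap.range T : Set (PiLp 2 fun _ : Fin d => E)) := hΦK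
  obtain ⟨s, hs, hlim⟩ := mem_closure_iff_seq_limit.1 hcl
  choose g hg using fun n => LinearMap.mem_range.1 (hs n)
  set F : Fin d → E := fun i => N i (Φ i) with hF
  have hgF : ∀ i, Tendsto (fun n => U (e i) (g n) - g n) atTop (𝓝 (F i)) := fun i => by
    have h1 : Tendsto (fun n => s n i) atTop (𝓝 (Φ i)) :=
      ((PiLp.continuous_apply 2 _ i).tendsto _).comp hlim
    have h2 := ((N i).continuous.tendsto _).comp h1
    refine h2.congr fun n => ?_
    simp only [Function.comp]
    rw [← hg n]
    exact hNM i _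
  have hcauchy : ∀ x, ∃ c, Tendsto (fun n => U x (g n) - g n) atTop (𝓝 c) := fun x => by
    refine cauchySeq_tendsto_of_complete ?_
    rw [Metric.cauchySeq_iff']
    intro ε hε
    have hc : CauchySeq fun n => fun i => U (e i) (g n) - g n :=
      (tendsto_pi_nhds.2 hgF).cauchySeq
    set A : ℝ := ∑ i, |(x i : ℝ)| with hA
    have hA0 : 0 ≤ A := Finset.sum_nonneg fun _ _ => abs_nonneg _
    obtain ⟨n₀, hn₀⟩ := Metric.cauchySeq_iff'.1 hc (ε / (A + 1)) (by positivity)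
    refine ⟨n₀, fun n hn => ?_⟩
    have h1 : ∀ i, ‖U (e i) (g n - g n₀) - (g n - g n₀)‖ ≤ ε / (A + 1) := fun i => by
      have h2 := (dist_le_pi_dist _ _ i).trans (hn₀ n hn).le
      rw [dist_eq_norm] at h2
      refine le_trans (le_of_eq ?_) h2
      rw [map_sub]; congr 1; abel
    rw [dist_eq_norm]
    have h3 : U x (g n) - g n - (U x (g n₀) - g n₀) = U x (g n - g n₀) - (g n - g n₀) := by
      rw [map_sub]; abel
    rw [h3]
    refine (norm_increment_le hU _ x).trans_lt ?_
    calc ∑ i, |(x i : ℝ)| * ‖U (e i) (g n - g n₀) - (g n - g n₀)‖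
        ≤ ∑ i, |(x i : ℝ)| * (ε / (A + 1)) := by gcongr; exact h1 _
      _ = A * (ε / (A + 1)) := by rw [← Finset.sum_mul]
      _ < ε := by
        rw [← mul_div_assoc, div_lt_iff₀ (by positivity)]
        nlinarith
  choose c hc using hcauchy
  have hce : ∀ i, c (e i) = F i := fun i => tendsto_nhds_unique (hc (e i)) (hgF i)
  refine ⟨c, fun x y => ?_, fun ε hε => ?_, ?_⟩
  · have h1 := ((U x).continuous.tendsto _).comp (hc y)
    refine tendsto_nhds_unique h1 (((hc (x + y)).sub (hc x)).congr fun n => ?_)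
    simp only [Function.comp, map_sub, hU]
    abel
  -- Sublinearity: `c` differs from the coboundary of a fixed `g n` by at most `ε` on each
  -- generator, and a coboundary is bounded by `2‖g n‖`.
  · have h1 : ∀ i, ∀ᶠ n in atTop, ‖F i - (U (e i) (g n) - g n)‖ ≤ ε := fun i => by
      have h2 := ((hgF i).const_sub (F i)).norm
      rw [sub_self, norm_zero] at h2
      exact h2.eventually (ge_mem_nhds hε)
    obtain ⟨n, hn⟩ := (eventually_all.2 h1).exists
    refine ⟨2 * ‖g n‖, fun x => ?_⟩
    have h2 : ‖c x - (U x (g n) - g n)‖ ≤ ∑ i, |(x i : ℝ)| * ‖F i - (U (e i) (g n) - g n)‖ := by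
      refine le_of_tendsto_of_tendsto' ((hc x).sub_const _).norm
        (tendsto_finsetSum _ fun i _ => (((hgF i).sub_const _).norm.const_mul _)) fun m => ?_
      have h3 : ∀ x, U x (g m) - g m - (U x (g n) - g n) = U x (g m - g n) - (g m - g n) :=
        fun x => by rw [map_sub]; abel
      simp only [h3]
      exact norm_increment_le hU _ x
    have h4 : ‖U x (g n) - g n‖ ≤ 2 * ‖g n‖ := by
      refine (norm_sub_le _ _).trans (le_of_eq ?_)
      rw [LinearIsometry.norm_map]; ring
    have h5 : ∑ i, |(x i : ℝ)| * ‖F i - (U (e i) (g n) - g n)‖ ≤ ε * ∑ i, |(x i : ℝ)| := by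
      rw [Finset.mul_sum]
      refine Finset.sum_le_sum fun i _ => ?_
      rw [mul_comm]
      gcongr
      exact hn i
    have h6 := norm_add_le (c x - (U x (g n) - g n)) (U x (g n) - g n)
    rw [sub_add_cancel] at h6
    linarith
  · set Q : Fin d → E := fun i => M i (M i (v i - c (e i))) with hQ
    change ∑ i, (U (-e i) (Q i) - Q i) = 0
    -- `Q` is the flux, that is, `M` applied to the residual `V - Φ`. Orthogonality of the residual
    -- to every weighted gradient says that `Q` is divergence-free.
    have hQV : ∀ i, Q i = M i ((V - Φ) i) := fun i => by
      simp only [hQ, hce, hF, map_sub, hMN]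
      simp [V]
    have h1 : ∀ f : E, inner ℝ f (∑ i, (U (-e i) (Q i) - Q i)) = 0 := fun f => by
      have h2 : inner ℝ (T f) (V - Φ) = 0 :=
        (Submodule.mem_orthogonal _ _).1 horth _
          (Submodule.le_topologicalClosure _ (LinearMap.mem_range_self T f))
      rw [PiLp.inner_apply] at h2
      rw [inner_sum, ← h2]
      refine Finset.sum_congr rfl fun i _ => ?_
      change _ = inner ℝ (M i (U (e i) f - f)) ((V - Φ) i)
      rw [hsymm, ← hQV, inner_sub_left, inner_sub_right]
      congr 1
      rw [← (U (e i)).inner_map_map, hU, add_neg_cancel, hU0]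
    exact inner_self_eq_zero.1 (h1 _)

end Hilbert

/-! ### The corrector in `L²(P)` -/

section Corrector

theorem exists_mul_clm {α : Type*} {mα : MeasurableSpace α} {μ : Measure α} {m : α → ℝ}
    (hm : Measurable m) {C : ℝ} (hC : ∀ᵐ a ∂μ, ‖m a‖ ≤ C) :
    ∃ T : Lp ℝ 2 μ →L[ℝ] Lp ℝ 2 μ, ∀ f, T f =ᵐ[μ] fun a => m a * f a := by
  have hM : MemLp m ∞ μ := memLp_top_of_bound hm.aestronglyMeasurable C hC
  refine ⟨(ContinuousLinearMap.mul ℝ ℝ).holderL μ ∞ 2 2 hM.toLp, fun f => ?_⟩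
  rw [ContinuousLinearMap.holderL_apply_apply]
  filter_upwards [(ContinuousLinearMap.mul ℝ ℝ).coeFn_holder (r := 2) hM.toLp f, hM.coeFn_toLp]
    with a h1 h2
  rw [h1, h2]
  rfl

theorem coeFn_lp_sum {α ι : Type*} {mα : MeasurableSpace α} {μ : Measure α} (s : Finset ι)
    (f : ι → Lp ℝ 2 μ) : (∑ i ∈ s, f i : Lp ℝ 2 μ) =ᵐ[μ] fun a => ∑ i ∈ s, f i a := by
  classical
  induction s using Finset.induction_on with
  | empty =>
    simp only [Finset.sum_empty]
    exact Lp.coeFn_zero ℝ 2 μ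
  | insert i s hi ih =>
    rw [Finset.sum_insert hi]
    filter_upwards [ih, Lp.coeFn_add (f i) (∑ i ∈ s, f i)] with a h1 h2
    rw [h2, Pi.add_apply, h1, Finset.sum_insert hi]

variable {d : ℕ} {P : Measure (Config d)}

/-- The corrector of the `k`-th coordinate. -/
theorem exists_coordinate_corrector (hd : 1 ≤ d) (hP : IsShiftErgodic P) [IsProbabilityMeasure P]
    (hell : ∀ᵐ ω ∂P, ∀ b, |ω b - 1| ≤ ellipticGap d) (k : Fin d) :
    ∃ c : Vertex d → Lp ℝ 2 P,
      (∀ x y, ∀ᵐ ω ∂P, c y (shift x ω) = c (x + y) ω - c x ω) ∧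
      (∀ ε > 0, ∃ C : ℝ, ∀ x, ‖c x‖ ≤ ε * ∑ i, |(x i : ℝ)| + C) ∧
      ∀ᵐ ω ∂P, ∑ i, (ω (0, i) * (toVec (e i) k - c (e i) ω) +
        ω (-e i, i) * (toVec (-e i) k - c (-e i) ω)) = 0 := by
  let U : Vertex d → Lp ℝ 2 P →ₗᵢ[ℝ] Lp ℝ 2 P := fun x =>
    Lp.compMeasurePreservingₗᵢ ℝ (shift x) (hP.measurePreserving x)
  have hUf : ∀ x f, U x f =ᵐ[P] fun ω => f (shift x ω) := fun x f =>
    Lp.coeFn_compMeasurePreserving f (hP.measurePreserving x)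
  have hU : ∀ x y f, U x (U y f) = U (x + y) f := fun x y f => by
    refine Lp.ext ?_
    filter_upwards [hUf x (U y f), hUf (x + y) f, hP.ae_shift x (hUf y f)] with ω h1 h2 h3
    rw [h1, h3, h2, shift_shift, add_comm]
  have hb : ∀ᵐ ω ∂P, ∀ b, 3 / 4 ≤ ω b ∧ ω b ≤ 5 / 4 := by
    filter_upwards [hell] with ω hω b using bounds_of_near_one hd hω b
  have hmeas : ∀ i : Fin d, Measurable fun ω : Config d => √(ω (0, i)) := fun i =>
    (measurable_pi_apply _).sqrt
  have hM : ∀ i : Fin d, ∃ T : Lp ℝ 2 P →L[ℝ] Lp ℝ 2 P, ∀ f,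
      T f =ᵐ[P] fun ω => √(ω (0, i)) * f ω := fun i => by
    refine exists_mul_clm (C := 2) (hmeas i) ?_
    filter_upwards [hb] with ω hω
    rw [Real.norm_of_nonneg (Real.sqrt_nonneg _), Real.sqrt_le_left (by norm_num)]
    linarith [(hω (0, i)).2]
  have hN : ∀ i : Fin d, ∃ T : Lp ℝ 2 P →L[ℝ] Lp ℝ 2 P, ∀ f,
      T f =ᵐ[P] fun ω => (√(ω (0, i)))⁻¹ * f ω := fun i => by
    refine exists_mul_clm (C := 2) (hmeas i).inv ?_
    filter_upwards [hb] with ω hω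
    rw [Real.norm_of_nonneg (inv_nonneg.2 (Real.sqrt_nonneg _))]
    refine inv_le_of_inv_le₀ (by norm_num) (Real.le_sqrt_of_sq_le ?_)
    linarith [(hω (0, i)).1]
  choose M hM using hM
  choose N hN using hN
  let v : Fin d → Lp ℝ 2 P := fun i =>
    (memLp_const (toVec (e i : Vertex d) k) : MemLp (fun _ : Config d => _) 2 P).toLp
  have hv : ∀ i, v i =ᵐ[P] fun _ => toVec (e i : Vertex d) k := fun i => MemLp.coeFn_toLp _
  obtain ⟨c, hc, hsub, hharm⟩ := exists_corrector hU (M := M) (N := N)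
    (fun i f g => by
      rw [L2.inner_def, L2.inner_def]
      refine integral_congr_ae ?_
      filter_upwards [hM i f, hM i g] with ω h1 h2
      rw [h1, h2]
      simp only [RCLike.inner_apply, conj_trivial]
      ring)
    (fun i f => by
      refine Lp.ext ?_
      filter_upwards [hN i (M i f), hM i f, hb] with ω h1 h2 h3
      have : √(ω (0, i)) ≠ 0 := (Real.sqrt_pos.2 (by linarith [(h3 (0, i)).1])).ne'
      rw [h1, h2, inv_mul_cancel_left₀ this])
    (fun i f => by
      refine Lp.ext ?_
      filter_upwards [hM i (N i f), hN i f, hb] with ω h1 h2 h3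
      have : √(ω (0, i)) ≠ 0 := (Real.sqrt_pos.2 (by linarith [(h3 (0, i)).1])).ne'
      rw [h1, h2, mul_inv_cancel_left₀ this]) v
  have hcoc : ∀ x y, ∀ᵐ ω ∂P, c y (shift x ω) = c (x + y) ω - c x ω := fun x y => by
    have h0 := hUf x (c y)
    rw [hc] at h0
    filter_upwards [h0, Lp.coeFn_sub (c (x + y)) (c x)] with ω h1 h2
    rw [← h1, h2, Pi.sub_apply]
  refine ⟨c, hcoc, hsub, ?_⟩
  have hQ : ∀ i, ∀ᵐ ω ∂P, M i (M i (v i - c (e i))) ω =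
      ω (0, i) * (toVec (e i) k - c (e i) ω) := fun i => by
    filter_upwards [hM i (M i (v i - c (e i))), hM i (v i - c (e i)), hb,
      Lp.coeFn_sub (v i) (c (e i)), hv i] with ω h1 h2 h3 h4 h5
    rw [h1, h2, h4, Pi.sub_apply, h5, ← mul_assoc,
      Real.mul_self_sqrt (by linarith [(h3 (0, i)).1])]
  have hterm : ∀ i, ∀ᵐ ω ∂P,
      (U (-e i) (M i (M i (v i - c (e i)))) - M i (M i (v i - c (e i))) : Lp ℝ 2 P) ω =
      -(ω (0, i) * (toVec (e i) k - c (e i) ω) +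
        ω (-e i, i) * (toVec (-e i) k - c (-e i) ω)) := fun i => by
    -- The cocycle identity gives `c(e i) ∘ shift(-e i) = c 0 - c(-e i)`, and `c 0 = 0`. The shifted
    -- flux is thus the flux through the edge from `-e i` to `0`.
    filter_upwards [Lp.coeFn_sub (U (-e i) (M i (M i (v i - c (e i)))))
      (M i (M i (v i - c (e i)))), hQ i, hUf (-e i) (M i (M i (v i - c (e i)))),
      hP.ae_shift (-e i) (hQ i), hcoc (-e i) (e i), hcoc 0 0] with ω h1 h2 h3 h4 h5 h6
    rw [add_zero, sub_self, shift_zero] at h6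
    rw [h1, Pi.sub_apply, h2, h3, h4, h5, neg_add_cancel, h6]
    have h7 : toVec (-e i : Vertex d) k = -toVec (e i : Vertex d) k := by simp [toVec]
    simp only [shift, add_zero, h7]
    ring
  have hzero : ∀ᵐ ω ∂P, ∑ i, (U (-e i) (M i (M i (v i - c (e i)))) -
      M i (M i (v i - c (e i))) : Lp ℝ 2 P) ω = 0 := by
    have h0 := coeFn_lp_sum Finset.univ fun i =>
      U (-e i) (M i (M i (v i - c (e i)))) - M i (M i (v i - c (e i)))
    rw [hharm] at h0
    filter_upwards [h0, Lp.coeFn_zero ℝ 2 P] with ω h1 h2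
    rw [h2, Pi.zero_apply] at h1
    simpa using h1.symm
  filter_upwards [hzero, ae_all_iff.2 hterm] with ω h1 h2
  simp only [h2, Finset.sum_neg_distrib, neg_eq_zero] at h1
  exact h1

end Corrector

/-! ### From the corrector to a harmonic coordinate -/

section Existence

variable {d : ℕ} {P : Measure (Config d)}

theorem lintegral_vec_sq {φ : Config d → Vec d} {c : Fin d → Lp ℝ 2 P}
    (h : ∀ᵐ ω ∂P, ∀ k, ‖φ ω k‖ = ‖c k ω‖) :
    ∫⁻ ω, ‖φ ω‖ₑ ^ 2 ∂P = ENNReal.ofReal (∑ k, ‖c k‖ ^ 2) := by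
  have h1 : ∀ k, ∫⁻ ω, ‖c k ω‖ₑ ^ 2 ∂P = ‖c k‖ₑ ^ 2 := fun k => by
    have := eLpNorm_nnreal_pow_eq_lintegral (f := c k) (μ := P) (p := 2) two_ne_zero
    simp only [NNReal.coe_ofNat, ENNReal.rpow_ofNat] at this
    rw [Lp.enorm_def]
    exact_mod_cast this.symm
  rw [← sum_enorm_pow, ← Finset.sum_congr rfl fun k _ => h1 k,
    ← lintegral_finsetSum' _ fun k _ => (Lp.aestronglyMeasurable (c k)).enorm.pow_const 2]
  refine lintegral_congr_ae ?_
  filter_upwards [h] with ω hω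
  rw [sum_enorm_pow, ← ofReal_norm, ← ENNReal.ofReal_pow (norm_nonneg _),
    EuclideanSpace.norm_sq_eq]
  simp only [hω]

theorem sum_abs_le_norm_toVec (x : Vertex d) : ∑ i, |(x i : ℝ)| ≤ d * ‖toVec x‖ := by
  refine (Finset.sum_le_card_nsmul _ _ ‖toVec x‖ fun i _ => ?_).trans (by simp)
  exact PiLp.norm_apply_le (toVec x) i

theorem tendsto_sq_div_of_sublinear {a : Vertex d → Fin d → ℝ} (ha : ∀ x k, 0 ≤ a x k)
    (h : ∀ k, ∀ ε > 0, ∃ C : ℝ, ∀ x, a x k ≤ ε * ∑ i, |(x i : ℝ)| + C) :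
    Tendsto (fun x : Vertex d => ENNReal.ofReal (∑ k, a x k ^ 2) / ‖toVec x‖ₑ ^ 2)
      (comap (fun x : Vertex d => ‖toVec x‖) atTop) (𝓝 0) := by
  have hlim : ∀ k, Tendsto (fun x : Vertex d => a x k / ‖toVec x‖)
      (comap (fun x : Vertex d => ‖toVec x‖) atTop) (𝓝 0) := fun k => by
    rw [Metric.tendsto_nhds]
    intro ε hε
    obtain ⟨C, hC⟩ := h k (ε / (2 * (d + 1))) (by positivity)
    filter_upwards [tendsto_comap.eventually (eventually_gt_atTop (2 * |C| / ε)),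
      tendsto_comap.eventually (eventually_gt_atTop (0 : ℝ))] with x hx hx0
    rw [Real.dist_eq, sub_zero, abs_of_nonneg (div_nonneg (ha x k) hx0.le), div_lt_iff₀ hx0]
    rw [div_lt_iff₀ hε] at hx
    have h1 : ε / (2 * (d + 1)) * ∑ i, |(x i : ℝ)| ≤ ε / 2 * ‖toVec x‖ := by
      calc ε / (2 * (d + 1)) * ∑ i, |(x i : ℝ)| ≤ ε / (2 * (d + 1)) * ((d + 1) * ‖toVec x‖) := by
            gcongr
            linarith [sum_abs_le_norm_toVec x]
        _ = ε / 2 * ‖toVec x‖ := by field_simp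
    linarith [hC x, le_abs_self C]
  have hsum := tendsto_finsetSum Finset.univ fun k (_ : k ∈ Finset.univ) => (hlim k).pow 2
  have h0 := ENNReal.tendsto_ofReal hsum
  simp only [ne_eq, OfNat.ofNat_ne_zero, not_false_eq_true, zero_pow, Finset.sum_const_zero,
    ENNReal.ofReal_zero] at h0
  refine h0.congr' ?_
  filter_upwards [tendsto_comap.eventually (eventually_gt_atTop (0 : ℝ))] with x hx
  rw [← ofReal_norm, ← ENNReal.ofReal_pow (norm_nonneg _),
    ← ENNReal.ofReal_div_of_pos (by positivity), Finset.sum_div]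
  simp only [div_pow]

theorem exists_isHarmonicCoordinate (hd : 1 ≤ d) (hP : IsShiftErgodic P) [IsProbabilityMeasure P]
    (hell : ∀ᵐ ω ∂P, ∀ b, |ω b - 1| ≤ ellipticGap d) : ∃ ψ, IsHarmonicCoordinate P ψ := by
  choose c hcoc hsub hharm using exists_coordinate_corrector hd hP hell
  let ψ : Config d → Vertex d → Vec d := fun ω x => WithLp.toLp 2 fun k => toVec x k - c k x ω
  have hcoc' : ∀ᵐ ω ∂P, ∀ k x y, c k y (shift x ω) = c k (x + y) ω - c k x ω := by
    simp only [ae_all_iff]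
    exact hcoc
  have hcov : ∀ᵐ ω ∂P, ψ ω 0 = 0 ∧ ∀ x y, ψ ω y - ψ ω x = ψ (shift x ω) (y - x) := by
    filter_upwards [hcoc'] with ω hω
    refine ⟨?_, fun x y => ?_⟩
    · ext k
      have := hω k 0 0
      rw [add_zero, sub_self, shift_zero] at this
      simp [ψ, this, toVec]
    · ext k
      simp only [ψ, PiLp.sub_apply, hω, toVec_sub, add_sub_cancel]
      ring
  -- Harmonicity at the origin is enough: shift covariance carries it to the countably many other
  -- vertices.
  have hharm0 : ∀ᵐ ω ∂P, laplacian ω (ψ ω) 0 = 0 := by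
    filter_upwards [hcov, ae_all_iff.2 hharm] with ω h1 h2
    ext k
    rw [laplacian_apply, PiLp.zero_apply, ← h2 k]
    simp only [laplacian, h1.1, PiLp.zero_apply, sub_zero, zero_add, zero_sub, smul_eq_mul]
    rfl
  have hmeas : ∀ x, AEMeasurable (fun ω => ψ ω x) P := fun x => by
    refine (WithLp.measurable_toLp 2 _).comp_aemeasurable (aemeasurable_pi_lambda _ fun k => ?_)
    exact (Lp.aestronglyMeasurable (c k x)).aemeasurable.const_sub _
  refine ⟨ψ, ⟨hmeas, ?_, hcov, ?_, ?_⟩⟩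
  · filter_upwards [ae_all_iff.2 fun x => hP.ae_shift x hharm0, hcov] with ω h1 h2 x
    rw [← h1 x]
    refine Finset.sum_congr rfl fun i _ => ?_
    have h3 : ψ (shift x ω) 0 = 0 := by rw [← sub_self x, ← h2.2, sub_self]
    rw [h2.2, h2.2, h3]
    simp [shift, sub_eq_add_neg]
  · have hb : ∀ᵐ ω ∂P, ∀ b, 3 / 4 ≤ ω b ∧ ω b ≤ 5 / 4 := by
      filter_upwards [hell] with ω hω b using bounds_of_near_one hd hω b
    have hfin : ∀ i, ∫⁻ ω, ‖ψ ω (e i)‖ₑ ^ 2 ∂P < ∞ := fun i => by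
      let w : Fin d → Lp ℝ 2 P := fun k =>
        (memLp_const (toVec (e i : Vertex d) k) : MemLp (fun _ : Config d => _) 2 P).toLp
      rw [lintegral_vec_sq (c := fun k => w k - c k (e i))]
      · exact ENNReal.ofReal_lt_top
      · rw [ae_all_iff]
        intro k
        filter_upwards [Lp.coeFn_sub (w k) (c k (e i)), (memLp_const (toVec (e i : Vertex d) k) :
          MemLp (fun _ : Config d => _) 2 P).coeFn_toLp] with ω h1 h2
        rw [h1, Pi.sub_apply, h2]
    calc ∫⁻ ω, ∑ i, ENNReal.ofReal (ω (0, i)) * ‖ψ ω (e i)‖ₑ ^ 2 ∂P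
        ≤ ∫⁻ ω, ∑ i, 2 * ‖ψ ω (e i)‖ₑ ^ 2 ∂P := by
          refine lintegral_mono_ae ?_
          filter_upwards [hb] with ω hω
          gcongr with i
          refine ENNReal.ofReal_le_of_le_toReal ?_
          rw [ENNReal.toReal_ofNat]
          linarith [(hω (0, i)).2]
      _ = ∑ i, 2 * ∫⁻ ω, ‖ψ ω (e i)‖ₑ ^ 2 ∂P := by
          rw [lintegral_finsetSum']
          · exact Finset.sum_congr rfl fun i _ => lintegral_const_mul' _ _ (by simp)
          · exact fun i _ => ((hmeas (e i)).enorm.pow_const 2).const_mul 2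
      _ < ∞ := ENNReal.sum_lt_top.2 fun i _ => ENNReal.mul_lt_top (by simp) (hfin i)
  · refine (tendsto_sq_div_of_sublinear (a := fun x k => ‖c k x‖) (fun _ _ => norm_nonneg _)
      fun k => hsub k).congr fun x => ?_
    rw [lintegral_vec_sq (c := fun k => c k x)]
    refine ae_of_all _ fun ω k => ?_
    simp [ψ]

end Existence

end RandomConductance

end

/-! ### Meyers' estimate with `p = 6` -/

theorem mainTheorem4 (d : ℕ) (hd : 1 ≤ d) :
    ∃ lam : ℝ, 0 < lam ∧ lam < 1 ∧
      ∀ (P : Measure (RandomConductance.Config d)) [IsProbabilityMeasure P],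
        RandomConductance.IsShiftErgodic P →
        (∀ᵐ ω ∂P, RandomConductance.IsElliptic lam ω) →
        (∃ ψ, RandomConductance.IsHarmonicCoordinate P ψ) ∧
        ∃ p : ℝ, 4 < p ∧
          ∀ ψ, RandomConductance.IsHarmonicCoordinate P ψ →
            RandomConductance.gradNorm P p ψ < ∞ ∧
            (⨆ (L : ℕ) (_ : 1 ≤ L),
              RandomConductance.boxGradNorm P (RandomConductance.box d L) p
                (fun ω x => RandomConductance.finiteVolumeCoordinate
                  (RandomConductance.box d L) ω x - ψ ω x)) < ∞ := by
  have hg := RandomConductance.ellipticGap_pos hd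
  -- With `ε = ellipticGap d`, this constant gives `1 / lam = 1 + ε` and `lam ≥ 1 - ε`, so
  -- ellipticity confines the conductances to within `ε` of `1`.
  refine ⟨1 / (1 + RandomConductance.ellipticGap d), by positivity,
    (div_lt_one (by positivity)).2 (by linarith), fun P _ hP hE => ?_⟩
  have hell : ∀ᵐ ω ∂P, ∀ b, |ω b - 1| ≤ RandomConductance.ellipticGap d := by
    filter_upwards [hE] with ω hω b
    obtain ⟨h1, h2⟩ := hω b
    rw [one_div_one_div] at h2
    rw [div_le_iff₀ (by positivity)] at h1
    rw [abs_le]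
    constructor <;> nlinarith
  refine ⟨RandomConductance.exists_isHarmonicCoordinate hd hP hell, 6, by norm_num,
    fun ψ hψ => ⟨hψ.gradNorm_lt_top hd hP hell, ?_⟩⟩
  refine lt_of_le_of_lt (iSup_le fun L => iSup_le fun hL =>
    hψ.boxGradNorm_le hd hP hell hL) ?_
  refine ENNReal.rpow_lt_top_of_nonneg (by norm_num) ?_
  finiteness
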